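/- Let $k$ be an algebraically closed field of characteristic $2$, let $\omega\in k$ satisfy $\omega^2+\omega+1=0$, and let $A_4\le A_5$ be the stabiliser of the point $5$. Modules are left modules; $\operatorname{rad}M$ is the intersection of the maximal submodules of $M$, $\operatorname{soc}M$ is the sum of its simple submodules, the radical layers of $M$ are the quotients $\operatorname{rad}^{n}M/\operatorname{rad}^{n+1}M$ ($n=0,1,\dots$, where $\operatorname{rad}^0M=M$ and $\operatorname{rad}^{n+1}M=\operatorname{rad}(\operatorname{rad}^nM)$), the head is $M/\operatorname{rad}M$, and $M$ is uniserial if its submodules are linearly ordered by inclusion. Let $S_1=k$ be the trivial $kA_5$-module and let $S_4\subseteq k^5$ be the submodule of vectors with coordinate sum $0$ in the permutation module. There is a representation $S_2:A_5\to \mathrm{SL}_2(k)$ that permutes the five lines of $k^2$ spanned by $(1,1),(1,\omega),(1,\omega^2),(1,0),(0,1)$ as $A_5$ permutes $1,2,3,4,5$; let $S_3$ be the one obtained by replacing $\omega$ by $\omega^2$. There are one-dimensional $kA_4$-modules $T_2,T_3$ on which $(1,2,3)$ acts by $\omega$, $\omega^2$ respectively; let $T_2^{A_5},T_3^{A_5}$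 be the induced $kA_5$-modules. Then the following hold. 1. $S_1,S_2,S_3,S_4$ are simple, of dimensions $1,2,2,4$, pairwise non-isomorphic, and every simple $kA_5$-module is isomorphic to one of them. 2. There are left ideals $P_1,P_2,P_3,P_4$ of $kA_5$, of dimensions $12,8,8,4$, that are projective indecomposable modules, pairwise non-isomorphic, such that $P_i$ has head isomorphic to $S_i$ and every finitely generated projective indecomposable $kA_5$-module is isomorphic to one of them, and as left modules $$kA_5\cong P_1\oplus P_2^{2}\oplus P_3^{2}\oplus P_4^{4}.$$ 3. $P_4\cong S_4$. $P_2$ is uniserial with radical layers $S_2,S_1,S_3,S_1,S_2$ (from the top), and $P_3$ is uniserial with radical layers $S_3,S_1,S_2,S_1,S_3$. 4. $T_2^{A_5}$ is uniserial with radical layers $S_3,S_1,S_2$, and $T_3^{A_5}$ is uniserial with radical layers $S_2,S_1,S_3$. 5. $\operatorname{soc}P_1\cong S_1$, $\operatorname{soc}P_1\subseteq\operatorname{rad}P_1$, $\operatorname{rad}P_1/\operatorname{soc}P_1\cong T_2^{A_5}\oplus T_3^{A_5}$, and the radical layers of $P_1$ are $S_1,\;S_3\oplus S_2,\;S_1\oplus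 S_1,\;S_2\oplus S_3,\;S_1$. 6. The Cartan matrix, whose $(i,j)$ entry is the multiplicity of $S_i$ as a composition factor of $P_j$, is $$\begin{pmatrix}4&2&2&0\\2&2&1&0\\2&1&2&0\\0&0&0&1\end{pmatrix}.$$ 7. $kA_5$ has exactly two blocks, i.e. exactly two ideals $kA_5e$ with $e$ a primitive idempotent of the centre. They are $kA_5e_1$ and $kA_5e_2$ with block idempotents satisfying $e_1e_2=0$, $e_1+e_2=1$, so that $kA_5=kA_5e_1\oplus kA_5e_2$; $P_1,P_2,P_3$ and the trivial module belong to $kA_5e_1$ and $P_4$ belongs to $kA_5e_2$ (where $M$ belongs to $kA_5e$ if $e$ acts as the identity on $M$). If $1=\sum_t f_t$ is any finite decomposition into orthogonal primitive idempotents of $kA_5$, then $e_1$ is the sum of the $f_t$ with $kA_5f_t$ isomorphic to $P_1$, $P_2$ or $P_3$, and $e_2$ is the sum of the $f_t$ with $kA_5f_t\cong P_4$. -/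

import Mathlib

open scoped MonoidAlgebra

universe u v

/-! ### Modules over a ring -/

section Modules

variable (A : Type*) [Ring A] (M : Type*) [AddCommGroup M] [Module A M]

/-- A nonzero module that is not the direct sum of two nonzero submodules. -/
def IsIndecomposableModule : Prop :=
  Nontrivial M ∧ ∀ N N' : Submodule A M, IsCompl N N' → N = ⊥ ∨ N' = ⊥

/-- The submodules are linearly ordered by inclusion. -/
def IsUniserialModule : Prop :=
  ∀ N N' : Submodule A M, N ≤ N' ∨ N' ≤ N

/-- The socle: the sum of all simple submodules. -/
def moduleSocle : Submodule A M :=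
  sSup {N : Submodule A M | IsSimpleModule A N}

/-- The radical series `rad⁰ M = M`, `radⁿ⁺¹ M = rad (radⁿ M)`; here `Module.jacobson` is the
intersection of all maximal submodules. -/
def radSeries : ℕ → Submodule A M
  | 0 => ⊤
  | n + 1 => (Module.jacobson A (radSeries n)).map (radSeries n).subtype

/-- The radical layer `radⁿ M / radⁿ⁺¹ M`; for `n = 0` this is the head of `M`. -/
abbrev RadLayer (n : ℕ) : Type _ :=
  radSeries A M n ⧸ (radSeries A M (n + 1)).submoduleOf (radSeries A M n)

/-- The heart `rad M / soc M` (meant for modules with `soc M ≤ rad M`). -/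
abbrev ModuleHeart : Type _ :=
  Module.jacobson A M ⧸ (moduleSocle A M).submoduleOf (Module.jacobson A M)

/-- `M` has a composition series, and in each composition series of `M` exactly `n` of the
factors are isomorphic to `S`. -/
def HasMultiplicity (S : Type*) [AddCommGroup S] [Module A S] (n : ℕ) : Prop :=
  (∃ s : CompositionSeries (Submodule A M), s.head = ⊥ ∧ s.last = ⊤) ∧
  ∀ s : CompositionSeries (Submodule A M), s.head = ⊥ → s.last = ⊤ →
    Nat.card {t : Fin s.length //
      Nonempty ((s t.succ ⧸ (s t.castSucc).submoduleOf (s t.succ)) ≃ₗ[A] S)} = n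

end Modules

/-! ### Idempotents and blocks -/

section Blocks

/-- A nonzero idempotent that is not the sum of two nonzero orthogonal idempotents. -/
def IsPrimitiveIdempotent {R : Type*} [Ring R] (e : R) : Prop :=
  IsIdempotentElem e ∧ e ≠ 0 ∧
  ∀ f g : R, IsIdempotentElem f → IsIdempotentElem g → f * g = 0 → g * f = 0 →
    e = f + g → f = 0 ∨ g = 0

/-- A block idempotent of `A`: a primitive idempotent of the centre of `A`. -/
def IsBlockIdempotent {A : Type*} [Ring A] (e : A) : Prop :=
  ∃ z : Subring.center A, (z : A) = e ∧ IsPrimitiveIdempotent z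

/-- The blocks of `A`: the ideals `A e` with `e` a block idempotent. -/
def blocks (A : Type*) [Ring A] : Set (Ideal A) :=
  {B | ∃ e : A, IsBlockIdempotent e ∧ B = Ideal.span {e}}

end Blocks

/-! ### The groups `A₅` and `A₄` and their modules; the points `1, …, 5` are `0, …, 4 : Fin 5` -/

/-- The alternating group on five points. -/
abbrev A5 : Type := alternatingGroup (Fin 5)

/-- The alternating group on four points, as the stabiliser of the last point in `A₅`. -/
abbrev A4 : Subgroup A5 := MulAction.stabilizer A5 (4 : Fin 5)

/-- The cycle `(1,2,3)` as an element of `A₅`. -/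
def cycle123 : A5 :=
  ⟨Equiv.swap 0 1 * Equiv.swap 1 2, by rw [Equiv.Perm.mem_alternatingGroup]; decide⟩

/-- The cycle `(1,2,3)` as an element of `A₄`. -/
def cycle123' : A4 :=
  ⟨cycle123, by rw [MulAction.mem_stabilizer_iff]; decide⟩

section Representations

variable {k : Type*} [Field k]

/-- Spanning vectors of five lines in `k²`; for `ω` a primitive cube root of unity in
characteristic `2` they represent the five points of the projective line over `𝔽₄ = {0,1,ω,ω²}`. -/
def linePoint (ω : k) : Fin 5 → Fin 2 → k :=
  ![![1, 1], ![1, ω], ![1, ω ^ 2], ![1, 0], ![0, 1]]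

/-- `ρ` is the two-dimensional representation of `A₅` by matrices of determinant one that permute
the five lines spanned by `linePoint ω` in the way `A₅` permutes the five points. -/
def IsProjectiveLineRep (ω : k) (ρ : Representation k A5 (Fin 2 → k)) : Prop :=
  (∀ g : A5, LinearMap.det (ρ g) = 1) ∧
  ∀ (g : A5) (i : Fin 5), ∃ c : k,
    ρ g (linePoint ω i) = c • linePoint ω ((g : Equiv.Perm (Fin 5)) i)

variable (k) in
/-- The permutation representation of `A₅` on `k⁵`. -/
def permRep : Representation k A5 (Fin 5 → k) where
  toFun g := LinearMap.funLeft k k ((g⁻¹ : A5) : Equiv.Perm (Fin 5))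
  map_one' := by ext; simp
  map_mul' g h := by ext; simp [LinearMap.funLeft]

variable (k) in
/-- The vectors with coordinate sum zero, as a subrepresentation of the permutation
representation. -/
def sumZeroSubrep : Subrepresentation (permRep k) where
  toSubmodule := LinearMap.ker (∑ i : Fin 5, LinearMap.proj (R := k) (φ := fun _ => k) i)
  apply_mem_toSubmodule g v hv := by
    simp only [LinearMap.mem_ker, LinearMap.sum_apply, LinearMap.proj_apply] at hv ⊢
    rw [← hv]
    exact Equiv.sum_comp ((g⁻¹ : A5) : Equiv.Perm (Fin 5)) v

/-- The four representations `S₁` (trivial), `S₂`, `S₃` (given), `S₄` (coordinate sum zero). -/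
noncomputable def fourReps (ρ₂ ρ₃ : Representation k A5 (Fin 2 → k)) : Fin 4 → Rep k A5 :=
  ![Rep.of (Representation.trivial k A5 k), Rep.of ρ₂, Rep.of ρ₃,
    Rep.of (sumZeroSubrep k).toRepresentation]

/-- The `k A₅`-module induced from a representation of `A₄`. -/
abbrev IndA5 {V : Type*} [AddCommGroup V] [Module k V] (τ : Representation k A4 V) : Type _ :=
  (Representation.ind A4.subtype τ).asModule

end Representations

/-- The matrix of Cartan invariants of `k A₅` in characteristic two. -/
def cartanA5 : Matrix (Fin 4) (Fin 4) ℕ :=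
  !![4, 2, 2, 0;
     2, 2, 1, 0;
     2, 1, 2, 0;
     0, 0, 0, 1]

/-! Up to Morita equivalence, the group algebra `A` of `A₅` is a small quiver algebra on three
vertices together with an isolated vertex, and every assertion can be read off from its paths. The
proof exhibits this structure inside `A` by explicit elements, and the dimension `60` then shows
that there is nothing else.

Nine pairs `u p`, `v p` split `1` into orthogonal idempotents whose four labels occur `1, 2, 2, 4`
times, and arrows between the labels `0, 1, 2` satisfy `αβ = γδ = 0` and `βαδγ = δγβα` (`A5.frame`).
All coefficients lie in the field with four elements, so these identities are finite checks.
Elements are coded as bit strings along a Hamiltonian path in the Cayley graph, and multiplication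
becomes repeated permutation of bit blocks and `xor` (`A5.ev_mul`, `A5.value_products`).

The listed paths are linearly independent, because multiplication by complementary paths leads to
nonzero socle elements. This bounds each Peirce component `e i * A * e j` from below by a Cartan
number. Counted with multiplicity, the bounds add up to exactly `60`, so the paths are bases
(`QuiverFrame.finrank_corner`). Hence the arrows are radical, and modulo the radical each `e i * A *
e i` is `k` while the mixed components vanish (`QuiverFrame.isSplit`). No prior count of simple
modules is needed: they correspond to labels (`IdempotentFrame.IsSplit.nonempty_equiv`), the
multiplicity of the one with label `i` in `M` is the dimension of `e i • M`
(`IdempotentFrame.IsSplit.hasMultiplicity`), and the `A e` are the projective indecomposables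
(`IdempotentFrame.IsSplit.exists_equiv_proj`).

Uniseriality comes from chains of homogeneous vectors, each a radical multiple of the preceding one.
Nakayama's lemma bounds the dimensions below by the labels, a count bounds them above, and equality
leaves no room for other submodules (`IdempotentFrame.IsRadChain`). For label `1` the chain follows
the path `αδγβ`; label `2` follows by symmetry (`QuiverFrame.swap`). In the projective module with
label `0`, the arrows `α` and `γ` generate two uniserial arms that meet exactly in the socle and
together form the radical (`QuiverFrame.coarm_inf_arm`). A five-dimensional module generated by a
vector of label `1` is unique up to isomorphism, which identifies the two summands of the heart with
induced modules (`QuiverFrame.nonempty_equiv_arm_quotient`).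

The blocks come from the zeros of the Cartan matrix, which make two sums of idempotents central. The
corner rings are local and the arrows connect the labels `0, 1, 2`, so neither sum splits further in
the centre. -/

/-! ### Frames of orthogonal idempotents -/

/-- A decomposition `1 = ∑ₚ uₚ vₚ` of the unit of a ring into orthogonal idempotents, where `uₚ vₚ`
is isomorphic to `e (σ p)` and the representatives `e i` are themselves among the summands. -/
structure IdempotentFrame (A : Type*) [Ring A] {P I : Type*} [Fintype P] [DecidableEq P]
    (σ : P → I) where
  /-- the representatives of the isomorphism classes -/
  e : I → A
  /-- the left factors -/
  u : P → A
  /-- the right factors -/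
  v : P → A
  /-- the position of the representatives -/
  base : I → P
  σ_base : ∀ i, σ (base i) = i
  u_base : ∀ i, u (base i) = e i
  v_base : ∀ i, v (base i) = e i
  v_mul_u : ∀ p q, v p * u q = if p = q then e (σ p) else 0
  sum_u_mul_v : ∑ p, u p * v p = 1

namespace IdempotentFrame

section Ring

variable {A : Type*} [Ring A] {P I : Type*} [Fintype P] [DecidableEq P] {σ : P → I}
  (F : IdempotentFrame A σ)

lemma u_mul_e (p : P) : F.u p * F.e (σ p) = F.u p := by
  conv_rhs => rw [← one_mul (F.u p), ← F.sum_u_mul_v, Finset.sum_mul]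
  simp [mul_assoc, F.v_mul_u]

lemma e_mul_v (p : P) : F.e (σ p) * F.v p = F.v p := by
  conv_rhs => rw [← mul_one (F.v p), ← F.sum_u_mul_v, Finset.mul_sum]
  simp [← mul_assoc, F.v_mul_u]

lemma e_mul_e (i : I) : F.e i * F.e i = F.e i := by
  simpa [F.u_base, F.σ_base] using F.u_mul_e (F.base i)

variable {M : Type*} [AddCommGroup M] [Module A M]

lemma sum_u_smul_v_smul (m : M) : ∑ p, F.u p • F.v p • m = m := by
  simp_rw [← mul_smul, ← Finset.sum_smul, F.sum_u_mul_v, one_smul]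

lemma e_smul_v_smul (p : P) (m : M) : F.e (σ p) • F.v p • m = F.v p • m := by
  rw [← mul_smul, F.e_mul_v]

lemma exists_v_smul_ne_zero {m : M} (hm : m ≠ 0) : ∃ p, F.v p • m ≠ 0 := by
  by_contra! h
  exact hm (by rw [← F.sum_u_smul_v_smul m]; simp [h])

lemma mem_of_v_smul_mem {N : Submodule A M} {m : M} (h : ∀ p, F.v p • m ∈ N) : m ∈ N := by
  rw [← F.sum_u_smul_v_smul m]
  exact N.sum_mem fun p _ => N.smul_mem _ (h p)

lemma mem_ideal_of_v_mul_mem {N : Ideal A} {a : A} (h : ∀ p, F.v p * a ∈ N) : a ∈ N :=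
  F.mem_of_v_smul_mem h

lemma exists_homogeneous [Nontrivial M] : ∃ (i : I) (x : M), x ≠ 0 ∧ F.e i • x = x := by
  obtain ⟨m, hm⟩ := exists_ne (0 : M)
  obtain ⟨p, hp⟩ := F.exists_v_smul_ne_zero hm
  exact ⟨σ p, F.v p • m, hp, F.e_smul_v_smul p m⟩

lemma exists_homogeneous_mem {N : Submodule A M} (hN : N ≠ ⊥) :
    ∃ (i : I) (x : M), x ∈ N ∧ x ≠ 0 ∧ F.e i • x = x := by
  obtain ⟨m, hm, hm0⟩ := N.exists_mem_ne_zero_of_ne_bot hN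
  obtain ⟨p, hp⟩ := F.exists_v_smul_ne_zero hm0
  exact ⟨σ p, F.v p • m, N.smul_mem _ hm, hp, F.e_smul_v_smul p m⟩

/-- `M` is simple and is not annihilated by `e i`. -/
def IsTop (i : I) (M : Type*) [AddCommGroup M] [Module A M] : Prop :=
  IsSimpleModule A M ∧ ∃ x : M, x ≠ 0 ∧ F.e i • x = x

variable {F} in
lemma IsTop.congr {i : I} {N : Type*} [AddCommGroup N] [Module A N]
    (h : F.IsTop i M) (f : M ≃ₗ[A] N) : F.IsTop i N := by
  obtain ⟨h, x, hx, hx'⟩ := h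
  refine ⟨IsSimpleModule.congr f.symm, f x, by simpa using hx, ?_⟩
  rw [← map_smul, hx']

lemma exists_isTop [IsSimpleModule A M] : ∃ i, F.IsTop i M := by
  have := IsSimpleModule.nontrivial A M
  obtain ⟨i, x, hx⟩ := F.exists_homogeneous (M := M)
  exact ⟨i, ‹_›, x, hx⟩

end Ring

/-! ### Dimensions of the homogeneous parts -/

section Dimension

variable {k A : Type*} [Field k] [Ring A] [Algebra k A] {P I : Type*} [Fintype P] [DecidableEq P]
  {σ : P → I} (F : IdempotentFrame A σ)
  {M : Type*} [AddCommGroup M] [Module k M] [Module A M]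
  [IsScalarTower k A M]

variable (k M) in
/-- The subspace `e i • M`. -/
def part (i : I) : Submodule k M :=
  have : SMulCommClass k A M := IsScalarTower.to_smulCommClass
  LinearMap.eqLocus (Module.toModuleEnd k (S := A) M (F.e i)) LinearMap.id

variable {F} in
lemma mem_part {i : I} {m : M} : m ∈ F.part k M i ↔ F.e i • m = m := Iff.rfl

lemma e_smul_mem_part (i : I) (m : M) : F.e i • m ∈ F.part k M i := by
  rw [mem_part, ← mul_smul, F.e_mul_e]

lemma v_smul_mem_part (p : P) (m : M) : F.v p • m ∈ F.part k M (σ p) := F.e_smul_v_smul p m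

lemma v_smul_u_smul {p q : P} {m : M} (hm : m ∈ F.part k M (σ q)) :
    F.v p • F.u q • m = if p = q then m else 0 := by
  rw [← mul_smul, F.v_mul_u]
  split_ifs with h
  · subst h; exact hm
  · exact zero_smul _ _

variable (k M) in
/-- A module is the direct sum of copies of its homogeneous parts. -/
def partEquiv : M ≃ₗ[k] (Π p, F.part k M (σ p)) :=
  have : SMulCommClass k A M := IsScalarTower.to_smulCommClass
  { toFun := fun m p => ⟨F.v p • m, F.v_smul_mem_part p m⟩
    map_add' := fun x y => by ext; simp
    map_smul' := fun c x => funext fun p => Subtype.ext (smul_comm (F.v p) c x)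
    invFun := fun x => ∑ p, F.u p • (x p : M)
    left_inv := F.sum_u_smul_v_smul
    right_inv := fun x => by
      ext p
      simp only [Finset.smul_sum]
      rw [Finset.sum_eq_single p]
      · rw [F.v_smul_u_smul (x p).2, if_pos rfl]
      · intro q _ hq
        rw [F.v_smul_u_smul (x q).2, if_neg hq.symm]
      · simp }

lemma finrank_eq_sum [Module.Finite k M] :
    Module.finrank k M = ∑ p, Module.finrank k (F.part k M (σ p)) := by
  rw [(F.partEquiv k M).finrank_eq, Module.finrank_pi_fintype]

lemma finrank_part_pos [Module.Finite k M] {i : I} {x : M} (hx : x ≠ 0) (hi : F.e i • x = x) :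
    0 < Module.finrank k (F.part k M i) := by
  rw [Module.finrank_pos_iff]
  exact ⟨⟨⟨x, hi⟩, 0, by simpa [Subtype.ext_iff] using hx⟩⟩

variable [DecidableEq I]

variable (σ) in
/-- The dimension of the simple module with label `i`. -/
def dim (i : I) : ℕ := Fintype.card {p // σ p = i}

lemma dim_pos (F : IdempotentFrame A σ) (i : I) : 0 < dim σ i :=
  Fintype.card_pos_iff.mpr ⟨⟨F.base i, F.σ_base i⟩⟩

variable (k M) in
lemma dim_mul_finrank_part (i : I) : dim σ i * Module.finrank k (F.part k M i) =
    ∑ p with σ p = i, Module.finrank k (F.part k M (σ p)) := by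
  rw [dim, Fintype.card_subtype, ← smul_eq_mul, ← Finset.sum_const]
  exact Finset.sum_congr rfl fun p hp => by rw [(Finset.mem_filter.mp hp).2]

variable (k M) in
lemma finrank_eq_sum_dim [Fintype I] [Module.Finite k M] :
    Module.finrank k M = ∑ i, dim σ i * Module.finrank k (F.part k M i) := by
  simp_rw [F.dim_mul_finrank_part k M]
  rw [F.finrank_eq_sum, ← Finset.sum_fiberwise (s := Finset.univ) (g := σ)]

/-- One nonzero vector in `e i • M` is transported by `u p` into an independent summand for every
`p` with label `i`. -/
lemma dim_le_finrank [Module.Finite k M] {i : I} {x : M} (hx : x ≠ 0) (hi : F.e i • x = x) :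
    dim σ i ≤ Module.finrank k M := by
  refine (Nat.le_mul_of_pos_right _ (F.finrank_part_pos (k := k) hx hi)).trans ?_
  rw [F.dim_mul_finrank_part k M, F.finrank_eq_sum]
  exact Finset.sum_le_sum_of_subset (Finset.subset_univ _)

lemma dim_add_dim_le_finrank [Module.Finite k M] {i j : I} (hij : i ≠ j) {x y : M}
    (hx : x ≠ 0) (hi : F.e i • x = x) (hy : y ≠ 0) (hj : F.e j • y = y) :
    dim σ i + dim σ j ≤ Module.finrank k M := by
  refine (Nat.add_le_add (Nat.le_mul_of_pos_right _ (F.finrank_part_pos (k := k) hx hi))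
    (Nat.le_mul_of_pos_right _ (F.finrank_part_pos (k := k) hy hj))).trans ?_
  rw [F.dim_mul_finrank_part k M, F.dim_mul_finrank_part k M, ← Finset.sum_union, F.finrank_eq_sum]
  · exact Finset.sum_le_sum_of_subset (Finset.subset_univ _)
  · rw [Finset.disjoint_filter]
    rintro p - rfl h
    exact hij h

end Dimension

end IdempotentFrame

/-! ### Dimension counts for submodules over a `k`-algebra -/

section Tower

variable {k A M : Type*} [Field k] [Ring A] [Algebra k A] [AddCommGroup M] [Module k M] [Module A M]
  [IsScalarTower k A M] [Module.Finite k M]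

lemma Submodule.finite_of_tower (N : Submodule A M) : Module.Finite k N :=
  inferInstanceAs (Module.Finite k (N.restrictScalars k))

lemma Submodule.eq_of_le_of_finrank_le_of_tower {N N' : Submodule A M} (h : N ≤ N')
    (h' : Module.finrank k N' ≤ Module.finrank k N) : N = N' :=
  Submodule.restrictScalars_injective k A M <|
    Submodule.eq_of_le_of_finrank_le (S₁ := N.restrictScalars k) (S₂ := N'.restrictScalars k) h h'

lemma Submodule.finrank_mono_of_tower {N N' : Submodule A M} (h : N ≤ N') :
    Module.finrank k N ≤ Module.finrank k N' :=
  Submodule.finrank_mono (s := N.restrictScalars k) (t := N'.restrictScalars k) h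

lemma Submodule.finrank_quotient_add_of_tower (N : Submodule A M) :
    Module.finrank k (M ⧸ N) + Module.finrank k N = Module.finrank k M :=
  Submodule.finrank_quotient_add_finrank (N.restrictScalars k)

lemma Submodule.finrank_submoduleOf_add {N N' : Submodule A M} (h : N ≤ N') :
    Module.finrank k (N' ⧸ N.submoduleOf N') + Module.finrank k N = Module.finrank k N' := by
  have := Submodule.finite_of_tower (k := k) N'
  rw [← (N.submoduleOf N').finrank_quotient_add_of_tower (k := k)]
  congr 1
  exact ((Submodule.submoduleOfEquivOfLe h).restrictScalars k).symm.finrank_eq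

end Tower

/-! ### Simplicity by dimension, and additivity of the homogeneous parts -/

namespace IdempotentFrame

section Simple

variable {k A : Type*} [Field k] [Ring A] [Algebra k A] {P I : Type*} [Fintype P] [DecidableEq P]
  {σ : P → I} (F : IdempotentFrame A σ)
  {M : Type*} [AddCommGroup M] [Module k M] [Module A M]
  [IsScalarTower k A M]

-- A nonzero submodule contains a homogeneous vector. If its label differed from `i`, both labels
-- would have to fit into a dimension that has room for `i` alone; so the label is `i` and the
-- submodule already has full dimension.
variable (k) in
lemma isTop_of_finrank_eq [DecidableEq I] [Module.Finite k M] {i : I} {x : M} (hx : x ≠ 0)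
    (hi : F.e i • x = x) (h : Module.finrank k M = dim σ i) : F.IsTop i M := by
  refine ⟨?_, x, hx, hi⟩
  have : Nontrivial M := ⟨⟨x, 0, hx⟩⟩
  refine { eq_bot_or_eq_top := fun N => or_iff_not_imp_left.mpr fun hN => ?_ }
  obtain ⟨j, y, hyN, hy, hj⟩ := F.exists_homogeneous_mem hN
  have hij : j = i := by
    by_contra hij
    have := F.dim_add_dim_le_finrank (k := k) hij hy hj hx hi
    have := F.dim_pos j
    omega
  subst hij
  refine Submodule.eq_of_le_of_finrank_le_of_tower (k := k) le_top ?_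
  rw [show Module.finrank k (⊤ : Submodule A M) = Module.finrank k M from
    (Submodule.topEquiv.restrictScalars k).finrank_eq, h]
  have := N.finite_of_tower (k := k)
  exact F.dim_le_finrank (k := k) (M := N) (x := ⟨y, hyN⟩) (by simpa [Subtype.ext_iff] using hy)
    (by ext; simpa using hj)

/-- The dimension of the homogeneous parts is additive. -/
lemma finrank_part_quotient_add [Module.Finite k M] (N : Submodule A M) (i : I) :
    Module.finrank k (F.part k (M ⧸ N) i) + Module.finrank k (F.part k N i) =
      Module.finrank k (F.part k M i) := by
  let f : F.part k M i →ₗ[k] F.part k (M ⧸ N) i :=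
    ((N.mkQ.restrictScalars k).domRestrict (F.part k M i)).codRestrict _ fun x => by
      rw [mem_part]
      simpa using congrArg N.mkQ x.2
  have hf : Function.Surjective f := by
    rintro ⟨y, hy⟩
    obtain ⟨m, rfl⟩ := N.mkQ_surjective y
    refine ⟨⟨F.e i • m, F.e_smul_mem_part i m⟩, Subtype.ext ?_⟩
    exact hy
  have g : F.part k N i ≃ₗ[k] LinearMap.ker f :=
    { toFun := fun x => ⟨⟨x, congrArg Subtype.val x.2⟩, by
        rw [LinearMap.mem_ker]
        ext
        simp [f]⟩
      map_add' := fun _ _ => rfl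
      map_smul' := fun _ _ => rfl
      invFun := fun x => ⟨⟨x, by
        exact (Submodule.Quotient.mk_eq_zero N).mp
          (congrArg Subtype.val (LinearMap.mem_ker.mp x.2))⟩, Subtype.ext x.1.2⟩
      left_inv := fun _ => rfl
      right_inv := fun _ => rfl }
  rw [g.finrank_eq, ← LinearMap.finrank_range_add_finrank_ker f, LinearMap.range_eq_top.mpr hf,
    finrank_top]

lemma finrank_part_congr {N : Type*} [AddCommGroup N] [Module k N] [Module A N]
    [IsScalarTower k A N] (f : M ≃ₗ[A] N) (i : I) :
    Module.finrank k (F.part k M i) = Module.finrank k (F.part k N i) := by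
  refine LinearEquiv.finrank_eq
    { toFun := fun x => ⟨f x, by rw [mem_part, ← map_smul, mem_part.mp x.2]⟩
      map_add' := fun _ _ => Subtype.ext (by simp)
      map_smul' := fun c x => Subtype.ext
        ((f.toLinearMap.restrictScalars k).map_smul c (x : M))
      invFun := fun x => ⟨f.symm x, by rw [mem_part, ← map_smul, mem_part.mp x.2]⟩
      left_inv := fun _ => Subtype.ext (by simp)
      right_inv := fun _ => Subtype.ext (by simp) }

lemma finrank_part_submodule_add [Module.Finite k M] {N N' : Submodule A M} (h : N ≤ N') (i : I) :
    Module.finrank k (F.part k (N' ⧸ N.submoduleOf N') i) + Module.finrank k (F.part k N i) =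
      Module.finrank k (F.part k N' i) := by
  have := N'.finite_of_tower (k := k)
  rw [← F.finrank_part_quotient_add (N.submoduleOf N'),
    F.finrank_part_congr (Submodule.submoduleOfEquivOfLe h)]

end Simple

end IdempotentFrame

/-! ### The radical series -/

section Radical

variable {A : Type*} [Ring A] {M : Type*} [AddCommGroup M] [Module A M]

lemma smul_eq_zero_of_mem_jacobson [IsSemisimpleModule A M] {a : A} (ha : a ∈ Ring.jacobson A)
    (m : M) : a • m = 0 :=
  Module.mem_annihilator.mp (IsSemisimpleModule.jacobson_le_annihilator A M ha) m

lemma mem_jacobson_of_forall_smul_eq_zero {a : A}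
    (h : ∀ m : Ideal A, IsSimpleModule A (A ⧸ m) → ∀ x : A ⧸ m, a • x = 0) :
    a ∈ Ring.jacobson A := by
  refine Submodule.mem_sInf.mpr fun m hm => ?_
  have := h m (isSimpleModule_iff_isCoatom.mpr hm) (Submodule.Quotient.mk 1)
  rw [← Submodule.Quotient.mk_smul, Submodule.Quotient.mk_eq_zero] at this
  simpa using this

/-- Nakayama's lemma. -/
lemma le_of_le_sup_jacobson_smul {N N' : Submodule A M} (hN' : N'.FG)
    (h : N' ≤ N ⊔ Ring.jacobson A • N') : N' ≤ N := by
  by_contra hle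
  have h1 : N'.map N.mkQ ≠ ⊥ := by
    rw [Ne, ← le_bot_iff, Submodule.map_le_iff_le_comap, Submodule.comap_bot, Submodule.ker_mkQ]
    exact hle
  refine absurd ?_ (Submodule.FG.jacobson_smul_lt h1 (hN'.map _)).not_ge
  calc N'.map N.mkQ ≤ (N ⊔ Ring.jacobson A • N').map N.mkQ := Submodule.map_mono h
    _ = Ring.jacobson A • N'.map N.mkQ := by
      rw [Submodule.map_sup, Submodule.mkQ_map_self, bot_sup_eq, Submodule.map_smul'']

lemma notMem_jacobson_smul_span {m : M} (hm : m ≠ 0) :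
    m ∉ Ring.jacobson A • Submodule.span A {m} := fun h =>
  absurd ((Submodule.span_singleton_le_iff_mem _ _).mpr h)
    (Submodule.FG.jacobson_smul_lt (by simpa using hm) (Submodule.fg_span_singleton m)).not_ge

lemma smul_mem_jacobson_smul_span {a : A} (ha : a ∈ Ring.jacobson A) (m : M) :
    a • m ∈ Ring.jacobson A • Submodule.span A {m} :=
  Submodule.smul_mem_smul ha (Submodule.mem_span_singleton_self m)

lemma jacobson_smul_le_of_isSemisimple {N N' : Submodule A M}
    [IsSemisimpleModule A (N ⧸ N'.submoduleOf N)] : Ring.jacobson A • N ≤ N' := by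
  refine Submodule.smul_le.mpr fun a ha m hm => ?_
  have := smul_eq_zero_of_mem_jacobson ha
    (Submodule.Quotient.mk ⟨m, hm⟩ : N ⧸ N'.submoduleOf N)
  rw [← Submodule.Quotient.mk_smul, Submodule.Quotient.mk_eq_zero] at this
  exact this

/-- Semisimplicity of `N / N'` puts the radical of `N` inside `N'`, and the radical of `N` always
contains `Ring.jacobson A • N`. Hence one generator count and one quotient check determine each term
of a radical series. -/
lemma radSeries_succ_eq {n : ℕ} {N N' : Submodule A M} (hn : radSeries A M n = N)
    (h : N' ≤ N) (h' : N' ≤ Ring.jacobson A • N)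
    (hs : IsSemisimpleModule A (N ⧸ N'.submoduleOf N)) : radSeries A M (n + 1) = N' := by
  subst hn
  change (Module.jacobson A (radSeries A M n)).map (radSeries A M n).subtype = N'
  refine le_antisymm ?_ ?_
  · refine (Submodule.map_mono (Module.jacobson_le_of_eq_bot (N := N'.submoduleOf _)
      (IsSemisimpleModule.jacobson_eq_bot A _))).trans ?_
    rw [Submodule.map_le_iff_le_comap]
    exact le_rfl
  · refine h'.trans ?_
    have : Ring.jacobson A • radSeries A M n =
        (Ring.jacobson A • (⊤ : Submodule A (radSeries A M n))).map (radSeries A M n).subtype := by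
      rw [Submodule.map_smul'', Submodule.map_subtype_top]
    rw [this]
    exact Submodule.map_mono (Ring.jacobson_smul_top_le A _)

end Radical

/-! ### Split frames and the left ideals `A e` -/

namespace IdempotentFrame

variable {k A : Type*} [Field k] [Ring A] [Algebra k A] {P I : Type*} [Fintype P] [DecidableEq P]
  {σ : P → I} (F : IdempotentFrame A σ)

variable (k) in
/-- Modulo the Jacobson radical, the ring of a split frame is a product of matrix rings over `k`. -/
structure IsSplit : Prop where
  off : ∀ (i j : I) (a : A), i ≠ j → F.e j * a * F.e i ∈ Ring.jacobson A
  diag : ∀ (i : I) (a : A), ∃ c : k, F.e i * a * F.e i - c • F.e i ∈ Ring.jacobson A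

/-- The projective module `A e`. -/
abbrev proj (i : I) : Ideal A := Ideal.span {F.e i}

/-- The generator of the projective module `A e`. -/
def gen (i : I) : F.proj i := ⟨F.e i, Ideal.subset_span rfl⟩

lemma mem_proj_iff {i : I} {a : A} : a ∈ F.proj i ↔ a * F.e i = a := by
  rw [Ideal.mem_span_singleton']
  refine ⟨?_, fun h => ⟨a, h⟩⟩
  rintro ⟨b, rfl⟩
  rw [mul_assoc, F.e_mul_e]

lemma span_gen (i : I) : Submodule.span A {F.gen i} = ⊤ := by
  refine eq_top_iff.mpr fun x _ => Submodule.mem_span_singleton.mpr ⟨x, Subtype.ext ?_⟩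
  exact F.mem_proj_iff.mp x.2

lemma e_smul_gen (i : I) : F.e i • F.gen i = F.gen i := Subtype.ext (F.e_mul_e i)

instance projective_proj (i : I) : Module.Projective A (F.proj i) := by
  refine Module.Projective.of_split (F.proj i).subtype
    ((LinearMap.toSpanSingleton A A (F.e i)).codRestrict (F.proj i) fun a =>
      Ideal.mul_mem_left _ _ (Ideal.subset_span rfl)) ?_
  ext x
  exact F.mem_proj_iff.mp x.2

/-! ### Homomorphisms from `A e` and the classification of simple modules -/

section Hom

variable {M : Type*} [AddCommGroup M] [Module A M]

/-- The homomorphism `A e → M` that maps `e` to `e x`. -/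
def homOfVector (i : I) (x : M) : F.proj i →ₗ[A] M :=
  (LinearMap.toSpanSingleton A M x).domRestrict (F.proj i)

@[simp]
lemma homOfVector_apply (i : I) (x : M) (a : F.proj i) : F.homOfVector i x a = (a : A) • x := rfl

lemma range_homOfVector {i : I} {x : M} (hx : F.e i • x = x) :
    LinearMap.range (F.homOfVector i x) = Submodule.span A {x} := by
  rw [LinearMap.range_eq_map, ← F.span_gen i, Submodule.map_span, Set.image_singleton]
  congr 2

lemma homOfVector_surjective [IsSimpleModule A M] {i : I} {x : M} (h0 : x ≠ 0)
    (hx : F.e i • x = x) : Function.Surjective (F.homOfVector i x) := by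
  rw [← LinearMap.range_eq_top, F.range_homOfVector hx]
  exact IsSimpleModule.span_singleton_eq_top A h0

variable {F} (hF : F.IsSplit k)

include hF

/-- Each `v p * a` lies in a Peirce component ending at `i`. Modulo the radical it is zero if the
labels differ and otherwise a scalar multiple of the idempotent, and that scalar must vanish because
`x` is nonzero. The annihilating elements of `A e` therefore do not depend on the simple module, so
its label determines it. -/
lemma IsSplit.smul_eq_zero_iff [IsSimpleModule A M] {i : I} {x : M} (h0 : x ≠ 0)
    (hx : F.e i • x = x) {a : A} (ha : a * F.e i = a) :
    a • x = 0 ↔ a ∈ Ring.jacobson A := by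
  refine ⟨fun h => F.mem_ideal_of_v_mul_mem fun p => ?_,
    fun h => smul_eq_zero_of_mem_jacobson h x⟩
  have hv : F.v p * a = F.e (σ p) * (F.v p * a) * F.e i := by
    rw [← mul_assoc, F.e_mul_v, mul_assoc, ha]
  by_cases hi : i = σ p
  · subst hi
    obtain ⟨c, hc⟩ := hF.diag (σ p) (F.v p * a)
    rw [← hv] at hc
    have h1 := smul_eq_zero_of_mem_jacobson hc x
    rw [sub_smul, mul_smul, h, smul_zero, zero_sub, neg_eq_zero] at h1
    have hc0 : c = 0 := by
      by_contra hc0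
      apply h0
      rw [← hx]
      have : F.e (σ p) = algebraMap k A c⁻¹ * (c • F.e (σ p)) := by
        rw [← Algebra.smul_def, smul_smul, inv_mul_cancel₀ hc0, one_smul]
      rw [this, mul_smul, h1, smul_zero]
    rwa [hc0, zero_smul, sub_zero] at hc
  · rw [hv]
    exact hF.off _ _ _ hi

lemma IsSplit.ker_homOfVector [IsSimpleModule A M] {i : I} {x : M} (h0 : x ≠ 0)
    (hx : F.e i • x = x) :
    LinearMap.ker (F.homOfVector i x) = (Ring.jacobson A).submoduleOf (F.proj i) := by
  ext a
  exact hF.smul_eq_zero_iff h0 hx (F.mem_proj_iff.mp a.2)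

lemma IsSplit.nonempty_equiv {i : I} {M' : Type*} [AddCommGroup M'] [Module A M']
    (h : F.IsTop i M) (h' : F.IsTop i M') : Nonempty (M ≃ₗ[A] M') := by
  obtain ⟨_, x, h0, hx⟩ := h
  obtain ⟨_, x', h0', hx'⟩ := h'
  exact ⟨((F.homOfVector i x).quotKerEquivOfSurjective (F.homOfVector_surjective h0 hx)).symm ≪≫ₗ
    Submodule.quotEquivOfEq _ _
      ((hF.ker_homOfVector h0 hx).trans (hF.ker_homOfVector h0' hx').symm) ≪≫ₗ
    (F.homOfVector i x').quotKerEquivOfSurjective (F.homOfVector_surjective h0' hx')⟩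

lemma IsSplit.e_smul_eq_zero {i j : I} (h : F.IsTop i M) (hij : i ≠ j) (y : M) :
    F.e j • y = 0 := by
  obtain ⟨_, x, h0, hx⟩ := h
  obtain ⟨a, rfl⟩ := F.homOfVector_surjective h0 hx y
  rw [homOfVector_apply, ← hx, ← mul_smul, ← mul_smul]
  exact smul_eq_zero_of_mem_jacobson (hF.off _ _ _ hij) x

lemma IsSplit.label_unique {i j : I} (h : F.IsTop i M) (h' : F.IsTop j M) : i = j := by
  by_contra hij
  obtain ⟨_, y, h0, hy⟩ := h'
  exact h0 (hy ▸ hF.e_smul_eq_zero h hij y)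

lemma IsSplit.e_smul_eq_smul [Module k M] [IsScalarTower k A M] [IsSimpleModule A M] {i : I} {x : M}
    (hx : F.e i • x = x) (a : A) : ∃ c : k, F.e i • a • x = c • x := by
  obtain ⟨c, hc⟩ := hF.diag i a
  refine ⟨c, ?_⟩
  have := smul_eq_zero_of_mem_jacobson hc x
  rwa [sub_smul, sub_eq_zero, mul_smul, hx, mul_smul, smul_assoc, hx] at this

end Hom

/-! ### Heads and the projective indecomposable modules -/

section Proj

variable {F} (hF : F.IsSplit k)

lemma fg_top_proj (i : I) : (⊤ : Submodule A (F.proj i)).FG := by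
  rw [← F.span_gen i]
  exact Submodule.fg_span_singleton _

instance finite_proj (i : I) : Module.Finite A (F.proj i) := ⟨fg_top_proj i⟩

include hF

/-- `A e` has a unique maximal submodule. -/
lemma IsSplit.eq_of_isCoatom {i : I} {N : Submodule A (F.proj i)} (hN : IsCoatom N) :
    N = (Ring.jacobson A).submoduleOf (F.proj i) := by
  have := isSimpleModule_iff_isCoatom.mpr hN
  have hx : F.e i • N.mkQ (F.gen i) = N.mkQ (F.gen i) := by rw [← map_smul, F.e_smul_gen]
  have h0 : N.mkQ (F.gen i) ≠ 0 := by
    intro h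
    apply hN.1
    rw [← top_le_iff, ← F.span_gen i, Submodule.span_singleton_le_iff_mem]
    simpa using h
  rw [← hF.ker_homOfVector h0 hx]
  ext a
  rw [LinearMap.mem_ker, homOfVector_apply, ← map_smul]
  have : (a : A) • F.gen i = a := Subtype.ext (F.mem_proj_iff.mp a.2)
  rw [this]
  simp

lemma IsSplit.isCoatom {i : I} (hi : F.e i ≠ 0) :
    IsCoatom ((Ring.jacobson A).submoduleOf (F.proj i)) := by
  have : Nontrivial (F.proj i) := ⟨⟨F.gen i, 0, fun h => hi (congrArg Subtype.val h)⟩⟩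
  obtain ⟨N, hN, -⟩ := (eq_top_or_exists_le_coatom (⊥ : Submodule A (F.proj i))).resolve_left
    bot_ne_top
  rwa [hF.eq_of_isCoatom hN] at hN

lemma IsSplit.le_of_ne_top {i : I} {N : Submodule A (F.proj i)} (hN : N ≠ ⊤) :
    N ≤ (Ring.jacobson A).submoduleOf (F.proj i) := by
  obtain ⟨N', hN', h⟩ := (eq_top_or_exists_le_coatom N).resolve_left hN
  rwa [hF.eq_of_isCoatom hN'] at h

lemma IsSplit.gen_notMem {i : I} (hi : F.e i ≠ 0) :
    F.gen i ∉ (Ring.jacobson A).submoduleOf (F.proj i) := fun h =>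
  (hF.isCoatom hi).1 (top_le_iff.mp (by
    rwa [← F.span_gen i, Submodule.span_singleton_le_iff_mem]))

lemma IsSplit.isTop_proj_quotient {i : I} (hi : F.e i ≠ 0) :
    F.IsTop i (F.proj i ⧸ (Ring.jacobson A).submoduleOf (F.proj i)) := by
  refine ⟨isSimpleModule_iff_isCoatom.mpr (hF.isCoatom hi), Submodule.Quotient.mk (F.gen i), ?_, ?_⟩
  · rw [Ne, Submodule.Quotient.mk_eq_zero]
    exact hF.gen_notMem hi
  · rw [← Submodule.Quotient.mk_smul, F.e_smul_gen]

lemma IsSplit.isIndecomposableModule_proj {i : I} (hi : F.e i ≠ 0) :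
    IsIndecomposableModule A (F.proj i) := by
  refine ⟨⟨⟨F.gen i, 0, fun h => hi (congrArg Subtype.val h)⟩⟩, fun N N' h => ?_⟩
  by_cases hN : N = ⊤
  · right
    simpa [hN] using h.disjoint.symm
  by_cases hN' : N' = ⊤
  · left
    simpa [hN'] using h.disjoint
  exact absurd (top_le_iff.mp (h.sup_eq_top ▸ sup_le (hF.le_of_ne_top hN) (hF.le_of_ne_top hN')))
    (hF.isCoatom hi).1

/-- A homomorphism to `A e` that is nonzero modulo the radical is surjective. -/
lemma IsSplit.surjective_of_not_le {i : I} {M : Type*} [AddCommGroup M] [Module A M]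
    {f : M →ₗ[A] F.proj i} {m : M} (hm : f m ∉ (Ring.jacobson A).submoduleOf (F.proj i)) :
    Function.Surjective f := by
  rw [← LinearMap.range_eq_top]
  by_contra h
  exact hm (hF.le_of_ne_top h ⟨m, rfl⟩)

/-- Every finitely generated projective indecomposable module is isomorphic to some `A e`. -/
lemma IsSplit.exists_equiv_proj {M : Type*} [AddCommGroup M] [Module A M]
    [Module.Finite A M] [Module.Projective A M] (hM : IsIndecomposableModule A M) :
    ∃ i, Nonempty (M ≃ₗ[A] F.proj i) := by
  have := hM.1
  obtain ⟨N, hN, -⟩ := (eq_top_or_exists_le_coatom (⊥ : Submodule A M)).resolve_left bot_ne_top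
  have := isSimpleModule_iff_isCoatom.mpr hN
  obtain ⟨i, -, x, h0, hx⟩ := F.exists_isTop (M := M ⧸ N)
  refine ⟨i, ?_⟩
  obtain ⟨f, hf⟩ := Module.projective_lifting_property (F.homOfVector i x) N.mkQ
    (F.homOfVector_surjective h0 hx)
  obtain ⟨m, hm⟩ := N.mkQ_surjective x
  have hsurj : Function.Surjective f := by
    refine hF.surjective_of_not_le (m := m) ?_
    rw [← hF.ker_homOfVector h0 hx, LinearMap.mem_ker, ← LinearMap.comp_apply, hf, hm]
    exact h0
  -- `f` is onto because its image is not contained in the only maximal submodule. It splits since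
  -- `A e` is projective, and indecomposability of `M` then leaves no room for a kernel.
  obtain ⟨g, hg⟩ := Module.projective_lifting_property f LinearMap.id hsurj
  have hcompl := LinearMap.isCompl_of_proj (p := LinearMap.range g) (f := g.rangeRestrict ∘ₗ f) (by
    rintro ⟨_, y, rfl⟩
    ext
    simpa using congrArg g (LinearMap.congr_fun hg y))
  have hker : LinearMap.ker (g.rangeRestrict ∘ₗ f) = LinearMap.ker f := by
    refine LinearMap.ker_comp_of_ker_eq_bot f (LinearMap.ker_eq_bot.mpr ?_)
    refine (LinearMap.injective_rangeRestrict_iff g).mpr ?_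
    exact Function.LeftInverse.injective (g := f) fun y => LinearMap.congr_fun hg y
  rw [hker] at hcompl
  refine ⟨LinearEquiv.ofBijective f ⟨LinearMap.ker_eq_bot.mp ?_, hsurj⟩⟩
  refine (hM.2 _ _ hcompl).resolve_left fun h => h0 ?_
  rw [← hm, ← hf, LinearMap.comp_apply, show f m = 0 from ?_, map_zero]
  have h1 : g (f m) = 0 := by
    rw [← Submodule.mem_bot A, ← h]
    exact ⟨_, rfl⟩
  rw [show f m = f (g (f m)) from (LinearMap.congr_fun hg (f m)).symm, h1, map_zero]

end Proj

/-! ### Chains of cyclic submodules -/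

section Chain

variable [DecidableEq I] {M : Type*} [AddCommGroup M] [Module k M] [Module A M]
  [IsScalarTower k A M]

variable (k) in
/-- Homogeneous vectors `m 0, …, m (n - 1)`, each obtained from the preceding one by an element of
the radical, whose labels account for the whole dimension of the module generated by `m 0`. -/
structure IsRadChain (n : ℕ) (m : ℕ → M) (l : ℕ → I) : Prop where
  homogeneous : ∀ t < n, F.e (l t) • m t = m t
  ne_zero : ∀ t < n, m t ≠ 0
  eq_zero : m n = 0
  step : ∀ t < n, m (t + 1) ∈ Ring.jacobson A • Submodule.span A {m t}
  finrank_le : Module.finrank k (Submodule.span A {m 0}) ≤ ∑ t ∈ Finset.range n, dim σ (l t)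

namespace IsRadChain

variable {F} {n : ℕ} {m : ℕ → M} {l : ℕ → I} (h : F.IsRadChain k n m l)

include h

lemma span_le {t : ℕ} (ht : t < n) :
    Submodule.span A {m (t + 1)} ≤ Submodule.span A {m t} :=
  (Submodule.span_singleton_le_iff_mem _ _).mpr (Submodule.smul_le_right (h.step t ht))

lemma mk_ne_zero {t : ℕ} (ht : t < n) :
    (Submodule.Quotient.mk ⟨m t, Submodule.mem_span_singleton_self _⟩ :
      Submodule.span A {m t} ⧸
        (Submodule.span A {m (t + 1)}).submoduleOf (Submodule.span A {m t})) ≠ 0 := by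
  rw [Ne, Submodule.Quotient.mk_eq_zero]
  intro hmem
  refine notMem_jacobson_smul_span (A := A) (h.ne_zero t ht) ?_
  exact (Submodule.span_singleton_le_iff_mem _ _).mpr (h.step t ht) hmem

lemma mk_homogeneous {t : ℕ} (ht : t < n) :
    F.e (l t) • (Submodule.Quotient.mk ⟨m t, Submodule.mem_span_singleton_self _⟩ :
      Submodule.span A {m t} ⧸
        (Submodule.span A {m (t + 1)}).submoduleOf (Submodule.span A {m t})) =
      Submodule.Quotient.mk ⟨m t, Submodule.mem_span_singleton_self _⟩ := by
  rw [← Submodule.Quotient.mk_smul]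
  congr 1
  exact Subtype.ext (h.homogeneous t ht)

lemma span_antitone {s t : ℕ} (hst : s ≤ t) (ht : t ≤ n) :
    Submodule.span A {m t} ≤ Submodule.span A {m s} := by
  induction hst with
  | refl => exact le_rfl
  | step _ ih => exact (h.span_le ht).trans (ih (Nat.le_of_succ_le ht))

variable [Module.Finite k M]

include h

lemma finrank_add_le {t : ℕ} (ht : t < n) :
    Module.finrank k (Submodule.span A {m (t + 1)}) + dim σ (l t) ≤
      Module.finrank k (Submodule.span A {m t}) := by
  rw [← Submodule.finrank_submoduleOf_add (k := k) (h.span_le ht), add_comm]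
  have := (Submodule.span A {m t}).finite_of_tower (k := k)
  gcongr
  exact F.dim_le_finrank (k := k) (h.mk_ne_zero ht) (h.mk_homogeneous ht)

lemma finrank_add_sum_le {t : ℕ} (ht : t ≤ n) :
    Module.finrank k (Submodule.span A {m t}) + ∑ s ∈ Finset.range t, dim σ (l s) ≤
      Module.finrank k (Submodule.span A {m 0}) := by
  induction t with
  | zero => simp
  | succ t ih =>
    rw [Finset.sum_range_succ]
    have := h.finrank_add_le ht
    have := ih (by omega)
    omega

lemma le_finrank {t : ℕ} (ht : t ≤ n) :
    ∑ s ∈ Finset.Ico t n, dim σ (l s) ≤ Module.finrank k (Submodule.span A {m t}) := by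
  induction ht using Nat.decreasingInduction with
  | self => simp
  | of_succ t ht ih =>
    rw [Finset.sum_eq_sum_Ico_succ_bot ht, add_comm]
    exact (Nat.add_le_add_right ih _).trans (h.finrank_add_le ht)

/-- By Nakayama's lemma each step of the chain costs at least the dimension of its label. The total
is at most the sum of all labels, so no step can cost more. -/
lemma finrank_eq {t : ℕ} (ht : t ≤ n) :
    Module.finrank k (Submodule.span A {m t}) = ∑ s ∈ Finset.Ico t n, dim σ (l s) := by
  refine le_antisymm ?_ (h.le_finrank ht)
  have h1 := h.finrank_add_sum_le ht
  have h2 := h.finrank_le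
  rw [← Finset.sum_range_add_sum_Ico _ ht] at h2
  omega

lemma isTop {t : ℕ} (ht : t < n) : F.IsTop (l t) (Submodule.span A {m t} ⧸
    (Submodule.span A {m (t + 1)}).submoduleOf (Submodule.span A {m t})) := by
  have := (Submodule.span A {m t}).finite_of_tower (k := k)
  refine F.isTop_of_finrank_eq k (h.mk_ne_zero ht) (h.mk_homogeneous ht) ?_
  have := Submodule.finrank_submoduleOf_add (k := k) (h.span_le ht)
  rw [h.finrank_eq (t := t + 1) ht, h.finrank_eq ht.le, Finset.sum_eq_sum_Ico_succ_bot ht] at this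
  omega

lemma jacobson_smul {t : ℕ} (ht : t < n) :
    Ring.jacobson A • Submodule.span A {m t} = Submodule.span A {m (t + 1)} := by
  have := (h.isTop ht).1
  exact le_antisymm jacobson_smul_le_of_isSemisimple
    ((Submodule.span_singleton_le_iff_mem _ _).mpr (h.step t ht))

/-- `N ⊔ span {m (t + 1)}` is one of two neighbouring terms, as the quotient is simple. If it is the
lower one, the search continues there; if it is the upper one, `N` covers the head of `span {m t}`
and Nakayama's lemma makes it everything. -/
lemma exists_eq_span_of_le {t : ℕ} (ht : t ≤ n) {N : Submodule A M}
    (hN : N ≤ Submodule.span A {m t}) : ∃ s, t ≤ s ∧ s ≤ n ∧ N = Submodule.span A {m s} := by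
  induction ht using Nat.decreasingInduction with
  | self => exact ⟨n, le_rfl, le_rfl, by simpa [h.eq_zero] using hN⟩
  | of_succ t ht ih =>
    have hcov := (covBy_iff_quot_is_simple (h.span_le ht)).mpr (h.isTop ht).1
    rcases hcov.eq_or_eq le_sup_right (sup_le hN (h.span_le ht)) with h1 | h1
    · obtain ⟨s, hs, hs', rfl⟩ := ih (sup_eq_right.mp h1)
      exact ⟨s, by omega, hs', rfl⟩
    · refine ⟨t, le_rfl, ht.le, le_antisymm hN ?_⟩
      refine le_of_le_sup_jacobson_smul (Submodule.fg_span_singleton _) ?_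
      rw [h.jacobson_smul ht, h1]

variable (h0 : Submodule.span A {m 0} = ⊤)

include h0

lemma isUniserialModule : IsUniserialModule A M := by
  intro N N'
  obtain ⟨s, -, hs, rfl⟩ := h.exists_eq_span_of_le (Nat.zero_le n) (N := N) (h0 ▸ le_top)
  obtain ⟨s', -, hs', rfl⟩ := h.exists_eq_span_of_le (Nat.zero_le n) (N := N') (h0 ▸ le_top)
  rcases le_total s s' with hss | hss
  · exact Or.inr (h.span_antitone hss hs')
  · exact Or.inl (h.span_antitone hss hs)

lemma radSeries_eq {t : ℕ} (ht : t ≤ n) : radSeries A M t = Submodule.span A {m t} := by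
  induction t with
  | zero => exact h0.symm
  | succ t ih =>
    have := (h.isTop ht).1
    exact radSeries_succ_eq (ih (by omega)) (h.span_le ht) (h.jacobson_smul ht).ge inferInstance

lemma radSeries_eq_bot : radSeries A M n = ⊥ := by
  rw [h.radSeries_eq h0 le_rfl, h.eq_zero, Submodule.span_zero_singleton]

lemma isTop_radLayer {t : ℕ} (ht : t < n) : F.IsTop (l t) (RadLayer A M t) := by
  change F.IsTop (l t) (radSeries A M t ⧸ (radSeries A M (t + 1)).submoduleOf (radSeries A M t))
  rw [h.radSeries_eq h0 (t := t + 1) ht, h.radSeries_eq h0 ht.le]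
  exact h.isTop ht

end IsRadChain

end Chain

/-! ### Multiplicities of composition factors -/

section Multiplicity

variable {F} (hF : F.IsSplit k)
  {M : Type*} [AddCommGroup M] [Module k M] [Module A M]
  [IsScalarTower k A M]

include hF

lemma IsSplit.finrank_part_isTop [Module.Finite k M] {i : I} (h : F.IsTop i M) :
    Module.finrank k (F.part k M i) = 1 := by
  obtain ⟨hs, x, h0, hx⟩ := h
  refine (finrank_eq_one_iff_of_nonzero' (⟨x, hx⟩ : F.part k M i)
    (by simpa [Subtype.ext_iff] using h0)).mpr ?_
  rintro ⟨y, hy⟩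
  obtain ⟨a, rfl⟩ := F.homOfVector_surjective h0 hx y
  obtain ⟨c, hc⟩ := hF.e_smul_eq_smul hx (a : A)
  refine ⟨c, Subtype.ext ?_⟩
  rw [homOfVector_apply] at hy
  exact hc.symm.trans hy

lemma IsSplit.finrank_part_eq_ite [Module.Finite k M] [IsSimpleModule A M] {S : Type*}
    [AddCommGroup S] [Module A S] {i : I} (hS : F.IsTop i S) [Decidable (Nonempty (M ≃ₗ[A] S))] :
    Module.finrank k (F.part k M i) = if Nonempty (M ≃ₗ[A] S) then 1 else 0 := by
  split_ifs with h
  · obtain ⟨f⟩ := h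
    exact hF.finrank_part_isTop (hS.congr f.symm)
  · obtain ⟨j, hj⟩ := F.exists_isTop (M := M)
    have hij : j ≠ i := by
      rintro rfl
      exact h (hF.nonempty_equiv hj hS)
    have : F.part k M i = ⊥ := by
      refine (Submodule.eq_bot_iff _).mpr fun x hx => ?_
      rw [← mem_part.mp hx, hF.e_smul_eq_zero hj hij]
    rw [this, finrank_bot]

/-- The multiplicity of a simple module as a composition factor is the dimension of the
corresponding homogeneous part. -/
lemma IsSplit.hasMultiplicity [Module.Finite k M] {S : Type*} [AddCommGroup S] [Module A S] {i : I}
    (hS : F.IsTop i S) : HasMultiplicity A M S (Module.finrank k (F.part k M i)) := by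
  classical
  have : IsNoetherian A M := isNoetherian_of_tower k inferInstance
  have : IsArtinian A M := isArtinian_of_tower k inferInstance
  refine ⟨exists_compositionSeries_of_isNoetherian_isArtinian A M, fun s hs hs' => ?_⟩
  let c (t : Fin s.length) : ℕ :=
    if Nonempty ((s t.succ ⧸ (s t.castSucc).submoduleOf (s t.succ)) ≃ₗ[A] S) then 1 else 0
  -- Along the series the dimension of `e i • s n` grows by `1` when the next factor is isomorphic
  -- to `S` and by `0` otherwise.
  have key (n : ℕ) (hn : n < s.length + 1) :
      Module.finrank k (F.part k (s ⟨n, hn⟩) i) = ∑ t : Fin n, c ⟨t, by omega⟩ := by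
    induction n with
    | zero =>
      have h0 : s ⟨0, hn⟩ = ⊥ := hs
      have : Subsingleton (F.part k (s ⟨0, hn⟩) i) := by
        rw [h0]
        infer_instance
      exact Module.finrank_zero_of_subsingleton
    | succ n ih =>
      let t : Fin s.length := ⟨n, by omega⟩
      have hcov : s t.castSucc ⋖ s t.succ := s.step t
      have : IsSimpleModule A (s t.succ ⧸ (s t.castSucc).submoduleOf (s t.succ)) :=
        (covBy_iff_quot_is_simple hcov.le).mp hcov
      have hfin := (s t.succ).finite_of_tower (k := k)
      have h1 := F.finrank_part_submodule_add (k := k) hcov.le i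
      have h2 : Module.finrank k (F.part k (s t.castSucc) i) = _ := ih (by omega)
      rw [hF.finrank_part_eq_ite hS, h2] at h1
      rw [Fin.sum_univ_castSucc]
      exact h1.symm.trans (add_comm _ _)
  have h1 := key s.length (by omega)
  have h2 : s ⟨s.length, by omega⟩ = ⊤ := hs'
  rw [h2, F.finrank_part_congr Submodule.topEquiv] at h1
  rw [h1, Nat.card_eq_fintype_card, Fintype.card_subtype, Finset.card_filter]

end Multiplicity

end IdempotentFrame

namespace IdempotentFrame

variable {k A : Type*} [Field k] [Ring A] [Algebra k A] {P I : Type*} [Fintype P] [DecidableEq P]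
  {σ : P → I} (F : IdempotentFrame A σ)

/-! ### The Peirce decomposition -/

variable (k) in
/-- The subspace `e i * A * e j`. -/
def corner (i j : I) : Submodule k A where
  carrier := {x | F.e i * x = x ∧ x * F.e j = x}
  add_mem' := fun ⟨ha, ha'⟩ ⟨hb, hb'⟩ => ⟨by rw [mul_add, ha, hb], by rw [add_mul, ha', hb']⟩
  zero_mem' := by simp
  smul_mem' := fun c x ⟨h, h'⟩ => ⟨by rw [mul_smul_comm, h], by rw [smul_mul_assoc, h']⟩

variable {F} in
lemma mem_corner {i j : I} {x : A} : x ∈ F.corner k i j ↔ F.e i * x = x ∧ x * F.e j = x := Iff.rfl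

lemma e_mul_mul_e_mem_corner (i j : I) (a : A) : F.e i * a * F.e j ∈ F.corner k i j :=
  ⟨by rw [← mul_assoc, ← mul_assoc, F.e_mul_e], by rw [mul_assoc, F.e_mul_e]⟩

lemma v_mul_mul_u_mem_corner (p q : P) (a : A) : F.v p * a * F.u q ∈ F.corner k (σ p) (σ q) :=
  ⟨by rw [← mul_assoc, ← mul_assoc, F.e_mul_v], by rw [mul_assoc, F.u_mul_e]⟩

variable (k) in
/-- An algebra is the direct sum of copies of its Peirce components. -/
def cornerEquiv : A ≃ₗ[k] (Π p q, F.corner k (σ p) (σ q)) where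
  toFun a p q := ⟨F.v p * a * F.u q, F.v_mul_mul_u_mem_corner p q a⟩
  map_add' x y := by ext; simp [mul_add, add_mul]
  map_smul' c x := by ext; simp
  invFun x := ∑ p, ∑ q, F.u p * x p q * F.v q
  left_inv a := by
    calc ∑ p, ∑ q, F.u p * (F.v p * a * F.u q) * F.v q
        = (∑ p, F.u p * F.v p) * a * ∑ q, F.u q * F.v q := by
          simp_rw [Finset.sum_mul, Finset.mul_sum, mul_assoc]
      _ = a := by rw [F.sum_u_mul_v, one_mul, mul_one]
  right_inv x := by
    ext p q
    have (p' q' : P) : F.v p * (F.u p' * x p' q' * F.v q') * F.u q =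
        if p = p' then if q' = q then (x p' q' : A) else 0 else 0 := by
      calc F.v p * (F.u p' * x p' q' * F.v q') * F.u q
          = (F.v p * F.u p') * x p' q' * (F.v q' * F.u q) := by simp_rw [mul_assoc]
        _ = _ := by
          rw [F.v_mul_u, F.v_mul_u]
          split_ifs with h h'
          · subst h
            rw [(x p q').2.1, (x p q').2.2]
          all_goals simp
    simp_rw [Finset.mul_sum, Finset.sum_mul, this]
    simp

lemma finrank_eq_sum_corner [Module.Finite k A] :
    Module.finrank k A = ∑ p, ∑ q, Module.finrank k (F.corner k (σ p) (σ q)) := by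
  rw [(F.cornerEquiv k).finrank_eq, Module.finrank_pi_fintype]
  exact Finset.sum_congr rfl fun p _ => Module.finrank_pi_fintype k

/-- The homogeneous parts of `A e` are Peirce components. -/
def partProjEquiv (i j : I) : F.part k (F.proj j) i ≃ₗ[k] F.corner k i j where
  toFun x := ⟨x, congrArg Subtype.val x.2, F.mem_proj_iff.mp x.1.2⟩
  map_add' _ _ := rfl
  map_smul' _ _ := rfl
  invFun x := ⟨⟨x, F.mem_proj_iff.mpr x.2.2⟩, Subtype.ext x.2.1⟩
  left_inv _ := rfl
  right_inv _ := rfl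

lemma finrank_part_proj (i j : I) :
    Module.finrank k (F.part k (F.proj j) i) = Module.finrank k (F.corner k i j) :=
  (F.partProjEquiv i j).finrank_eq

/-- An element of a Peirce component is in the radical if it has only nilpotent products. -/
lemma mem_jacobson_of_isNilpotent {i j : I} {x : A} (hx : x * F.e i = x) (hx' : F.e j * x = x)
    (h : ∀ y ∈ F.corner k i j, IsNilpotent (y * x)) : x ∈ Ring.jacobson A := by
  refine mem_jacobson_of_forall_smul_eq_zero fun m hm w => ?_
  by_contra h0
  -- If `x` did not kill the simple module, some `y` would carry `x • w` back to `e i • w`. The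
  -- nilpotent element `e i * y * e j * x` would then fix `e i • w`, which forces that vector, and
  -- with it `x • w`, to vanish.
  obtain ⟨y, hy⟩ := Submodule.mem_span_singleton.mp
    (IsSimpleModule.span_singleton_eq_top A h0 ▸ Submodule.mem_top : F.e i • w ∈ _)
  have h1 : (F.e i * y * F.e j * x) • F.e i • w = F.e i • w := by
    rw [mul_assoc, hx', mul_smul, ← mul_smul x, hx, mul_smul, hy, ← mul_smul, F.e_mul_e]
  obtain ⟨n, hn⟩ := h _ (F.e_mul_mul_e_mem_corner i j y)
  have h2 (n : ℕ) : (F.e i * y * F.e j * x) ^ n • F.e i • w = F.e i • w := by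
    induction n with
    | zero => simp
    | succ n ih => rw [pow_succ, mul_smul, h1, ih]
  have h3 := h2 n
  rw [hn, zero_smul] at h3
  apply h0
  rw [← hx, mul_smul, ← h3, smul_zero]

end IdempotentFrame

/-! ### Frames with the quiver of the group algebra of `A₅` -/

/-- The labels of the nine summands of the regular module. -/
abbrev label : Fin 9 → Fin 4 := ![0, 1, 1, 2, 2, 3, 3, 3, 3]

/-- A frame together with arrows `α : 0 → 1`, `β : 1 → 0`, `γ : 0 → 2`, `δ : 2 → 0` subject to the
relations `αβ = 0`, `γδ = 0`, `βαδγ = δγβα`, and with nonzero socle elements. -/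
structure QuiverFrame (A : Type*) [Ring A] extends IdempotentFrame A label where
  /-- the arrow from `0` to `1` -/
  α : A
  /-- the arrow from `1` to `0` -/
  β : A
  /-- the arrow from `0` to `2` -/
  γ : A
  /-- the arrow from `2` to `0` -/
  δ : A
  e_α : e 1 * α = α
  α_e : α * e 0 = α
  e_β : e 0 * β = β
  β_e : β * e 1 = β
  e_γ : e 2 * γ = γ
  γ_e : γ * e 0 = γ
  e_δ : e 0 * δ = δ
  δ_e : δ * e 2 = δ
  α_β : α * β = 0
  γ_δ : γ * δ = 0
  β_α_δ_γ : β * (α * (δ * γ)) = δ * (γ * (β * α))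
  δ_γ_β_α_ne_zero : δ * (γ * (β * α)) ≠ 0
  α_δ_γ_β_ne_zero : α * (δ * (γ * β)) ≠ 0
  γ_β_α_δ_ne_zero : γ * (β * (α * δ)) ≠ 0
  e_ne_zero : ∀ i, e i ≠ 0

namespace QuiverFrame

section Relations

variable {A : Type*} [Ring A] (Q : QuiverFrame A)

attribute [simp] e_α α_e e_β β_e e_γ γ_e e_δ δ_e α_β γ_δ β_α_δ_γ

@[simp] lemma e_α_assoc (x : A) : Q.e 1 * (Q.α * x) = Q.α * x := by rw [← mul_assoc, e_α]
@[simp] lemma e_β_assoc (x : A) : Q.e 0 * (Q.β * x) = Q.β * x := by rw [← mul_assoc, e_β]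
@[simp] lemma e_γ_assoc (x : A) : Q.e 2 * (Q.γ * x) = Q.γ * x := by rw [← mul_assoc, e_γ]
@[simp] lemma e_δ_assoc (x : A) : Q.e 0 * (Q.δ * x) = Q.δ * x := by rw [← mul_assoc, e_δ]
@[simp] lemma α_β_assoc (x : A) : Q.α * (Q.β * x) = 0 := by rw [← mul_assoc, α_β, zero_mul]
@[simp] lemma γ_δ_assoc (x : A) : Q.γ * (Q.δ * x) = 0 := by rw [← mul_assoc, γ_δ, zero_mul]
@[simp] lemma e_e (i : Fin 4) : Q.e i * Q.e i = Q.e i := Q.e_mul_e i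

-- Oriented this way the relations are rewriting rules: `simp` brings a product of arrows to an
-- entry of `path` or to `0`, all composable words of length five being zero.
@[simp] lemma β_α_δ_γ_assoc (x : A) :
    Q.β * (Q.α * (Q.δ * (Q.γ * x))) = Q.δ * (Q.γ * (Q.β * (Q.α * x))) := by
  have := congrArg (· * x) Q.β_α_δ_γ
  simpa only [mul_assoc] using this

@[simp] lemma α_δ_γ_β_α : Q.α * (Q.δ * (Q.γ * (Q.β * Q.α))) = 0 := by
  rw [← β_α_δ_γ, α_β_assoc]

@[simp] lemma δ_γ_β_α_δ : Q.δ * (Q.γ * (Q.β * (Q.α * Q.δ))) = 0 := by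
  rw [← β_α_δ_γ_assoc, γ_δ, mul_zero, mul_zero, mul_zero]

/-- The nonzero paths from `j` to `i`. -/
def path : (i j : Fin 4) → Fin (cartanA5 i j) → A
  | 0, 0 => (![Q.e 0, Q.β * Q.α, Q.δ * Q.γ, Q.δ * (Q.γ * (Q.β * Q.α))] : Fin 4 → A)
  | 0, 1 => (![Q.β, Q.δ * (Q.γ * Q.β)] : Fin 2 → A)
  | 0, 2 => (![Q.δ, Q.β * (Q.α * Q.δ)] : Fin 2 → A)
  | 0, 3 => (![] : Fin 0 → A)
  | 1, 0 => (![Q.α, Q.α * (Q.δ * Q.γ)] : Fin 2 → A)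
  | 1, 1 => (![Q.e 1, Q.α * (Q.δ * (Q.γ * Q.β))] : Fin 2 → A)
  | 1, 2 => (![Q.α * Q.δ] : Fin 1 → A)
  | 1, 3 => (![] : Fin 0 → A)
  | 2, 0 => (![Q.γ, Q.γ * (Q.β * Q.α)] : Fin 2 → A)
  | 2, 1 => (![Q.γ * Q.β] : Fin 1 → A)
  | 2, 2 => (![Q.e 2, Q.γ * (Q.β * (Q.α * Q.δ))] : Fin 2 → A)
  | 2, 3 => (![] : Fin 0 → A)
  | 3, 0 => (![] : Fin 0 → A)
  | 3, 1 => (![] : Fin 0 → A)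
  | 3, 2 => (![] : Fin 0 → A)
  | 3, 3 => (![Q.e 3] : Fin 1 → A)

end Relations

/-! ### Linear independence of paths and the count to `60` -/

section Dimension

variable {k A : Type*} [Field k] [Ring A] [Algebra k A] (Q : QuiverFrame A)

variable (k) in
lemma path_mem_corner (i j : Fin 4) : ∀ t, Q.path i j t ∈ Q.corner k i j := by
  fin_cases i <;> fin_cases j <;> simp only [path, IdempotentFrame.mem_corner]
  all_goals first
    | (change ∀ t : Fin 0, _; exact fun t => t.elim0)
    | (change ∀ t : Fin 1, _; simp [mul_assoc])
    | (change ∀ t : Fin 2, _; simp [Fin.forall_fin_succ, mul_assoc])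
    | (change ∀ t : Fin 4, _; simp [Fin.forall_fin_succ, mul_assoc])

-- Multiplication by the socle element isolates the coefficient of `e 0`. After that `δγ` completes
-- `βα`, and `βα` completes `δγ`, to the nonzero socle element while killing the other one.
variable {Q} in
lemma coeff_eq_zero {a b c d : k} (h : a • Q.e 0 + b • (Q.β * Q.α) + c • (Q.δ * Q.γ) +
    d • (Q.δ * (Q.γ * (Q.β * Q.α))) = 0) : a = 0 ∧ b = 0 ∧ c = 0 ∧ d = 0 := by
  have hs := Q.δ_γ_β_α_ne_zero
  have ha : a = 0 := by
    have := congrArg (· * (Q.δ * (Q.γ * (Q.β * Q.α)))) h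
    simpa [add_mul, mul_assoc, hs] using this
  subst ha
  have hb : b = 0 := by
    have := congrArg (· * (Q.δ * Q.γ)) h
    simpa [add_mul, mul_assoc, hs] using this
  subst hb
  have hc : c = 0 := by
    have := congrArg (· * (Q.β * Q.α)) h
    simpa [add_mul, mul_assoc, hs] using this
  subst hc
  simpa [hs] using h

variable {Q} in
lemma pair_coeff_eq_zero {b d : k}
    (h : b • (Q.β * Q.α) + d • (Q.δ * (Q.γ * (Q.β * Q.α))) = 0) : b = 0 ∧ d = 0 := by
  obtain ⟨-, hb, -, hd⟩ := coeff_eq_zero (Q := Q) (a := 0) (b := b) (c := 0) (d := d)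
    (by simpa using h)
  exact ⟨hb, hd⟩

variable {Q} in
lemma pair_coeff_eq_zero' {c d : k}
    (h : c • (Q.δ * Q.γ) + d • (Q.δ * (Q.γ * (Q.β * Q.α))) = 0) : c = 0 ∧ d = 0 := by
  obtain ⟨-, -, hc, hd⟩ := coeff_eq_zero (Q := Q) (a := 0) (b := 0) (c := c) (d := d)
    (by simpa using h)
  exact ⟨hc, hd⟩

-- For components with exactly one end at `0`, multiplication by one arrow moves the paths into the
-- component at `0`, where independence is known. The remaining ones have an idempotent and a
-- square-zero socle element, or at most one path.
variable (k) in
lemma linearIndependent_path (i j : Fin 4) : LinearIndependent k (Q.path i j) := by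
  have hγβ : Q.γ * Q.β ≠ 0 := fun h => Q.γ_β_α_δ_ne_zero (by rw [← mul_assoc, h, zero_mul])
  have hαδ : Q.α * Q.δ ≠ 0 := fun h => Q.α_δ_γ_β_ne_zero (by rw [← mul_assoc, h, zero_mul])
  have hα := Q.α_δ_γ_β_ne_zero
  have hγ := Q.γ_β_α_δ_ne_zero
  fin_cases i <;> fin_cases j <;> simp only [path]
  · change LinearIndependent k (ι := Fin 4) _
    refine Fintype.linearIndependent_iff.mpr fun g hg => ?_
    simp only [Fin.sum_univ_four] at hg
    obtain ⟨h0, h1, h2, h3⟩ := coeff_eq_zero hg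
    simp [Fin.forall_fin_succ, h0, h1, h2, h3]
  · refine LinearIndependent.pair_iff.mpr fun a b h => pair_coeff_eq_zero (Q := Q) ?_
    simpa [add_mul, mul_assoc] using congrArg (· * Q.α) h
  · refine LinearIndependent.pair_iff.mpr fun a b h => pair_coeff_eq_zero' (Q := Q) ?_
    simpa [add_mul, mul_assoc] using congrArg (· * Q.γ) h
  · exact linearIndependent_empty_type (ι := Fin 0)
  · refine LinearIndependent.pair_iff.mpr fun a b h => pair_coeff_eq_zero (Q := Q) ?_
    simpa [mul_add] using congrArg (Q.β * ·) h
  · refine LinearIndependent.pair_iff.mpr fun a b h => ?_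
    have ha : a = 0 := by
      simpa [add_mul, mul_assoc, hα] using congrArg (· * (Q.α * (Q.δ * (Q.γ * Q.β)))) h
    subst ha
    simpa [hα] using h
  · exact (linearIndependent_unique_iff (ι := Fin 1)).mpr hαδ
  · exact linearIndependent_empty_type (ι := Fin 0)
  · refine LinearIndependent.pair_iff.mpr fun a b h => pair_coeff_eq_zero' (Q := Q) ?_
    simpa [mul_add] using congrArg (Q.δ * ·) h
  · exact (linearIndependent_unique_iff (ι := Fin 1)).mpr hγβ
  · refine LinearIndependent.pair_iff.mpr fun a b h => ?_
    have ha : a = 0 := by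
      simpa [add_mul, mul_assoc, hγ] using congrArg (· * (Q.γ * (Q.β * (Q.α * Q.δ)))) h
    subst ha
    simpa [hγ] using h
  · exact linearIndependent_empty_type (ι := Fin 0)
  · exact linearIndependent_empty_type (ι := Fin 0)
  · exact linearIndependent_empty_type (ι := Fin 0)
  · exact linearIndependent_empty_type (ι := Fin 0)
  · exact (linearIndependent_unique_iff (ι := Fin 1)).mpr (Q.e_ne_zero 3)

lemma span_path_le (i j : Fin 4) : Submodule.span k (Set.range (Q.path i j)) ≤ Q.corner k i j := by
  rw [Submodule.span_le]
  rintro _ ⟨t, rfl⟩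
  exact Q.path_mem_corner k i j t

variable (hA : Module.finrank k A = 60)

include hA

/-- Independence of the paths gives the lower bound `cartanA5 i j`. Summed over all pairs of the
nine summands, these bounds give `60 = dim A`, so none of them can be strict. -/
lemma finrank_corner (i j : Fin 4) : Module.finrank k (Q.corner k i j) = cartanA5 i j := by
  have : Module.Finite k A := Module.finite_of_finrank_pos (by omega)
  have hle (i j : Fin 4) : cartanA5 i j ≤ Module.finrank k (Q.corner k i j) := by
    have := Submodule.finrank_mono (Q.span_path_le (k := k) i j)
    rwa [finrank_span_eq_card (Q.linearIndependent_path k i j), Fintype.card_fin] at this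
  have hsum : ∑ p, ∑ q, cartanA5 (label p) (label q) =
      ∑ p, ∑ q, Module.finrank k (Q.corner k (label p) (label q)) := by
    rw [← Q.finrank_eq_sum_corner, hA]
    decide
  rw [Finset.sum_eq_sum_iff_of_le fun p _ => Finset.sum_le_sum fun q _ => hle _ _] at hsum
  have h1 := hsum (Q.base i) (Finset.mem_univ _)
  rw [Finset.sum_eq_sum_iff_of_le fun q _ => hle _ _] at h1
  have h2 := h1 (Q.base j) (Finset.mem_univ _)
  rw [Q.σ_base, Q.σ_base] at h2
  exact h2.symm

lemma corner_eq_span (i j : Fin 4) :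
    Q.corner k i j = Submodule.span k (Set.range (Q.path i j)) := by
  have : Module.Finite k A := Module.finite_of_finrank_pos (by omega)
  refine (Submodule.eq_of_le_of_finrank_eq (Q.span_path_le i j) ?_).symm
  rw [finrank_span_eq_card (Q.linearIndependent_path k i j), Fintype.card_fin,
    Q.finrank_corner hA]

lemma corner_le_of_path_mem {i j : Fin 4} {N : Submodule k A} (h : ∀ t, Q.path i j t ∈ N) :
    Q.corner k i j ≤ N := by
  rw [Q.corner_eq_span hA, Submodule.span_le]
  rintro _ ⟨t, rfl⟩
  exact h t

lemma exists_eq_sum_path {i j : Fin 4} {x : A} (hx : x ∈ Q.corner k i j) :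
    ∃ c : Fin (cartanA5 i j) → k, ∑ t, c t • Q.path i j t = x := by
  rw [Q.corner_eq_span hA] at hx
  exact (Submodule.mem_span_range_iff_exists_fun k).mp hx

lemma exists_of_mem_corner_zero_zero {x : A} (hx : x ∈ Q.corner k 0 0) :
    ∃ a b c d : k, x = a • Q.e 0 + b • (Q.β * Q.α) + c • (Q.δ * Q.γ) +
      d • (Q.δ * (Q.γ * (Q.β * Q.α))) := by
  obtain ⟨c, rfl⟩ := Q.exists_eq_sum_path hA hx
  refine ⟨c (0 : Fin 4), c (1 : Fin 4), c (2 : Fin 4), c (3 : Fin 4), ?_⟩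
  change (∑ t : Fin 4, _ : A) = _
  simp [Fin.sum_univ_four, path]

lemma exists_of_mem_corner_one_zero {x : A} (hx : x ∈ Q.corner k 1 0) :
    ∃ a b : k, x = a • Q.α + b • (Q.α * (Q.δ * Q.γ)) := by
  obtain ⟨c, rfl⟩ := Q.exists_eq_sum_path hA hx
  refine ⟨c (0 : Fin 2), c (1 : Fin 2), ?_⟩
  change (∑ t : Fin 2, _ : A) = _
  simp [Fin.sum_univ_two, path]

lemma exists_of_mem_corner_two_zero {x : A} (hx : x ∈ Q.corner k 2 0) :
    ∃ a b : k, x = a • Q.γ + b • (Q.γ * (Q.β * Q.α)) := by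
  obtain ⟨c, rfl⟩ := Q.exists_eq_sum_path hA hx
  refine ⟨c (0 : Fin 2), c (1 : Fin 2), ?_⟩
  change (∑ t : Fin 2, _ : A) = _
  simp [Fin.sum_univ_two, path]

lemma eq_zero_of_mem_corner {i j : Fin 4} (hij : cartanA5 i j = 0) {x : A}
    (hx : x ∈ Q.corner k i j) : x = 0 := by
  have : Module.Finite k A := Module.finite_of_finrank_pos (by omega)
  have h := Q.finrank_corner hA i j
  rw [hij, Submodule.finrank_eq_zero] at h
  simpa [h] using hx

/-- Every return path `y` from `1` to `0` begins with `β`, so `y * α` is a combination of `βα` and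
`δγβα`, which has square zero by `αβ = 0`. The other arrows are treated in the same way. -/
lemma α_mem_jacobson : Q.α ∈ Ring.jacobson A := by
  refine Q.mem_jacobson_of_isNilpotent (k := k) Q.α_e Q.e_α fun y hy => ⟨2, ?_⟩
  obtain ⟨c, rfl⟩ := Q.exists_eq_sum_path hA hy
  change ((∑ t : Fin 2, _ : A) * _) ^ 2 = 0
  simp [Fin.sum_univ_two, path, add_mul, mul_add, pow_two, mul_assoc]

lemma β_mem_jacobson : Q.β ∈ Ring.jacobson A := by
  refine Q.mem_jacobson_of_isNilpotent (k := k) Q.β_e Q.e_β fun y hy => ⟨2, ?_⟩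
  obtain ⟨c, rfl⟩ := Q.exists_eq_sum_path hA hy
  change ((∑ t : Fin 2, _ : A) * _) ^ 2 = 0
  simp [Fin.sum_univ_two, path, add_mul, pow_two, mul_assoc]

lemma γ_mem_jacobson : Q.γ ∈ Ring.jacobson A := by
  refine Q.mem_jacobson_of_isNilpotent (k := k) Q.γ_e Q.e_γ fun y hy => ⟨2, ?_⟩
  obtain ⟨c, rfl⟩ := Q.exists_eq_sum_path hA hy
  change ((∑ t : Fin 2, _ : A) * _) ^ 2 = 0
  simp [Fin.sum_univ_two, path, add_mul, mul_add, pow_two, mul_assoc]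

lemma δ_mem_jacobson : Q.δ ∈ Ring.jacobson A := by
  refine Q.mem_jacobson_of_isNilpotent (k := k) Q.δ_e Q.e_δ fun y hy => ⟨2, ?_⟩
  obtain ⟨c, rfl⟩ := Q.exists_eq_sum_path hA hy
  change ((∑ t : Fin 2, _ : A) * _) ^ 2 = 0
  simp [Fin.sum_univ_two, path, add_mul, pow_two, mul_assoc]

/-- Every path except the idempotents begins with an arrow on the left, and the arrows generate
inside the two-sided ideal `Ring.jacobson A`. -/
lemma isSplit : Q.IsSplit k := by
  have hα := Q.α_mem_jacobson hA
  have hβ := Q.β_mem_jacobson hA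
  have hγ := Q.γ_mem_jacobson hA
  have hδ := Q.δ_mem_jacobson hA
  have hβ' (x : A) : Q.β * x ∈ Ring.jacobson A := Ideal.mul_mem_right _ _ hβ
  have hα' (x : A) : Q.α * x ∈ Ring.jacobson A := Ideal.mul_mem_right _ _ hα
  have hγ' (x : A) : Q.γ * x ∈ Ring.jacobson A := Ideal.mul_mem_right _ _ hγ
  have hδ' (x : A) : Q.δ * x ∈ Ring.jacobson A := Ideal.mul_mem_right _ _ hδ
  constructor
  · intro i j a hij
    refine Q.corner_le_of_path_mem (k := k) hA (N := (Ring.jacobson A).restrictScalars k) ?_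
      (Q.e_mul_mul_e_mem_corner j i a)
    revert hij
    fin_cases i <;> fin_cases j <;> intro hij <;> simp only [path]
    all_goals first
      | exact absurd rfl hij
      | (change ∀ t : Fin 0, _; exact fun t => t.elim0)
      | (change ∀ t : Fin 1, _; simp [hα', hγ'])
      | (change ∀ t : Fin 2, _; simp [Fin.forall_fin_succ, *])
  · intro i a
    obtain ⟨c, hc⟩ := Q.exists_eq_sum_path (k := k) hA (Q.e_mul_mul_e_mem_corner i i a)
    rw [← hc]
    clear hc
    have hk (c : k) {x : A} (hx : x ∈ Ring.jacobson A) : c • x ∈ Ring.jacobson A :=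
      Submodule.smul_of_tower_mem _ c hx
    fin_cases i <;> simp only [path] <;> revert c
    · change ∀ c : Fin 4 → k, _
      refine fun c => ⟨c 0, ?_⟩
      have : (∑ t : Fin 4, c t • ![Q.e 0, Q.β * Q.α, Q.δ * Q.γ, Q.δ * (Q.γ * (Q.β * Q.α))] t) -
          c 0 • Q.e 0 = c 1 • (Q.β * Q.α) + c 2 • (Q.δ * Q.γ) +
            c 3 • (Q.δ * (Q.γ * (Q.β * Q.α))) := by
        simp [Fin.sum_univ_four]
        abel
      exact this ▸ Ideal.add_mem _ (Ideal.add_mem _ (hk _ (hβ' _)) (hk _ (hδ' _))) (hk _ (hδ' _))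
    · change ∀ c : Fin 2 → k, _
      refine fun c => ⟨c 0, ?_⟩
      change (∑ t : Fin 2, _ : A) - _ ∈ _
      simpa [Fin.sum_univ_two] using hk _ (hα' _)
    · change ∀ c : Fin 2 → k, _
      refine fun c => ⟨c 0, ?_⟩
      change (∑ t : Fin 2, _ : A) - _ ∈ _
      simpa [Fin.sum_univ_two] using hk _ (hγ' _)
    · change ∀ c : Fin 1 → k, _
      refine fun c => ⟨c 0, ?_⟩
      change (∑ t : Fin 1, _ : A) - _ ∈ _
      simp

lemma finrank_proj (j : Fin 4) : Module.finrank k (Q.proj j) = ![12, 8, 8, 4] j := by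
  have : Module.Finite k A := Module.finite_of_finrank_pos (by omega)
  have := (Q.proj j).finite_of_tower (k := k)
  rw [Q.finrank_eq_sum_dim k]
  simp_rw [Q.finrank_part_proj, Q.finrank_corner hA]
  clear this
  revert j
  decide

end Dimension

end QuiverFrame

/-! ### Quotients of sums of submodules -/

section SupQuotient

variable {A : Type*} [Ring A] {M : Type*} [AddCommGroup M] [Module A M]

/-- A vector of `U ⊔ V` determines its two components up to `U ⊓ V`. The hypothesis `h` makes this
ambiguity vanish in both quotients. -/
lemma nonempty_sup_quotient_equiv {U U' V V' : Submodule A M} (hU : U' ≤ U) (hV : V' ≤ V)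
    (h : U ⊓ V ≤ U' ⊓ V') :
    Nonempty ((↥(U ⊔ V) ⧸ (U' ⊔ V').submoduleOf (U ⊔ V)) ≃ₗ[A]
      (U ⧸ U'.submoduleOf U) × (V ⧸ V'.submoduleOf V)) := by
  let f : (U ⧸ U'.submoduleOf U) →ₗ[A] (↥(U ⊔ V) ⧸ (U' ⊔ V').submoduleOf (U ⊔ V)) :=
    Submodule.mapQ _ _ (Submodule.inclusion le_sup_left) fun x hx => Submodule.mem_sup_left hx
  let g : (V ⧸ V'.submoduleOf V) →ₗ[A] (↥(U ⊔ V) ⧸ (U' ⊔ V').submoduleOf (U ⊔ V)) :=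
    Submodule.mapQ _ _ (Submodule.inclusion le_sup_right) fun x hx => Submodule.mem_sup_right hx
  refine ⟨(LinearEquiv.ofBijective (f.coprod g) ⟨?_, ?_⟩).symm⟩
  · rw [← LinearMap.ker_eq_bot, LinearMap.ker_eq_bot']
    rintro ⟨x, y⟩ hxy
    obtain ⟨x, rfl⟩ := Submodule.Quotient.mk_surjective _ x
    obtain ⟨y, rfl⟩ := Submodule.Quotient.mk_surjective _ y
    have hmem : (x : M) + y ∈ U' ⊔ V' := by
      rw [LinearMap.coprod_apply] at hxy
      exact (Submodule.Quotient.mk_eq_zero ((U' ⊔ V').submoduleOf (U ⊔ V))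
        (x := Submodule.inclusion le_sup_left x + Submodule.inclusion le_sup_right y)).mp hxy
    obtain ⟨u, hu, v, hv, huv⟩ := Submodule.mem_sup.mp hmem
    have hx : (x : M) - u ∈ U' ⊓ V' := h ⟨U.sub_mem x.2 (hU hu), by
      have : (x : M) - u = v - y := by rw [sub_eq_sub_iff_add_eq_add, ← huv, add_comm]
      rw [this]
      exact V.sub_mem (hV hv) y.2⟩
    have hy : (y : M) = v - (x - u) := by
      rw [eq_sub_iff_add_eq, add_comm, sub_add_eq_add_sub, sub_eq_iff_eq_add, ← huv, add_comm]
    refine Prod.ext ((Submodule.Quotient.mk_eq_zero _).mpr ?_)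
      ((Submodule.Quotient.mk_eq_zero _).mpr ?_)
    · change (x : M) ∈ U'
      simpa using U'.add_mem hx.1 hu
    · change (y : M) ∈ V'
      rw [hy]
      exact V'.sub_mem hv hx.2
  · intro z
    obtain ⟨⟨z, hz⟩, rfl⟩ := Submodule.Quotient.mk_surjective _ z
    obtain ⟨x, hx, y, hy, rfl⟩ := Submodule.mem_sup.mp hz
    exact ⟨(Submodule.Quotient.mk ⟨x, hx⟩, Submodule.Quotient.mk ⟨y, hy⟩), rfl⟩

lemma isSemisimpleModule_prod {N : Type*} [AddCommGroup N] [Module A N] [IsSemisimpleModule A M]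
    [IsSemisimpleModule A N] : IsSemisimpleModule A (M × N) := by
  have : IsSemisimpleModule A (⊤ : Submodule A (M × N)) := by
    rw [← LinearMap.sup_range_inl_inr]
    exact .sup (.range _) (.range _)
  exact IsSemisimpleModule.congr Submodule.topEquiv.symm

lemma radSeries_one : radSeries A M 1 = Module.jacobson A M :=
  Module.map_jacobson_of_bijective (f := (⊤ : Submodule A M).subtype)
    ⟨Subtype.val_injective, fun x => ⟨⟨x, Submodule.mem_top⟩, rfl⟩⟩

end SupQuotient

/-! ### The symmetry between the labels `1` and `2` -/

namespace QuiverFrame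

section Swap

variable {A : Type*} [Ring A] (Q : QuiverFrame A)

/-- The permutation of the summands that interchanges the labels `1` and `2`. -/
def swapIndex : Equiv.Perm (Fin 9) where
  toFun := ![0, 3, 4, 1, 2, 5, 6, 7, 8]
  invFun := ![0, 3, 4, 1, 2, 5, 6, 7, 8]
  left_inv := by decide
  right_inv := by decide

/-- The permutation that interchanges the labels `1` and `2`. -/
def swapLabel : Fin 4 → Fin 4 := ![0, 2, 1, 3]

lemma label_swapIndex : ∀ p, label (swapIndex p) = swapLabel (label p) := by decide

lemma swapLabel_swapLabel : ∀ i, swapLabel (swapLabel i) = i := by decide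

lemma swapIndex_swapIndex : ∀ p, swapIndex (swapIndex p) = p := by decide

/-- The frame in which the roles of the labels `1` and `2` are interchanged. -/
def swap : QuiverFrame A where
  e i := Q.e (swapLabel i)
  u p := Q.u (swapIndex p)
  v p := Q.v (swapIndex p)
  base i := swapIndex (Q.base (swapLabel i))
  σ_base i := by rw [label_swapIndex, Q.σ_base, swapLabel_swapLabel]
  u_base i := by rw [swapIndex_swapIndex, Q.u_base]
  v_base i := by rw [swapIndex_swapIndex, Q.v_base]
  v_mul_u p q := by
    rw [Q.v_mul_u, label_swapIndex]
    simp only [EmbeddingLike.apply_eq_iff_eq]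
  sum_u_mul_v := by
    rw [← Q.sum_u_mul_v]
    exact Equiv.sum_comp swapIndex fun p => Q.u p * Q.v p
  α := Q.γ
  β := Q.δ
  γ := Q.α
  δ := Q.β
  e_α := Q.e_γ
  α_e := Q.γ_e
  e_β := Q.e_δ
  β_e := Q.δ_e
  e_γ := Q.e_α
  γ_e := Q.α_e
  e_δ := Q.e_β
  δ_e := Q.β_e
  α_β := Q.γ_δ
  γ_δ := Q.α_β
  β_α_δ_γ := Q.β_α_δ_γ.symm
  δ_γ_β_α_ne_zero := Q.β_α_δ_γ ▸ Q.δ_γ_β_α_ne_zero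
  α_δ_γ_β_ne_zero := Q.γ_β_α_δ_ne_zero
  γ_β_α_δ_ne_zero := Q.α_δ_γ_β_ne_zero
  e_ne_zero i := Q.e_ne_zero _

end Swap

/-! ### The uniserial modules -/

section Arm

variable {A : Type*} [Ring A] (Q : QuiverFrame A)

/-- The initial segments of the path `αδγβ`. -/
def word : ℕ → A
  | 0 => Q.e 1
  | 1 => Q.β
  | 2 => Q.γ * Q.β
  | 3 => Q.δ * (Q.γ * Q.β)
  | 4 => Q.α * (Q.δ * (Q.γ * Q.β))
  | _ => 0

/-- The endpoints of the initial segments of the path `αδγβ`. -/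
def wordLabel : ℕ → Fin 4
  | 0 => 1
  | 1 => 0
  | 2 => 2
  | 3 => 0
  | _ => 1

lemma e_mul_word (t : ℕ) (ht : t < 5) : Q.e (wordLabel t) * Q.word t = Q.word t := by
  interval_cases t <;> simp [word, wordLabel]

lemma word_ne_zero (t : ℕ) (ht : t < 5) : Q.word t ≠ 0 := by
  have h := Q.α_δ_γ_β_ne_zero
  interval_cases t <;> simp only [word]
  · exact Q.e_ne_zero 1
  all_goals
    intro h'
    simp [h'] at h

lemma word_mul_e (t : ℕ) : Q.word t * Q.e 1 = Q.word t := by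
  unfold word
  split <;> simp [mul_assoc]

lemma span_word_zero_smul_gen : Submodule.span A {Q.word 0 • Q.gen 1} = ⊤ := by
  rw [show Q.word 0 • Q.gen 1 = Q.gen 1 from Q.e_smul_gen 1, Q.span_gen]

variable {k : Type*} [Field k] [Algebra k A] (hA : Module.finrank k A = 60)
  {M : Type*} [AddCommGroup M] [Module A M]

include hA

lemma exists_word_succ (t : ℕ) (ht : t < 5) :
    ∃ a ∈ Ring.jacobson A, Q.word (t + 1) = a * Q.word t := by
  interval_cases t
  · exact ⟨Q.β, Q.β_mem_jacobson hA, Q.β_e.symm⟩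
  · exact ⟨Q.γ, Q.γ_mem_jacobson hA, rfl⟩
  · exact ⟨Q.δ, Q.δ_mem_jacobson hA, rfl⟩
  · exact ⟨Q.α, Q.α_mem_jacobson hA, rfl⟩
  · exact ⟨0, Ideal.zero_mem _, by simp [word]⟩

variable [Module k M] [IsScalarTower k A M]

lemma isRadChain {n : ℕ} (hn : n ≤ 5) {x : M} (hx : Q.e 1 • x = x)
    (hne : ∀ t < n, Q.word t • x ≠ 0) (h0 : Q.word n • x = 0)
    (hfin : Module.finrank k (Submodule.span A {x}) ≤
      ∑ t ∈ Finset.range n, IdempotentFrame.dim label (wordLabel t)) :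
    Q.IsRadChain k n (fun t => Q.word t • x) wordLabel where
  homogeneous t ht := by rw [← mul_smul, Q.e_mul_word t (by omega)]
  ne_zero := hne
  eq_zero := h0
  step t ht := by
    obtain ⟨a, ha, h⟩ := Q.exists_word_succ hA t (by omega)
    simp only [h, mul_smul]
    exact smul_mem_jacobson_smul_span ha _
  finrank_le := by
    rwa [show Q.word 0 • x = x from hx]

lemma isRadChain_proj :
    Q.IsRadChain k 5 (fun t => Q.word t • Q.gen 1) wordLabel := by
  refine Q.isRadChain hA le_rfl (Q.e_smul_gen 1) (fun t ht h => Q.word_ne_zero t ht ?_)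
    (by simp [word]) ?_
  · rw [← Q.word_mul_e]
    exact congrArg Subtype.val h
  · rw [Q.span_gen, show Module.finrank k (⊤ : Submodule A (Q.proj 1)) = Module.finrank k (Q.proj 1)
      from (Submodule.topEquiv.restrictScalars k).finrank_eq, Q.finrank_proj hA]
    decide

/-- A module of dimension `5` generated by a vector of label `1` is the quotient of the projective
module by the third term of its radical series. -/
lemma ker_homOfVector_eq {x : M} (hx : Q.e 1 • x = x)
    (hspan : Submodule.span A {x} = ⊤)
    (hM : Module.finrank k M = 5) :
    LinearMap.ker (Q.homOfVector 1 x) = Submodule.span A {Q.word 3 • Q.gen 1} := by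
  have : Module.Finite k A := Module.finite_of_finrank_pos (by omega)
  have := (Q.proj 1).finite_of_tower (k := k)
  have h := Q.isRadChain_proj hA
  obtain ⟨s, -, hs, hker⟩ := h.exists_eq_span_of_le (Nat.zero_le 5)
    (N := LinearMap.ker (Q.homOfVector 1 x)) (by rw [Q.span_word_zero_smul_gen]; exact le_top)
  rw [hker]
  have h1 := h.finrank_eq hs
  rw [← hker] at h1
  have hsurj : Function.Surjective (Q.homOfVector 1 x) := by
    rw [← LinearMap.range_eq_top, Q.range_homOfVector hx, hspan]
  have h2 := (LinearMap.ker (Q.homOfVector 1 x)).finrank_quotient_add_of_tower (k := k)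
  rw [(((Q.homOfVector 1 x).quotKerEquivOfSurjective hsurj).restrictScalars k).finrank_eq, hM,
    Q.finrank_proj hA, h1] at h2
  -- The chain in the eight-dimensional module has dimensions `8, 6, 5, 3, 2, 0`, and the kernel has
  -- dimension `8 - 5 = 3`.
  have : s = 3 := by
    revert h2
    clear h1 hker
    revert s
    decide
  rw [this]

lemma isRadChain_of_finrank_eq [Module.Finite k M] {x : M} (hx : Q.e 1 • x = x)
    (hspan : Submodule.span A {x} = ⊤)
    (hM : Module.finrank k M = 5) :
    Q.IsRadChain k 3 (fun t => Q.word t • x) wordLabel := by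
  have : Module.Finite k A := Module.finite_of_finrank_pos (by omega)
  have := (Q.proj 1).finite_of_tower (k := k)
  have h := Q.isRadChain_proj hA
  have hker := Q.ker_homOfVector_eq hA hx hspan hM
  have hiff (t : ℕ) : Q.word t • x = 0 ↔
      Q.word t • Q.gen 1 ∈ Submodule.span A {Q.word 3 • Q.gen 1} := by
    rw [← hker, LinearMap.mem_ker, map_smul, Q.homOfVector_apply]
    change _ ↔ Q.word t • Q.e 1 • x = 0
    rw [hx]
  refine Q.isRadChain hA (by norm_num) hx (fun t ht h0 => ?_)
    ((hiff 3).mpr (Submodule.mem_span_singleton_self _)) ?_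
  · have h1 := (Submodule.span_singleton_le_iff_mem _ _).mpr ((hiff t).mp h0)
    have h2 := Submodule.finrank_mono_of_tower (k := k) h1
    rw [h.finrank_eq (t := t) (by omega), h.finrank_eq (t := 3) (by omega)] at h2
    revert h2
    clear h0 h1
    revert t
    decide
  · rw [hspan, (Submodule.topEquiv.restrictScalars k).finrank_eq, hM]
    decide

lemma nonempty_equiv_of_finrank_eq {x : M} (hx : Q.e 1 • x = x)
    (hspan : Submodule.span A {x} = ⊤) (hM : Module.finrank k M = 5)
    {M' : Type*} [AddCommGroup M'] [Module A M'] [Module k M'] [IsScalarTower k A M']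
    {x' : M'} (hx' : Q.e 1 • x' = x') (hspan' : Submodule.span A {x'} = ⊤)
    (hM' : Module.finrank k M' = 5) : Nonempty (M ≃ₗ[A] M') := by
  have hsurj : Function.Surjective (Q.homOfVector 1 x) := by
    rw [← LinearMap.range_eq_top, Q.range_homOfVector hx, hspan]
  have hsurj' : Function.Surjective (Q.homOfVector 1 x') := by
    rw [← LinearMap.range_eq_top, Q.range_homOfVector hx', hspan']
  exact ⟨((Q.homOfVector 1 x).quotKerEquivOfSurjective hsurj).symm ≪≫ₗ
    Submodule.quotEquivOfEq _ _ ((Q.ker_homOfVector_eq hA hx hspan hM).trans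
      (Q.ker_homOfVector_eq hA hx' hspan' hM').symm) ≪≫ₗ
    (Q.homOfVector 1 x').quotKerEquivOfSurjective hsurj'⟩

end Arm

end QuiverFrame

namespace QuiverFrame

/-! ### The projective module with label `0` -/

section Trivial

variable {k A : Type*} [Field k] [Ring A] [Algebra k A] (Q : QuiverFrame A)

/-- The arrow `α` as a vector of the projective module with label `0`. -/
def αVec : Q.proj 0 := ⟨Q.α, Q.mem_proj_iff.mpr Q.α_e⟩

/-- The `t`-th term of the radical series of the submodule generated by `α`. -/
def arm (t : ℕ) : Submodule A (Q.proj 0) := Submodule.span A {Q.word t • Q.αVec}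

/-- The `t`-th term of the radical series of the submodule generated by `γ`. -/
def coarm (t : ℕ) : Submodule A (Q.proj 0) := Q.swap.arm t

/-- A vector that spans the socle of the projective module with label `0`. -/
def socVec : Q.proj 0 :=
  ⟨Q.δ * (Q.γ * (Q.β * Q.α)), Q.mem_proj_iff.mpr (by simp [mul_assoc])⟩

lemma arm_three : Q.arm 3 = Submodule.span A {Q.socVec} := by
  rw [arm]
  congr 2
  exact Subtype.ext (by simp [αVec, word, socVec, mul_assoc])

lemma swap_socVec : (Q.swap.socVec : Q.proj 0) = Q.socVec := Subtype.ext Q.β_α_δ_γ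

lemma coarm_three : Q.coarm 3 = Submodule.span A {Q.socVec} :=
  Q.swap.arm_three.trans (congrArg (fun x : Q.proj 0 => Submodule.span A {x}) Q.swap_socVec)

lemma arm_four : Q.arm 4 = ⊥ := by
  rw [arm, Submodule.span_singleton_eq_bot]
  exact Subtype.ext (by simp [αVec, word, mul_assoc])

lemma e_smul_αVec : Q.e 1 • Q.αVec = Q.αVec := Subtype.ext Q.e_α

variable (hA : Module.finrank k A = 60)

include hA

/-- The module generated by `α` is an image of `A e 1`, of dimension `8`. Its kernel contains the
two-dimensional submodule generated by `αδγβ`, since `αδγβα = 0`. -/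
lemma finrank_span_αVec_le : Module.finrank k (Submodule.span A {Q.αVec}) ≤ 6 := by
  have : Module.Finite k A := Module.finite_of_finrank_pos (by omega)
  have := (Q.proj 1).finite_of_tower (k := k)
  have h1 : Submodule.span A {Q.word 4 • Q.gen 1} ≤ LinearMap.ker (Q.homOfVector 1 Q.αVec) := by
    rw [Submodule.span_singleton_le_iff_mem, LinearMap.mem_ker]
    exact Subtype.ext (by simp [IdempotentFrame.gen, word, αVec, mul_assoc])
  have h2 := Submodule.finrank_mono_of_tower (k := k) h1
  rw [(Q.isRadChain_proj hA).finrank_eq (t := 4) (by norm_num)] at h2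
  have h3 := (LinearMap.ker (Q.homOfVector 1 Q.αVec)).finrank_quotient_add_of_tower (k := k)
  rw [((Q.homOfVector 1 Q.αVec).quotKerEquivRange.restrictScalars k).finrank_eq,
    Q.range_homOfVector Q.e_smul_αVec, Q.finrank_proj hA] at h3
  rw [show ∑ s ∈ Finset.Ico 4 5, IdempotentFrame.dim label (wordLabel s) = 2 by decide] at h2
  simp only [Matrix.cons_val] at h3
  omega

lemma isRadChain_arm : Q.IsRadChain k 4 (fun t => Q.word t • Q.αVec) wordLabel := by
  refine Q.isRadChain hA (by norm_num) Q.e_smul_αVec (fun t ht h => ?_) ?_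
    ((Q.finrank_span_αVec_le hA).trans (by decide))
  · have h := congrArg Subtype.val h
    have hs := Q.δ_γ_β_α_ne_zero
    interval_cases t <;> simp [αVec, word, mul_assoc] at h <;> simp [h] at hs
  · exact Subtype.ext (by simp [αVec, word, mul_assoc])

lemma finrank_arm {t : ℕ} (ht : t ≤ 4) : Module.finrank k (Q.arm t) =
    ∑ s ∈ Finset.Ico t 4, IdempotentFrame.dim label (wordLabel s) := by
  have : Module.Finite k A := Module.finite_of_finrank_pos (by omega)
  have := (Q.proj 0).finite_of_tower (k := k)
  exact (Q.isRadChain_arm hA).finrank_eq ht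

lemma arm_succ_le {t : ℕ} (ht : t < 4) : Q.arm (t + 1) ≤ Q.arm t :=
  (Q.isRadChain_arm hA).span_le ht

lemma arm_antitone {s t : ℕ} (hst : s ≤ t) (ht : t ≤ 4) : Q.arm t ≤ Q.arm s :=
  (Q.isRadChain_arm hA).span_antitone hst ht

lemma isTop_arm {t : ℕ} (ht : t < 4) :
    Q.IsTop (wordLabel t) (Q.arm t ⧸ (Q.arm (t + 1)).submoduleOf (Q.arm t)) := by
  have : Module.Finite k A := Module.finite_of_finrank_pos (by omega)
  have := (Q.proj 0).finite_of_tower (k := k)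
  exact (Q.isRadChain_arm hA).isTop ht

lemma jacobson_smul_arm {t : ℕ} (ht : t < 4) : Ring.jacobson A • Q.arm t = Q.arm (t + 1) := by
  have : Module.Finite k A := Module.finite_of_finrank_pos (by omega)
  have := (Q.proj 0).finite_of_tower (k := k)
  exact (Q.isRadChain_arm hA).jacobson_smul ht

lemma exists_eq_arm {N : Submodule A (Q.proj 0)} (hN : N ≤ Q.arm 0) :
    ∃ t ≤ 4, N = Q.arm t := by
  have : Module.Finite k A := Module.finite_of_finrank_pos (by omega)
  have := (Q.proj 0).finite_of_tower (k := k)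
  obtain ⟨t, -, h⟩ := (Q.isRadChain_arm hA).exists_eq_span_of_le (Nat.zero_le 4) hN
  exact ⟨t, h⟩

lemma finrank_coarm {t : ℕ} (ht : t ≤ 4) : Module.finrank k (Q.coarm t) =
    ∑ s ∈ Finset.Ico t 4, IdempotentFrame.dim label (wordLabel s) := Q.swap.finrank_arm hA ht

lemma coarm_antitone {s t : ℕ} (hst : s ≤ t) (ht : t ≤ 4) : Q.coarm t ≤ Q.coarm s :=
  Q.swap.arm_antitone hA hst ht

lemma isTop_coarm {t : ℕ} (ht : t < 4) :
    Q.IsTop (swapLabel (wordLabel t)) (Q.coarm t ⧸ (Q.coarm (t + 1)).submoduleOf (Q.coarm t)) :=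
  Q.swap.isTop_arm hA ht

lemma jacobson_smul_coarm {t : ℕ} (ht : t < 4) :
    Ring.jacobson A • Q.coarm t = Q.coarm (t + 1) := Q.swap.jacobson_smul_arm hA ht

lemma exists_eq_coarm {N : Submodule A (Q.proj 0)} (hN : N ≤ Q.coarm 0) :
    ∃ t ≤ 4, N = Q.coarm t := Q.swap.exists_eq_arm hA hN

/-- The intersection is a term of the uniserial arm and contains the common socle. A larger
intersection would make the second terms of both arms equal, although their heads have the different
labels `2` and `1`. -/
lemma coarm_inf_arm : Q.coarm 0 ⊓ Q.arm 0 = Submodule.span A {Q.socVec} := by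
  obtain ⟨s, hs, h⟩ := Q.exists_eq_arm hA (N := Q.coarm 0 ⊓ Q.arm 0) inf_le_right
  rw [h, ← arm_three]
  have h3 : Q.arm 3 ≤ Q.arm s := by
    rw [← h]
    refine le_inf ?_ (Q.arm_antitone hA (by norm_num) (by norm_num))
    rw [arm_three, ← coarm_three]
    exact Q.coarm_antitone hA (by norm_num) (by norm_num)
  refine le_antisymm ?_ h3
  by_cases hs2 : s ≤ 2
  · exfalso
    have h2 : Q.arm 2 ≤ Q.coarm 0 := by
      refine (Q.arm_antitone hA hs2 (by norm_num)).trans ?_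
      rw [← h]
      exact inf_le_left
    obtain ⟨t, ht, h2⟩ := Q.exists_eq_coarm hA h2
    have hfin := congrArg (fun N : Submodule A (Q.proj 0) => Module.finrank k N) h2
    -- Both arms have terms of dimensions `6, 4, 3, 1, 0`, so equal dimensions mean equal indices.
    have ht2 : t = 2 := by
      simp only [Q.finrank_arm hA (t := 2) (by norm_num), Q.finrank_coarm hA ht] at hfin
      clear h2
      revert t
      decide
    subst ht2
    have h4 : Q.arm 3 = Q.coarm 3 := by rw [arm_three, coarm_three]
    have top1 := Q.isTop_arm hA (t := 2) (by norm_num)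
    have top2 := Q.isTop_coarm hA (t := 2) (by norm_num)
    rw [← h4, ← h2] at top2
    exact absurd ((Q.isSplit hA).label_unique top1 top2) (by decide)
  · exact Q.arm_antitone hA (by omega) hs

lemma coarm_inf_arm_le {s t : ℕ} (hs : s ≤ 4) (ht : t ≤ 3) :
    Q.coarm s ⊓ Q.arm s ≤ Q.coarm t ⊓ Q.arm t := by
  refine (inf_le_inf (Q.coarm_antitone hA (Nat.zero_le s) hs)
    (Q.arm_antitone hA (Nat.zero_le s) hs)).trans ?_
  rw [Q.coarm_inf_arm hA]
  refine le_inf ?_ ?_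
  · rw [← coarm_three]
    exact Q.coarm_antitone hA ht (by norm_num)
  · rw [← arm_three]
    exact Q.arm_antitone hA ht (by norm_num)

lemma nonempty_arms_quotient_equiv {s t : ℕ} (hst : s ≤ t) (ht : t ≤ 3) :
    Nonempty ((↥(Q.coarm s ⊔ Q.arm s) ⧸ (Q.coarm t ⊔ Q.arm t).submoduleOf (Q.coarm s ⊔ Q.arm s))
      ≃ₗ[A] (Q.coarm s ⧸ (Q.coarm t).submoduleOf (Q.coarm s)) ×
        (Q.arm s ⧸ (Q.arm t).submoduleOf (Q.arm s))) :=
  nonempty_sup_quotient_equiv (Q.coarm_antitone hA hst (by omega))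
    (Q.arm_antitone hA hst (by omega)) (Q.coarm_inf_arm_le hA (by omega) ht)

lemma finrank_arms : Module.finrank k ↥(Q.coarm 0 ⊔ Q.arm 0) = 11 := by
  have : Module.Finite k A := Module.finite_of_finrank_pos (by omega)
  have := (Q.proj 0).finite_of_tower (k := k)
  have h := Submodule.finrank_sup_add_finrank_inf_eq ((Q.coarm 0).restrictScalars k)
    ((Q.arm 0).restrictScalars k)
  rw [← Submodule.restrictScalars_sup, ← Submodule.restrictScalars_inf, Q.coarm_inf_arm hA,
    ← arm_three] at h
  change Module.finrank k ↥(Q.coarm 0 ⊔ Q.arm 0) + Module.finrank k (Q.arm 3) =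
    Module.finrank k (Q.coarm 0) + Module.finrank k (Q.arm 0) at h
  rw [Q.finrank_arm hA (by norm_num), Q.finrank_arm hA (by norm_num),
    Q.finrank_coarm hA (by norm_num)] at h
  have h1 : ∑ s ∈ Finset.Ico 3 4, IdempotentFrame.dim label (wordLabel s) = 1 := by decide
  have h2 : ∑ s ∈ Finset.Ico 0 4, IdempotentFrame.dim label (wordLabel s) = 6 := by decide
  omega

lemma arms_le_jacobson_smul_top :
    Q.coarm 0 ⊔ Q.arm 0 ≤ Ring.jacobson A • (⊤ : Submodule A (Q.proj 0)) := by
  have hle {x : A} (hx : x ∈ Ring.jacobson A) (y : Q.proj 0) (hy : x * Q.e 0 = y) :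
      y ∈ Ring.jacobson A • (⊤ : Submodule A (Q.proj 0)) := by
    have : y = x • Q.gen 0 := Subtype.ext hy.symm
    rw [this]
    exact Submodule.smul_mem_smul hx Submodule.mem_top
  refine sup_le ?_ ?_ 
  · refine (Submodule.span_singleton_le_iff_mem _ _).mpr (Submodule.smul_mem _ _ ?_)
    exact hle (Q.γ_mem_jacobson hA) Q.swap.αVec Q.γ_e
  · refine (Submodule.span_singleton_le_iff_mem _ _).mpr (Submodule.smul_mem _ _ ?_)
    exact hle (Q.α_mem_jacobson hA) Q.αVec Q.α_e

lemma radSeries_proj_zero_one : radSeries A (Q.proj 0) 1 = Q.coarm 0 ⊔ Q.arm 0 := by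
  have : Module.Finite k A := Module.finite_of_finrank_pos (by omega)
  have := (Q.proj 0).finite_of_tower (k := k)
  have := (⊤ : Submodule A (Q.proj 0)).finite_of_tower (k := k)
  have h11 := Q.finrank_arms hA
  have h1 : Module.finrank k ((⊤ : Submodule A (Q.proj 0)) ⧸
      (Q.coarm 0 ⊔ Q.arm 0).submoduleOf ⊤) = 1 := by
    have h := Submodule.finrank_submoduleOf_add (k := k) (le_top (a := Q.coarm 0 ⊔ Q.arm 0))
    rw [(Submodule.topEquiv.restrictScalars k).finrank_eq, Q.finrank_proj hA, h11] at h
    simp only [Matrix.cons_val] at h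
    omega
  have : Q.IsTop 0 ((⊤ : Submodule A (Q.proj 0)) ⧸ (Q.coarm 0 ⊔ Q.arm 0).submoduleOf ⊤) := by
    refine Q.isTop_of_finrank_eq k (x := Submodule.Quotient.mk ⟨Q.gen 0, Submodule.mem_top⟩)
      ?_ ?_ h1
    · rw [Ne, Submodule.Quotient.mk_eq_zero]
      intro h
      have : (⊤ : Submodule A (Q.proj 0)) ≤ Q.coarm 0 ⊔ Q.arm 0 := by
        rw [← Q.span_gen, Submodule.span_singleton_le_iff_mem]
        exact h
      rw [top_le_iff.mp this, (Submodule.topEquiv.restrictScalars k).finrank_eq,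
        Q.finrank_proj hA] at h11
      simp at h11
    · rw [← Submodule.Quotient.mk_smul]
      congr 1
      exact Subtype.ext (Q.e_smul_gen 0)
  have := this.1
  exact radSeries_succ_eq (N := ⊤) rfl le_top (Q.arms_le_jacobson_smul_top hA) inferInstance

lemma isSemisimple_arms_quotient {t : ℕ} (ht : t ≤ 2) :
    IsSemisimpleModule A (↥(Q.coarm t ⊔ Q.arm t) ⧸
      (Q.coarm (t + 1) ⊔ Q.arm (t + 1)).submoduleOf (Q.coarm t ⊔ Q.arm t)) := by
  obtain ⟨f⟩ := Q.nonempty_arms_quotient_equiv hA (s := t) (t := t + 1) (by omega) (by omega)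
  have := (Q.isTop_arm hA (t := t) (by omega)).1
  have := (Q.isTop_coarm hA (t := t) (by omega)).1
  have := isSemisimpleModule_prod (A := A)
    (M := Q.coarm t ⧸ (Q.coarm (t + 1)).submoduleOf (Q.coarm t))
    (N := Q.arm t ⧸ (Q.arm (t + 1)).submoduleOf (Q.arm t))
  exact IsSemisimpleModule.congr f

lemma radSeries_proj_zero_succ {t : ℕ} (ht : t ≤ 3) :
    radSeries A (Q.proj 0) (t + 1) = Q.coarm t ⊔ Q.arm t := by
  induction t with
  | zero => exact Q.radSeries_proj_zero_one hA
  | succ t ih =>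
    refine radSeries_succ_eq (ih (by omega)) (sup_le_sup (Q.coarm_antitone hA (by omega) (by omega))
      (Q.arm_antitone hA (by omega) (by omega))) ?_ (Q.isSemisimple_arms_quotient hA (by omega))
    rw [Submodule.smul_sup, Q.jacobson_smul_arm hA (by omega), Q.jacobson_smul_coarm hA (by omega)]

lemma radSeries_proj_zero_four : radSeries A (Q.proj 0) 4 = Q.arm 3 := by
  rw [Q.radSeries_proj_zero_succ hA le_rfl, coarm_three, arm_three, sup_idem]

lemma radSeries_proj_zero_five : radSeries A (Q.proj 0) 5 = ⊥ := by
  have := (Q.isTop_arm hA (t := 3) (by omega)).1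
  rw [← Q.arm_four]
  exact radSeries_succ_eq (Q.radSeries_proj_zero_four hA) (Q.arm_succ_le hA (by norm_num))
    (Q.jacobson_smul_arm hA (by norm_num)).ge inferInstance

lemma isTop_radLayer_proj_zero_four : Q.IsTop 0 (RadLayer A (Q.proj 0) 4) := by
  change Q.IsTop 0 (radSeries A (Q.proj 0) 4 ⧸
    (radSeries A (Q.proj 0) 5).submoduleOf (radSeries A (Q.proj 0) 4))
  rw [Q.radSeries_proj_zero_five hA, Q.radSeries_proj_zero_four hA, ← Q.arm_four]
  exact Q.isTop_arm hA (t := 3) (by norm_num)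

lemma nonempty_radLayer_proj_zero_equiv {t : ℕ} (ht : t ≤ 2) :
    Nonempty (RadLayer A (Q.proj 0) (t + 1) ≃ₗ[A]
      (Q.coarm t ⧸ (Q.coarm (t + 1)).submoduleOf (Q.coarm t)) ×
        (Q.arm t ⧸ (Q.arm (t + 1)).submoduleOf (Q.arm t))) := by
  change Nonempty ((radSeries A (Q.proj 0) (t + 1) ⧸
    (radSeries A (Q.proj 0) (t + 2)).submoduleOf (radSeries A (Q.proj 0) (t + 1))) ≃ₗ[A] _)
  rw [Q.radSeries_proj_zero_succ hA (t := t + 1) (by omega),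
    Q.radSeries_proj_zero_succ hA (t := t) (by omega)]
  exact Q.nonempty_arms_quotient_equiv hA (Nat.le_succ t) (by omega)

lemma jacobson_proj_zero : Module.jacobson A (Q.proj 0) = Q.coarm 0 ⊔ Q.arm 0 := by
  rw [← radSeries_one, Q.radSeries_proj_zero_one hA]

lemma isTop_arm_three : Q.IsTop 0 (Q.arm 3) := by
  have : Module.Finite k A := Module.finite_of_finrank_pos (by omega)
  have := (Q.proj 0).finite_of_tower (k := k)
  have := (Q.arm 3).finite_of_tower (k := k)
  refine Q.isTop_of_finrank_eq k (x := ⟨Q.socVec, by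
    rw [arm_three]; exact Submodule.mem_span_singleton_self _⟩) ?_ ?_ ?_
  · intro h
    exact Q.δ_γ_β_α_ne_zero (congrArg (fun x : Q.arm 3 => ((x : Q.proj 0) : A)) h)
  · exact Subtype.ext (Subtype.ext (Q.e_δ_assoc _))
  · rw [Q.finrank_arm hA (by norm_num)]
    decide

/-- A homogeneous vector that is annihilated by the radical is in the socle. -/
lemma mem_arm_three {i : Fin 4} {x : Q.proj 0} (hx : Q.e i • x = x)
    (hJ : ∀ a ∈ Ring.jacobson A, a • x = 0) : x ∈ Q.arm 3 := by
  have hc : (x : A) ∈ Q.corner k i 0 := ⟨congrArg Subtype.val hx, Q.mem_proj_iff.mp x.2⟩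
  have hJ' (a : A) (ha : a ∈ Ring.jacobson A) : a * (x : A) = 0 := congrArg Subtype.val (hJ a ha)
  have hmem (h : ∃ d : k, (x : A) = d • (Q.δ * (Q.γ * (Q.β * Q.α)))) : x ∈ Q.arm 3 := by
    obtain ⟨d, hd⟩ := h
    rw [arm_three, Submodule.mem_span_singleton]
    exact ⟨algebraMap k A d, Subtype.ext (by
      rw [hd, Algebra.smul_def]
      rfl)⟩
  apply hmem
  clear hmem hJ hx
  generalize (x : A) = x at *
  fin_cases i
  · obtain ⟨a, b, c, d, rfl⟩ := Q.exists_of_mem_corner_zero_zero hA hc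
    -- Left multiplication by `δγ` sends the coefficients of `e 0` and `βα` to independent elements;
    -- afterwards `βα` detects the coefficient of `δγ`. Only the socle term survives.
    have h1 := hJ' _ (Ideal.mul_mem_right Q.γ _ (Q.δ_mem_jacobson hA))
    obtain ⟨rfl, rfl⟩ := pair_coeff_eq_zero' (Q := Q) (by simpa [mul_add, mul_assoc] using h1)
    have h2 := hJ' _ (Ideal.mul_mem_right Q.α _ (Q.β_mem_jacobson hA))
    have hc : c = 0 := by simpa [mul_add, mul_assoc, Q.δ_γ_β_α_ne_zero] using h2
    exact ⟨d, by simp [hc]⟩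
  · obtain ⟨a, b, rfl⟩ := Q.exists_of_mem_corner_one_zero hA hc
    obtain ⟨rfl, rfl⟩ := pair_coeff_eq_zero (Q := Q) (by
      simpa [mul_add, mul_assoc] using hJ' _ (Q.β_mem_jacobson hA))
    exact ⟨0, by simp⟩
  · obtain ⟨a, b, rfl⟩ := Q.exists_of_mem_corner_two_zero hA hc
    obtain ⟨rfl, rfl⟩ := pair_coeff_eq_zero' (Q := Q) (by
      simpa [mul_add, mul_assoc] using hJ' _ (Q.δ_mem_jacobson hA))
    exact ⟨0, by simp⟩
  · exact ⟨0, by simpa using Q.eq_zero_of_mem_corner hA (by decide) hc⟩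

/-- A simple submodule is generated by a homogeneous vector, and the radical kills it;
`mem_arm_three` says where such vectors are. -/
lemma moduleSocle_proj_zero : moduleSocle A (Q.proj 0) = Q.arm 3 := by
  refine le_antisymm (sSup_le fun N hN => ?_) (le_sSup (Q.isTop_arm_three hA).1)
  have hN : IsSimpleModule A N := hN
  have := IsSimpleModule.nontrivial A N
  obtain ⟨i, x, h0, hx⟩ := Q.exists_homogeneous (M := N)
  have hmem : (x : Q.proj 0) ∈ Q.arm 3 := Q.mem_arm_three hA (congrArg Subtype.val hx)
    fun a ha => congrArg Subtype.val (smul_eq_zero_of_mem_jacobson ha x)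
  intro y hy
  obtain ⟨a, ha⟩ := Submodule.mem_span_singleton.mp
    (IsSimpleModule.span_singleton_eq_top A h0 ▸ Submodule.mem_top : (⟨y, hy⟩ : N) ∈ _)
  rw [show y = a • (x : Q.proj 0) from (congrArg Subtype.val ha).symm]
  exact Submodule.smul_mem _ _ hmem

lemma nonempty_moduleHeart_equiv : Nonempty (ModuleHeart A (Q.proj 0) ≃ₗ[A]
    (Q.coarm 0 ⧸ (Q.coarm 3).submoduleOf (Q.coarm 0)) ×
      (Q.arm 0 ⧸ (Q.arm 3).submoduleOf (Q.arm 0))) := by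
  change Nonempty ((Module.jacobson A (Q.proj 0) ⧸
    (moduleSocle A (Q.proj 0)).submoduleOf (Module.jacobson A (Q.proj 0))) ≃ₗ[A] _)
  have := Q.nonempty_arms_quotient_equiv hA (Nat.zero_le 3) le_rfl
  rwa [show Q.coarm 3 ⊔ Q.arm 3 = moduleSocle A (Q.proj 0) by
    rw [Q.moduleSocle_proj_zero hA, coarm_three, arm_three, sup_idem],
    ← Q.jacobson_proj_zero hA] at this

lemma moduleSocle_le_jacobson : moduleSocle A (Q.proj 0) ≤ Module.jacobson A (Q.proj 0) := by
  rw [Q.moduleSocle_proj_zero hA, Q.jacobson_proj_zero hA]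
  exact (Q.arm_antitone hA (by norm_num) (by norm_num)).trans le_sup_right

/-- A module of dimension `5` generated by a vector of label `1` is a quotient of an arm. -/
lemma nonempty_equiv_arm_quotient {M : Type*} [AddCommGroup M] [Module A M] [Module k M]
    [IsScalarTower k A M] {x : M} (hx : Q.e 1 • x = x)
    (hspan : Submodule.span A {x} = ⊤)
    (hM : Module.finrank k M = 5) :
    Nonempty ((Q.arm 0 ⧸ (Q.arm 3).submoduleOf (Q.arm 0)) ≃ₗ[A] M) := by
  have : Module.Finite k A := Module.finite_of_finrank_pos (by omega)
  have := (Q.proj 0).finite_of_tower (k := k)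
  have h0 : Q.arm 0 = Submodule.span A {Q.αVec} := by
    rw [arm, show Q.word 0 • Q.αVec = Q.αVec from Q.e_smul_αVec]
  have hα : Q.αVec ∈ Q.arm 0 := h0 ▸ Submodule.mem_span_singleton_self _
  refine Q.nonempty_equiv_of_finrank_eq hA (k := k)
    (x := Submodule.Quotient.mk (⟨Q.αVec, hα⟩ : Q.arm 0)) ?_ ?_ ?_ hx hspan hM
  · rw [← Submodule.Quotient.mk_smul]
    congr 1
    exact Subtype.ext Q.e_smul_αVec
  · refine eq_top_iff.mpr fun y _ => ?_
    obtain ⟨⟨y, hy⟩, rfl⟩ := Submodule.Quotient.mk_surjective _ y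
    obtain ⟨a, ha⟩ := Submodule.mem_span_singleton.mp (h0 ▸ hy)
    refine Submodule.mem_span_singleton.mpr ⟨a, ?_⟩
    rw [← Submodule.Quotient.mk_smul]
    congr 1
    exact Subtype.ext ha
  · have h := Submodule.finrank_submoduleOf_add (k := k)
      (Q.arm_antitone hA (s := 0) (t := 3) (by norm_num) (by norm_num))
    rw [Q.finrank_arm hA (by norm_num), Q.finrank_arm hA (by norm_num)] at h
    have h1 : ∑ s ∈ Finset.Ico 3 4, IdempotentFrame.dim label (wordLabel s) = 1 := by decide
    have h2 : ∑ s ∈ Finset.Ico 0 4, IdempotentFrame.dim label (wordLabel s) = 6 := by decide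
    omega

end Trivial

end QuiverFrame

/-! ### Primitive idempotents -/

section Primitive

variable {A : Type*} [Ring A]

lemma eq_zero_of_isIdempotentElem_of_mem_jacobson {f : A} (hf : IsIdempotentElem f)
    (hJ : f ∈ Ring.jacobson A) : f = 0 := by
  by_contra h0
  refine notMem_jacobson_smul_span (A := A) h0 ?_
  have := smul_mem_jacobson_smul_span hJ f
  change f * f ∈ _ at this
  rwa [hf.eq] at this

/-- The left ideal generated by a primitive idempotent is indecomposable. -/
lemma IsPrimitiveIdempotent.isIndecomposableModule {f : A} (hf : IsPrimitiveIdempotent f) :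
    IsIndecomposableModule A (Ideal.span {f}) := by
  obtain ⟨hidem, h0, hprim⟩ := hf
  have hmem {a : A} (ha : a ∈ Ideal.span {f}) : a * f = a := by
    obtain ⟨b, rfl⟩ := Ideal.mem_span_singleton'.mp ha
    rw [mul_assoc, hidem]
  let g : Ideal.span {f} := ⟨f, Ideal.subset_span rfl⟩
  have hg (y : Ideal.span {f}) : y = (y : A) • g := Subtype.ext (hmem y.2).symm
  have hspan (N : Submodule A (Ideal.span {f})) (hN : g ∈ N) : N = ⊤ :=
    eq_top_iff.mpr fun y _ => by
      rw [hg y]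
      exact N.smul_mem _ hN
  refine ⟨⟨⟨g, 0, fun h => h0 (congrArg Subtype.val h)⟩⟩, fun N N' hN => ?_⟩
  obtain ⟨x, hx, y, hy, hxy⟩ := Submodule.mem_sup.mp
    (hN.sup_eq_top ▸ Submodule.mem_top : g ∈ N ⊔ N')
  have hsum : (x : A) + y = f := congrArg Subtype.val hxy
  have huniq {a a' b b' : Ideal.span {f}} (ha : a ∈ N) (ha' : a' ∈ N) (hb : b ∈ N') (hb' : b' ∈ N')
      (h : a + b = a' + b') : a = a' ∧ b = b' := by
    have h1 : a - a' = b' - b := by rw [sub_eq_sub_iff_add_eq_add, h, add_comm]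
    have h2 : a - a' ∈ N ⊓ N' := ⟨N.sub_mem ha ha', h1 ▸ N'.sub_mem hb' hb⟩
    rw [hN.inf_eq_bot, Submodule.mem_bot] at h2
    exact ⟨sub_eq_zero.mp h2, (sub_eq_zero.mp (h1 ▸ h2)).symm⟩
  have key1 := huniq (N.smul_mem (x : A) hx) hx (N'.smul_mem (x : A) hy) N'.zero_mem
    (by rw [← smul_add, hxy, ← hg, add_zero])
  have key2 := huniq (N.smul_mem (y : A) hx) N.zero_mem (N'.smul_mem (y : A) hy) hy
    (by rw [← smul_add, hxy, ← hg, zero_add])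
  rcases hprim x y (congrArg Subtype.val key1.1) (congrArg Subtype.val key2.2)
    (congrArg Subtype.val key1.2) (congrArg Subtype.val key2.1) hsum.symm with h | h
  · left
    have hx0 : x = 0 := Subtype.ext h
    rw [hx0, zero_add] at hxy
    have := hspan N' (hxy ▸ hy)
    simpa [this] using hN.disjoint
  · right
    have hy0 : y = 0 := Subtype.ext h
    rw [hy0, add_zero] at hxy
    have := hspan N (hxy ▸ hx)
    simpa [this] using hN.disjoint.symm

lemma projective_span_of_isIdempotentElem {f : A} (hf : IsIdempotentElem f) :
    Module.Projective A (Ideal.span {f}) := by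
  refine Module.Projective.of_split (Ideal.span {f}).subtype
    ((LinearMap.toSpanSingleton A A f).codRestrict (Ideal.span {f}) fun a =>
      Ideal.mul_mem_left _ _ (Ideal.subset_span rfl)) ?_
  ext x
  obtain ⟨b, hb⟩ := Ideal.mem_span_singleton'.mp x.2
  change (x : A) * f = x
  rw [← hb, mul_assoc, hf]

/-- Two orthogonal central idempotents with sum `1` that are primitive in the centre are the only
block idempotents. -/
lemma eq_or_eq_of_isBlockIdempotent {e₁ e₂ f : A} (h₁ : IsBlockIdempotent e₁)
    (h₂ : IsBlockIdempotent e₂) (hmul : e₁ * e₂ = 0) (hadd : e₁ + e₂ = 1)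
    (hf : IsBlockIdempotent f) : f = e₁ ∨ f = e₂ := by
  obtain ⟨z₁, rfl, h₁⟩ := h₁
  obtain ⟨z₂, rfl, h₂⟩ := h₂
  obtain ⟨z, rfl, hz⟩ := hf
  have hmul : z₁ * z₂ = 0 := Subtype.ext hmul
  have hadd : z₁ + z₂ = 1 := Subtype.ext hadd
  -- A nonzero idempotent `y` below a primitive `x` equals it, because `x = y + (x - y)` is an
  -- orthogonal decomposition.
  have key {x y : Subring.center A} (hx : IsPrimitiveIdempotent x) (hxy : x * y = y)
      (hy : IsIdempotentElem y) (hy0 : y ≠ 0) : y = x := by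
    have h := hx.2.2 y (x - y) hy (by
      change (x - y) * (x - y) = x - y
      have : x * x = x := hx.1
      have hy : y * y = y := hy
      rw [mul_sub, sub_mul, sub_mul, this, hxy, mul_comm y x, hxy, hy]
      abel) (by rw [mul_sub, hy, mul_comm, hxy, sub_self])
      (by rw [sub_mul, hy, hxy, sub_self]) (by abel)
    exact (sub_eq_zero.mp (h.resolve_left hy0)).symm
  have hzz : z * z = z := hz.1
  have hidem {x : Subring.center A} (hx : x * x = x) : IsIdempotentElem (z * x) := by
    change z * x * (z * x) = z * x
    rw [mul_mul_mul_comm, hzz, hx]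
  rcases hz.2.2 (z * z₁) (z * z₂) (hidem h₁.1) (hidem h₂.1)
    (by rw [mul_mul_mul_comm, hmul, mul_zero])
    (by rw [mul_mul_mul_comm, mul_comm z₂, hmul, mul_zero])
    (by rw [← mul_add, hadd, mul_one]) with h | h
  · right
    have : z₂ * z = z := by
      have := congrArg (z * ·) hadd
      simp only [mul_add, h, zero_add, mul_one] at this
      rw [mul_comm, this]
    exact congrArg Subtype.val (key h₂ this hz.1 hz.2.1)
  · left
    have : z₁ * z = z := by
      have := congrArg (z * ·) hadd
      simp only [mul_add, h, add_zero, mul_one] at this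
      rw [mul_comm, this]
    exact congrArg Subtype.val (key h₁ this hz.1 hz.2.1)

lemma blocks_eq_pair {e₁ e₂ : A} (h₁ : IsBlockIdempotent e₁)
    (h₂ : IsBlockIdempotent e₂) (hmul : e₁ * e₂ = 0) (hadd : e₁ + e₂ = 1) :
    blocks A = {Ideal.span {e₁}, Ideal.span {e₂}} := by
  ext B
  simp only [blocks, Set.mem_ofPred_eq, Set.mem_insert_iff, Set.mem_singleton_iff]
  constructor
  · rintro ⟨e, he, rfl⟩
    rcases eq_or_eq_of_isBlockIdempotent h₁ h₂ hmul hadd he with rfl | rfl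
    · exact Or.inl rfl
    · exact Or.inr rfl
  · rintro (rfl | rfl)
    · exact ⟨e₁, h₁, rfl⟩
    · exact ⟨e₂, h₂, rfl⟩

lemma isCompl_span_of_add_eq_one {e₁ e₂ : A} (h₁ : e₁ * e₁ = e₁)
    (h' : e₂ * e₁ = 0) (hadd : e₁ + e₂ = 1) :
    IsCompl (Ideal.span {e₁}) (Ideal.span {e₂}) := by
  constructor
  · rw [Submodule.disjoint_def]
    intro x hx hx'
    obtain ⟨a, rfl⟩ := Ideal.mem_span_singleton'.mp hx
    obtain ⟨b, hb⟩ := Ideal.mem_span_singleton'.mp hx'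
    have := congrArg (· * e₁) hb
    simp only [mul_assoc, h', h₁, mul_zero] at this
    exact this.symm
  · rw [codisjoint_iff, Ideal.eq_top_iff_one, ← hadd]
    exact Submodule.add_mem_sup (Ideal.subset_span rfl) (Ideal.subset_span rfl)

end Primitive

namespace QuiverFrame

variable {k A : Type*} [Field k] [Ring A] [Algebra k A] (Q : QuiverFrame A)

/-! ### The two blocks -/

/-- The idempotent of the principal block. -/
def blockOne : A := ∑ p with label p ≠ 3, Q.u p * Q.v p

/-- The idempotent of the block of the simple projective module. -/
def blockTwo : A := ∑ p with label p = 3, Q.u p * Q.v p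

lemma blockOne_add_blockTwo : Q.blockOne + Q.blockTwo = 1 := by
  rw [blockOne, blockTwo, add_comm, Finset.sum_filter_add_sum_filter_not, Q.sum_u_mul_v]

lemma v_mul_blockOne (p : Fin 9) : Q.v p * Q.blockOne = if label p = 3 then 0 else Q.v p := by
  simp_rw [blockOne, Finset.mul_sum, ← mul_assoc, Q.v_mul_u, ite_mul, zero_mul,
    Finset.sum_ite_eq, Finset.mem_filter, Finset.mem_univ, true_and, Q.e_mul_v, ite_not]

lemma v_mul_blockTwo (p : Fin 9) : Q.v p * Q.blockTwo = if label p = 3 then Q.v p else 0 := by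
  simp_rw [blockTwo, Finset.mul_sum, ← mul_assoc, Q.v_mul_u, ite_mul, zero_mul,
    Finset.sum_ite_eq, Finset.mem_filter, Finset.mem_univ, true_and, Q.e_mul_v]

lemma blockOne_mul_self : Q.blockOne * Q.blockOne = Q.blockOne := by
  conv_lhs => rw [blockOne, Finset.sum_mul]
  rw [blockOne]
  refine Finset.sum_congr rfl fun p hp => ?_
  rw [mul_assoc, ← blockOne, v_mul_blockOne, if_neg (Finset.mem_filter.mp hp).2]

lemma blockOne_mul_blockTwo : Q.blockOne * Q.blockTwo = 0 := by
  rw [blockOne, Finset.sum_mul]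
  refine Finset.sum_eq_zero fun p hp => ?_
  rw [mul_assoc, v_mul_blockTwo, if_neg (Finset.mem_filter.mp hp).2, mul_zero]

lemma blockTwo_mul_blockOne : Q.blockTwo * Q.blockOne = 0 := by
  rw [blockTwo, Finset.sum_mul]
  refine Finset.sum_eq_zero fun p hp => ?_
  rw [mul_assoc, v_mul_blockOne, if_pos (Finset.mem_filter.mp hp).2, mul_zero]

lemma blockTwo_mul_self : Q.blockTwo * Q.blockTwo = Q.blockTwo := by
  have := congrArg (· * Q.blockTwo) Q.blockOne_add_blockTwo
  simpa [add_mul, Q.blockOne_mul_blockTwo] using this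

lemma e_mul_blockOne (i : Fin 4) (hi : i ≠ 3) : Q.e i * Q.blockOne = Q.e i := by
  have := Q.v_mul_blockOne (Q.base i)
  rwa [Q.σ_base, if_neg hi, Q.v_base] at this

lemma e_mul_blockTwo : Q.e 3 * Q.blockTwo = Q.e 3 := by
  have := Q.v_mul_blockTwo (Q.base 3)
  rwa [Q.σ_base, if_pos rfl, Q.v_base] at this

lemma central_mul_blockOne_eq_zero {z : A} (hcomm : ∀ a, z * a = a * z)
    (h : ∀ i ≠ 3, z * Q.e i = 0) : z * Q.blockOne = 0 := by
  rw [blockOne, Finset.mul_sum]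
  refine Finset.sum_eq_zero fun p hp => ?_
  rw [← Q.u_mul_e, mul_assoc, ← mul_assoc, hcomm, mul_assoc, ← mul_assoc z,
    h _ (Finset.mem_filter.mp hp).2, zero_mul, mul_zero]

lemma central_mul_blockTwo_eq_zero {z : A} (hcomm : ∀ a, z * a = a * z)
    (h : z * Q.e 3 = 0) : z * Q.blockTwo = 0 := by
  rw [blockTwo, Finset.mul_sum]
  refine Finset.sum_eq_zero fun p hp => ?_
  rw [← Q.u_mul_e, mul_assoc, ← mul_assoc, hcomm, mul_assoc, ← mul_assoc z,
    (Finset.mem_filter.mp hp).2, h, zero_mul, mul_zero]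

variable (hA : Module.finrank k A = 60)

include hA

/-- The product is a sum of elements of Peirce components between a label other than `3` and the
label `3`, where the Cartan number is zero. -/
lemma blockOne_mul_mul_blockTwo (a : A) : Q.blockOne * a * Q.blockTwo = 0 := by
  simp_rw [blockOne, blockTwo, Finset.sum_mul, Finset.mul_sum]
  refine Finset.sum_eq_zero fun p hp => Finset.sum_eq_zero fun q hq => ?_
  have h : Q.v p * a * Q.u q = 0 := by
    refine Q.eq_zero_of_mem_corner (k := k) hA ?_ (Q.v_mul_mul_u_mem_corner p q a)
    have hp := (Finset.mem_filter.mp hp).2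
    rw [(Finset.mem_filter.mp hq).2]
    revert hp
    generalize label p = i
    revert i
    decide
  calc Q.u p * Q.v p * a * (Q.u q * Q.v q) = Q.u p * (Q.v p * a * Q.u q) * Q.v q := by
        simp_rw [mul_assoc]
    _ = 0 := by rw [h, mul_zero, zero_mul]

lemma blockTwo_mul_mul_blockOne (a : A) : Q.blockTwo * a * Q.blockOne = 0 := by
  simp_rw [blockOne, blockTwo, Finset.sum_mul, Finset.mul_sum]
  refine Finset.sum_eq_zero fun p hp => Finset.sum_eq_zero fun q hq => ?_
  have h : Q.v p * a * Q.u q = 0 := by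
    refine Q.eq_zero_of_mem_corner (k := k) hA ?_ (Q.v_mul_mul_u_mem_corner p q a)
    have hq := (Finset.mem_filter.mp hq).2
    rw [(Finset.mem_filter.mp hp).2]
    revert hq
    generalize label q = i
    revert i
    decide
  calc Q.u p * Q.v p * a * (Q.u q * Q.v q) = Q.u p * (Q.v p * a * Q.u q) * Q.v q := by
        simp_rw [mul_assoc]
    _ = 0 := by rw [h, mul_zero, zero_mul]

lemma blockOne_comm (a : A) : Q.blockOne * a = a * Q.blockOne := by
  have h1 : Q.blockOne * a = Q.blockOne * a * Q.blockOne := by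
    conv_lhs => rw [← mul_one (Q.blockOne * a), ← Q.blockOne_add_blockTwo, mul_add,
      Q.blockOne_mul_mul_blockTwo hA, add_zero]
  have h2 : a * Q.blockOne = Q.blockOne * a * Q.blockOne := by
    conv_lhs => rw [← one_mul (a * Q.blockOne), ← Q.blockOne_add_blockTwo, add_mul, ← mul_assoc,
      ← mul_assoc, Q.blockTwo_mul_mul_blockOne hA, add_zero]
  rw [h1, h2]

lemma blockTwo_comm (a : A) : Q.blockTwo * a = a * Q.blockTwo := by
  have h : Q.blockTwo = 1 - Q.blockOne := by rw [← Q.blockOne_add_blockTwo, add_sub_cancel_left]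
  rw [h, sub_mul, mul_sub, one_mul, mul_one, Q.blockOne_comm hA]

lemma blockOne_mul_of_mem_proj {i : Fin 4} (hi : i ≠ 3) {x : A} (hx : x ∈ Q.proj i) :
    Q.blockOne * x = x := by
  rw [← Q.mem_proj_iff.mp hx, Q.blockOne_comm hA, mul_assoc, Q.e_mul_blockOne i hi]

lemma blockTwo_mul_of_mem_proj {x : A} (hx : x ∈ Q.proj 3) : Q.blockTwo * x = x := by
  rw [← Q.mem_proj_iff.mp hx, Q.blockTwo_comm hA, mul_assoc, Q.e_mul_blockTwo]

/-- The corner rings are local. -/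
lemma eq_zero_or_eq_e {i : Fin 4} {f : A} (hf : f * f = f) (hl : Q.e i * f = f)
    (hr : f * Q.e i = f) : f = 0 ∨ f = Q.e i := by
  obtain ⟨c, hc⟩ := (Q.isSplit hA).diag i f
  rw [hl, hr] at hc
  by_cases hc0 : c = 0
  · left
    refine eq_zero_of_isIdempotentElem_of_mem_jacobson hf ?_
    simpa [hc0] using hc
  · right
    -- Here `f` is congruent to a nonzero multiple of `e i` modulo the radical. Multiplying by the
    -- complementary idempotent `e i - f` puts that idempotent in the radical, so it is zero.
    have h1 : (Q.e i - f) * f = 0 := by rw [sub_mul, hl, hf, sub_self]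
    have h2 : (Q.e i - f) * (Q.e i - f) = Q.e i - f := by
      rw [mul_sub, h1, sub_zero, sub_mul, hr, Q.e_mul_e]
    have h3 := Ideal.mul_mem_left (Ring.jacobson A) (Q.e i - f) hc
    rw [mul_sub, h1, zero_sub, neg_mem_iff, mul_smul_comm, sub_mul, hr, Q.e_mul_e] at h3
    have h4 := Submodule.smul_of_tower_mem (Ring.jacobson A) c⁻¹ h3
    rw [smul_smul, inv_mul_cancel₀ hc0, one_smul] at h4
    exact (sub_eq_zero.mp (eq_zero_of_isIdempotentElem_of_mem_jacobson h2 h4)).symm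

lemma central_mul_e {z : A} (hz : z * z = z) (hcomm : ∀ a, z * a = a * z) (i : Fin 4) :
    z * Q.e i = 0 ∨ z * Q.e i = Q.e i := by
  refine Q.eq_zero_or_eq_e hA ?_ ?_ ?_
  · rw [mul_assoc, ← mul_assoc (Q.e i), ← hcomm, mul_assoc z (Q.e i), Q.e_mul_e, ← mul_assoc, hz]
  · rw [hcomm, ← mul_assoc, Q.e_mul_e]
  · rw [mul_assoc, Q.e_mul_e]

/-- The arrows `β` and `δ` join the labels `1` and `2` to `0`. A central idempotent fixing `e 1` but
killing `e 0` would both fix and kill `β`, and similarly for `δ`. -/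
lemma central_mul_e_eq_zero {z : A} (hz : z * z = z) (hcomm : ∀ a, z * a = a * z)
    (h : z * Q.e 0 = 0) : ∀ i ≠ 3, z * Q.e i = 0 := by
  have key {i : Fin 4} {x : A} (hx0 : x ≠ 0) (hx : Q.e 0 * x = x) (hx' : x * Q.e i = x) :
      z * Q.e i = 0 := by
    refine (Q.central_mul_e hA hz hcomm i).resolve_right fun h' => hx0 ?_
    rw [← hx', ← h', ← mul_assoc, ← hcomm, ← hx, ← mul_assoc, h, zero_mul, zero_mul]
  intro i hi
  fin_cases i
  · exact h
  · exact key (fun h => Q.δ_γ_β_α_ne_zero (by simp [h])) Q.e_β Q.β_e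
  · exact key (fun h => Q.δ_γ_β_α_ne_zero (by simp [h])) Q.e_δ Q.δ_e
  · exact absurd rfl hi

lemma isBlockIdempotent_blockOne : IsBlockIdempotent Q.blockOne := by
  refine ⟨⟨Q.blockOne, Subring.mem_center_iff.mpr fun a => (Q.blockOne_comm hA a).symm⟩, rfl,
    Subtype.ext Q.blockOne_mul_self, ?_, ?_⟩
  · intro h
    have h : Q.blockOne = 0 := congrArg Subtype.val h
    refine Q.e_ne_zero 0 ?_
    rw [← Q.e_mul_blockOne 0 (by decide), h, mul_zero]
  · intro f g hf hg hfg hgf hsum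
    have comm (x : Subring.center A) (a : A) : (x : A) * a = a * x :=
      (Subring.mem_center_iff.mp x.2 a).symm
    have hsum' : Q.blockOne = f + g := congrArg Subtype.val hsum
    have hf' : (f : A) * f = f := congrArg Subtype.val hf
    have hg' : (g : A) * g = g := congrArg Subtype.val hg
    have hfg' : (f : A) * g = 0 := congrArg Subtype.val hfg
    have hgf' : (g : A) * f = 0 := congrArg Subtype.val hgf
    rcases Q.central_mul_e hA hf' (comm f) 0 with h | h
    · left
      have := Q.central_mul_blockOne_eq_zero (comm f) (Q.central_mul_e_eq_zero hA hf' (comm f) h)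
      rw [hsum', mul_add, hf', hfg', add_zero] at this
      exact Subtype.ext this
    · right
      have h : (g : A) * Q.e 0 = 0 := by rw [← h, ← mul_assoc, hgf', zero_mul]
      have := Q.central_mul_blockOne_eq_zero (comm g) (Q.central_mul_e_eq_zero hA hg' (comm g) h)
      rw [hsum', mul_add, hg', hgf', zero_add] at this
      exact Subtype.ext this

lemma isBlockIdempotent_blockTwo : IsBlockIdempotent Q.blockTwo := by
  refine ⟨⟨Q.blockTwo, Subring.mem_center_iff.mpr fun a => (Q.blockTwo_comm hA a).symm⟩, rfl,
    Subtype.ext Q.blockTwo_mul_self, ?_, ?_⟩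
  · intro h
    have h : Q.blockTwo = 0 := congrArg Subtype.val h
    refine Q.e_ne_zero 3 ?_
    rw [← Q.e_mul_blockTwo, h, mul_zero]
  · intro f g hf hg hfg hgf hsum
    have comm (x : Subring.center A) (a : A) : (x : A) * a = a * x :=
      (Subring.mem_center_iff.mp x.2 a).symm
    have hsum' : Q.blockTwo = f + g := congrArg Subtype.val hsum
    have hf' : (f : A) * f = f := congrArg Subtype.val hf
    have hg' : (g : A) * g = g := congrArg Subtype.val hg
    have hfg' : (f : A) * g = 0 := congrArg Subtype.val hfg
    have hgf' : (g : A) * f = 0 := congrArg Subtype.val hgf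
    rcases Q.central_mul_e hA hf' (comm f) 3 with h | h
    · left
      have := Q.central_mul_blockTwo_eq_zero (comm f) h
      rw [hsum', mul_add, hf', hfg', add_zero] at this
      exact Subtype.ext this
    · right
      have h : (g : A) * Q.e 3 = 0 := by rw [← h, ← mul_assoc, hgf', zero_mul]
      have := Q.central_mul_blockTwo_eq_zero (comm g) h
      rw [hsum', mul_add, hg', hgf', zero_add] at this
      exact Subtype.ext this

/-- The principal block acts as the identity on the simple module with label `0`. -/
lemma blockOne_smul {M : Type*} [AddCommGroup M] [Module A M] (hM : Q.IsTop 0 M) (x : M) :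
    Q.blockOne • x = x := by
  have h : Q.blockTwo • x = 0 := by
    rw [blockTwo, Finset.sum_smul]
    refine Finset.sum_eq_zero fun p hp => ?_
    rw [← Q.e_mul_v, (Finset.mem_filter.mp hp).2, mul_smul, mul_smul,
      (Q.isSplit hA).e_smul_eq_zero hM (by decide), smul_zero]
  have h1 := congrArg (· • x) Q.blockOne_add_blockTwo
  simpa [add_smul, h] using h1

/-! ### Decompositions into primitive idempotents -/

lemma blockOne_mul_of_equiv {f : A} {i : Fin 4} (hi : i ≠ 3)
    (φ : Ideal.span {f} ≃ₗ[A] Q.proj i) : Q.blockOne * f = f := by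
  let g : Ideal.span {f} := ⟨f, Ideal.subset_span rfl⟩
  have : Q.blockOne • g = g := by
    apply φ.injective
    rw [map_smul]
    exact Subtype.ext (Q.blockOne_mul_of_mem_proj hA hi (φ g).2)
  exact congrArg Subtype.val this

lemma blockTwo_mul_of_equiv {f : A} (φ : Ideal.span {f} ≃ₗ[A] Q.proj 3) : Q.blockTwo * f = f := by
  let g : Ideal.span {f} := ⟨f, Ideal.subset_span rfl⟩
  have : Q.blockTwo • g = g := by
    apply φ.injective
    rw [map_smul]
    exact Subtype.ext (Q.blockTwo_mul_of_mem_proj hA (φ g).2)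
  exact congrArg Subtype.val this

lemma exists_equiv_of_isPrimitiveIdempotent {f : A} (hf : IsPrimitiveIdempotent f) :
    ∃ i, Nonempty (Ideal.span {f} ≃ₗ[A] Q.proj i) := by
  have := projective_span_of_isIdempotentElem hf.1
  have : Module.Finite A (Ideal.span {f}) :=
    Module.Finite.iff_fg.mpr (Submodule.fg_span_singleton f)
  exact (Q.isSplit hA).exists_equiv_proj hf.isIndecomposableModule

/-- Multiply `1 = ∑ f t` by the block idempotent. Each `f t` generates a copy of some `A e`, on
which the block idempotent acts as identity or as zero. -/
lemma blockOne_eq_finsum {n : ℕ} {f : Fin n → A} (hf : CompleteOrthogonalIdempotents f)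
    (hprim : ∀ t, IsPrimitiveIdempotent (f t)) :
    Q.blockOne = ∑ᶠ (t) (_ : ∃ i, i ≠ 3 ∧ Nonempty (Ideal.span {f t} ≃ₗ[A] Q.proj i)), f t := by
  classical
  rw [← mul_one Q.blockOne, ← hf.complete, Finset.mul_sum, finsum_eq_sum_of_fintype]
  refine Finset.sum_congr rfl fun t _ => ?_
  by_cases h : ∃ i, i ≠ 3 ∧ Nonempty (Ideal.span {f t} ≃ₗ[A] Q.proj i)
  · obtain ⟨i, hi, ⟨φ⟩⟩ := id h
    rw [finsum_eq_if, if_pos h, Q.blockOne_mul_of_equiv hA hi φ]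
  · obtain ⟨i, ⟨φ⟩⟩ := Q.exists_equiv_of_isPrimitiveIdempotent hA (hprim t)
    have hi : i = 3 := by
      by_contra hi
      exact h ⟨i, hi, ⟨φ⟩⟩
    subst hi
    rw [finsum_eq_if, if_neg h, ← Q.blockTwo_mul_of_equiv hA φ, ← mul_assoc,
      Q.blockOne_mul_blockTwo, zero_mul]

lemma blockTwo_eq_finsum {n : ℕ} {f : Fin n → A} (hf : CompleteOrthogonalIdempotents f)
    (hprim : ∀ t, IsPrimitiveIdempotent (f t)) :
    Q.blockTwo = ∑ᶠ (t) (_ : Nonempty (Ideal.span {f t} ≃ₗ[A] Q.proj 3)), f t := by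
  classical
  rw [← mul_one Q.blockTwo, ← hf.complete, Finset.mul_sum, finsum_eq_sum_of_fintype]
  refine Finset.sum_congr rfl fun t _ => ?_
  by_cases h : Nonempty (Ideal.span {f t} ≃ₗ[A] Q.proj 3)
  · obtain ⟨φ⟩ := id h
    rw [finsum_eq_if, if_pos h, Q.blockTwo_mul_of_equiv hA φ]
  · obtain ⟨i, ⟨φ⟩⟩ := Q.exists_equiv_of_isPrimitiveIdempotent hA (hprim t)
    have hi : i ≠ 3 := by
      rintro rfl
      exact h ⟨φ⟩
    rw [finsum_eq_if, if_neg h, ← Q.blockOne_mul_of_equiv hA hi φ, ← mul_assoc,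
      Q.blockTwo_mul_blockOne, zero_mul]

/-! ### The regular module -/

/-- Right multiplications by the nine `u p` are jointly injective because `a = ∑ a * u p * v p`.
They are surjective since `12 + 2 * 8 + 2 * 8 + 4 * 4 = 60`. -/
lemma nonempty_regular_equiv : Nonempty (A ≃ₗ[A]
    (Q.proj 0 × (Fin 2 → Q.proj 1) × (Fin 2 → Q.proj 2) × (Fin 4 → Q.proj 3))) := by
  have : Module.Finite k A := Module.finite_of_finrank_pos (by omega)
  have hfin (i : Fin 4) := (Q.proj i).finite_of_tower (k := k)
  let r (i : Fin 4) (p : Fin 9) (h : label p = i) : A →ₗ[A] Q.proj i :=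
    (LinearMap.toSpanSingleton A A (Q.u p)).codRestrict (Q.proj i) fun a => Q.mem_proj_iff.mpr (by
      subst h
      rw [LinearMap.toSpanSingleton_apply, smul_eq_mul, mul_assoc, Q.u_mul_e])
  let f : A →ₗ[A] (Q.proj 0 × (Fin 2 → Q.proj 1) × (Fin 2 → Q.proj 2) × (Fin 4 → Q.proj 3)) :=
    (r 0 0 rfl).prod ((LinearMap.pi ![r 1 1 rfl, r 1 2 rfl]).prod
      ((LinearMap.pi ![r 2 3 rfl, r 2 4 rfl]).prod
        (LinearMap.pi ![r 3 5 rfl, r 3 6 rfl, r 3 7 rfl, r 3 8 rfl])))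
  have hinj : Function.Injective f := by
    rw [← LinearMap.ker_eq_bot, LinearMap.ker_eq_bot']
    intro a ha
    have h0 : ∀ p, a * Q.u p = 0 := by
      have h (g : (Q.proj 0 × (Fin 2 → Q.proj 1) × (Fin 2 → Q.proj 2) × (Fin 4 → Q.proj 3)) → A) :
          g (f a) = g 0 := congrArg g ha
      intro p
      fin_cases p
      · exact h fun y => y.1
      · exact h fun y => y.2.1 0
      · exact h fun y => y.2.1 1
      · exact h fun y => y.2.2.1 0
      · exact h fun y => y.2.2.1 1
      · exact h fun y => y.2.2.2 0
      · exact h fun y => y.2.2.2 1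
      · exact h fun y => y.2.2.2 2
      · exact h fun y => y.2.2.2 3
    rw [← mul_one a, ← Q.sum_u_mul_v, Finset.mul_sum]
    simp_rw [← mul_assoc, h0, zero_mul, Finset.sum_const_zero]
  have hsurj : Function.Surjective f := by
    refine (LinearMap.injective_iff_surjective_of_finrank_eq_finrank
      (f := f.restrictScalars k) ?_).mp hinj
    simp [Module.finrank_prod, Module.finrank_pi_fintype, Q.finrank_proj hA, hA]
  exact ⟨LinearEquiv.ofBijective f ⟨hinj, hsurj⟩⟩

end QuiverFrame

/-! ### Computation in the group algebra of `A₅` over the field with four elements -/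

namespace A5

/-- The cycle `(1,2,3,4,5)`. -/
def fiveCycle : A5 := ⟨finRotate 5, by rw [Equiv.Perm.mem_alternatingGroup]; decide⟩

/-- Two generators of `A₅`. -/
def gen : Bool → A5
  | false => fiveCycle
  | true => cycle123

/-- The product of the first `n` generators of a list, the first one being the rightmost factor. -/
def word : List Bool → ℕ → A5
  | _, 0 => 1
  | [], _ + 1 => 1
  | s :: t, n + 1 => word t n * gen s

/-- The steps of a Hamiltonian path in the Cayley graph of `A₅`. -/
def steps : List Bool := (List.range 59).map (Nat.testBit 439178000490176784)

/-- The elements of `A₅`, numbered along the Hamiltonian path. -/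
def elt (l : ℕ) : A5 := word steps l

/-- The left multiplications by the generators as permutations of the numbers of the elements. -/
def shift : Bool → List ℕ
  | false =>
    [1, 2, 3, 4, 0, 6, 7, 8, 59, 10, 11, 12, 13, 9, 15, 16, 17, 58, 19, 20, 21, 52, 43, 24,
    25, 26, 27, 23, 29, 30, 31, 42, 33, 34, 35, 36, 32, 38, 39, 40, 41, 37, 28, 44, 45, 46,
    22, 48, 49, 50, 51, 47, 18, 54, 55, 56, 57, 53, 14, 5]
  | true =>
    [48, 36, 54, 40, 5, 33, 16, 2, 9, 35, 27, 6, 31, 14, 24, 55, 11, 18, 26, 49, 15, 22, 23,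
    21, 13, 45, 17, 28, 10, 39, 25, 32, 12, 4, 29, 8, 37, 1, 46, 34, 50, 42, 43, 41, 19, 30,
    47, 38, 56, 44, 3, 52, 53, 51, 7, 20, 0, 58, 59, 57]

lemma length_shift (s : Bool) : (shift s).length = 60 := by cases s <;> rfl

lemma shift_lt (s : Bool) : ∀ m ∈ shift s, m < 60 := by
  cases s <;> decide

-- This certifies the tables `shift`: left multiplication by a generator permutes positions, so
-- later products need no arithmetic with permutations.
set_option maxRecDepth 10000 in
lemma gen_mul_elt (s : Bool) : ∀ l : Fin 60, gen s * elt l = elt ((shift s)[l]'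
    (by rw [length_shift]; exact l.2)) := by
  cases s <;> decide +kernel

set_option maxRecDepth 10000 in
lemma elt_injective : Function.Injective fun l : Fin 60 => elt l := by
  decide +kernel

lemma card_eq : Fintype.card A5 = 60 := by
  rw [card_alternatingGroup, Fintype.card_fin]
  rfl

lemma elt_bijective : Function.Bijective fun l : Fin 60 => elt l := by
  rw [Fintype.bijective_iff_injective_and_card, card_eq, Fintype.card_fin]
  exact ⟨elt_injective, rfl⟩

/-- An induction principle: `A₅` is generated by `fiveCycle` and `cycle123`. -/
lemma induction {p : A5 → Prop} (one : p 1) (mul : ∀ s g, p g → p (gen s * g)) (g : A5) : p g := by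
  have key (t : List Bool) : ∀ n g, p g → p (word t n * g) := by
    induction t with
    | nil =>
      intro n g hg
      cases n <;> rwa [word, one_mul]
    | cons s t ih =>
      intro n g hg
      cases n with
      | zero => rwa [word, one_mul]
      | succ n =>
        rw [word, mul_assoc]
        exact ih n _ (mul s g hg)
  obtain ⟨l, rfl⟩ := elt_bijective.2 g
  simpa [elt] using key steps l 1 one

/-- Application of a function to a number that is evaluated first. -/
def force {X : Type*} (n : ℕ) (f : ℕ → X) : X :=
  match n with
  | 0 => f 0
  | m + 1 => f (m + 1)

lemma force_eq {X : Type*} (n : ℕ) (f : ℕ → X) : force n f = f n := by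
  cases n <;> rfl

/-- Permutation of the blocks of `w` bits of a number. -/
def move (w : ℕ) : List ℕ → ℕ → ℕ
  | [], _ => 0
  | m :: t, y => force (y >>> w) fun y' => ((y % 2 ^ w) <<< (w * m)) ^^^ move w t y'

/-- Multiplication of the element in position `p` of `x` with all elements of `y`. -/
def mulAux (w' p w : ℕ) : List Bool → ℕ → ℕ → ℕ
  | [], x, y => bif x.testBit p then y else 0
  | s :: t, x, y => force (x >>> w') fun x' => force (move w (shift s) y) fun y' =>
      (bif x.testBit p then y else 0) ^^^ mulAux w' p w t x' y'

/-! ### From bit strings to the group algebra -/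

section Ev

variable (k : Type u) [Field k]

/-- The element of the group algebra that is coded by the bits of `y` in the positions congruent to
`r` modulo `w`. -/
noncomputable def ev (w y r : ℕ) : k[A5] :=
  ∑ l ∈ Finset.range 60, (bif y.testBit (w * l + r) then MonoidAlgebra.of k A5 (elt l) else 0)

lemma coeff_ev (w y r : ℕ) (l : Fin 60) :
    (ev k w y r).coeff (elt l) = bif y.testBit (w * l + r) then 1 else 0 := by
  rw [ev, ← Fin.sum_univ_eq_sum_range (fun l => bif y.testBit (w * l + r) then
    MonoidAlgebra.of k A5 (elt l) else 0)]
  rw [MonoidAlgebra.coeff_sum, Finset.sum_apply', Finset.sum_eq_single l]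
  · cases y.testBit (w * l + r) <;> simp
  · intro m _ hm
    cases y.testBit (w * m + r)
    · simp
    · simp [elt_injective.eq_iff.not.mpr hm]
  · simp

lemma ev_block {w m : ℕ} (hm : m < 60) (y : ℕ) {r : ℕ} (hr : r < w) :
    ev k w ((y % 2 ^ w) <<< (w * m)) r =
      bif y.testBit r then MonoidAlgebra.of k A5 (elt m) else 0 := by
  rw [ev, Finset.sum_eq_single m]
  · simp [hr]
  · intro l _ hl
    have : ((y % 2 ^ w) <<< (w * m)).testBit (w * l + r) = false := by
      rw [Nat.testBit_shiftLeft, Nat.testBit_mod_two_pow]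
      rcases lt_or_gt_of_ne hl with h | h
      · have := Nat.mul_le_mul_left w (Nat.succ_le_of_lt h)
        rw [Nat.mul_succ] at this
        have : ¬ w * l + r ≥ w * m := by omega
        simp [this]
      · have := Nat.mul_le_mul_left w (Nat.succ_le_of_lt h)
        rw [Nat.mul_succ] at this
        have : ¬ w * l + r - w * m < w := by omega
        simp [this]
    rw [this, cond_false]
  · intro h
    exact absurd (Finset.mem_range.mpr hm) h

variable [CharP k 2]

lemma ev_xor (w x y r : ℕ) : ev k w (x ^^^ y) r = ev k w x r + ev k w y r := by
  rw [ev, ev, ev, ← Finset.sum_add_distrib]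
  refine Finset.sum_congr rfl fun l _ => ?_
  rw [Nat.testBit_xor]
  cases x.testBit (w * l + r) <;> cases y.testBit (w * l + r)
  · simp
  · simp
  · simp
  · rw [← two_smul k, CharTwo.two_eq_zero, zero_smul]
    rfl

lemma ev_move_aux {w r : ℕ} (hr : r < w) (t : List ℕ) (ht : ∀ m ∈ t, m < 60) (y : ℕ) :
    ev k w (move w t y) r = ∑ l : Fin t.length,
      bif y.testBit (w * l + r) then MonoidAlgebra.of k A5 (elt (t.get l)) else 0 := by
  induction t generalizing y with
  | nil => simp [move, ev]
  | cons m t ih =>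
    rw [move, force_eq, ev_xor, ev_block k (ht m (by simp)) y hr,
      ih fun m hm => ht m (by simp [hm])]
    simp only [List.length_cons, Fin.sum_univ_succ]
    congr 1
    · simp
    · refine Finset.sum_congr rfl fun l _ => ?_
      rw [Nat.testBit_shiftRight, Fin.val_succ,
        show w + (w * l + r) = w * (l + 1) + r by ring]
      rfl

lemma ev_move {w r : ℕ} (hr : r < w) (s : Bool) (y : ℕ) :
    ev k w (move w (shift s) y) r = MonoidAlgebra.of k A5 (gen s) * ev k w y r := by
  rw [ev_move_aux k hr _ (shift_lt s), ev, Finset.mul_sum,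
    ← Fin.sum_univ_eq_sum_range (fun l => MonoidAlgebra.of k A5 (gen s) *
      (bif y.testBit (w * l + r) then MonoidAlgebra.of k A5 (elt l) else 0)),
    ← Equiv.sum_comp (finCongr (length_shift s))]
  refine Finset.sum_congr rfl fun l _ => ?_
  simp only [finCongr_apply, Fin.val_cast]
  cases y.testBit (w * l + r)
  · simp
  · simp only [cond_true]
    rw [← map_mul]
    exact congrArg _ (gen_mul_elt s (finCongr (length_shift s) l)).symm

/-- This is a Horner scheme along the Hamiltonian path: each `elt (l + 1) * y` arises from `elt l *
y` by one more generator on the left. Since this generator acts on whole blocks of `w` bits, all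
elements stored in `y` are multiplied at once. -/
lemma ev_mulAux {w' p w r : ℕ} (hr : r < w) (t : List Bool) (x y : ℕ) :
    ev k w (mulAux w' p w t x y) r = ∑ l ∈ Finset.range (t.length + 1),
      (bif x.testBit (w' * l + p) then MonoidAlgebra.of k A5 (word t l) else 0) * ev k w y r := by
  induction t generalizing x y with
  | nil =>
    rw [mulAux, List.length_nil, zero_add, Finset.sum_range_one, mul_zero, zero_add, word, map_one]
    cases x.testBit p
    · simp [ev]
    · simp
  | cons s t ih =>
    rw [mulAux, force_eq, force_eq, ev_xor, ih, List.length_cons,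
      Finset.sum_range_succ' _ (t.length + 1), add_comm]
    refine congrArg₂ (· + ·) ?_ ?_
    · refine Finset.sum_congr rfl fun l _ => ?_
      rw [Nat.testBit_shiftRight, ev_move k hr, ← mul_assoc,
        show w' + (w' * l + p) = w' * (l + 1) + p by ring, word, map_mul]
      cases x.testBit (w' * (l + 1) + p) <;> simp
    · rw [mul_zero, zero_add, word, map_one]
      cases x.testBit p
      · simp [ev]
      · simp

/-- Multiplication of the element in position `p` of `x` with all elements of `y`. -/
def mul (w' x p w y : ℕ) : ℕ := mulAux w' p w steps x y

lemma ev_mul {w r : ℕ} (hr : r < w) (w' x p y : ℕ) :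
    ev k w (mul w' x p w y) r = ev k w' x p * ev k w y r := by
  rw [mul, ev_mulAux k hr, ← Finset.sum_mul]
  rfl

end Ev

/-! ### Coefficients in the field with four elements -/

/-- The bits in the positions congruent to `r` modulo `w`. -/
def plane (w y r : ℕ) : ℕ → ℕ
  | 0 => 0
  | l + 1 => plane w y r l ^^^ (((y >>> (w * l + r)) % 2) <<< l)

lemma testBit_plane (w y r n l : ℕ) :
    (plane w y r n).testBit l = (decide (l < n) && y.testBit (w * l + r)) := by
  induction n with
  | zero => simp [plane]
  | succ n ih =>
    rw [plane, Nat.testBit_xor, ih, Nat.testBit_shiftLeft,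
      show (y >>> (w * n + r)) % 2 = (y >>> (w * n + r)) % 2 ^ 1 from rfl,
      Nat.testBit_mod_two_pow, Nat.testBit_shiftRight]
    rcases lt_trichotomy l n with h | h | h
    · simp [h, Nat.lt_succ_of_lt h, Nat.not_le_of_gt h]
    · subst h
      simp
    · have h1 : ¬ l < n + 1 := by omega
      have h2 : ¬ l - n < 1 := by omega
      simp [h1, h2, Nat.lt_asymm h]

/-- The two bit planes of an element of the group algebra over the field with four elements. -/
abbrev Code : Type := ℕ × ℕ

/-- The element in position `q` of `y`, where `y` holds `n` elements. -/
def code (n y q : ℕ) : Code := (plane (2 * n) y (2 * q) 60, plane (2 * n) y (2 * q + 1) 60)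

/-- Addition of codes. -/
def codeAdd (c d : Code) : Code := (c.1 ^^^ d.1, c.2 ^^^ d.2)

/-- Multiplication by the cube root of unity. -/
def codeRot (c : Code) : Code := (c.2, c.1 ^^^ c.2)

/-- The products of the element in position `p` of `x` with the first `i` elements of `y`, where `x`
holds `m` elements and `y` holds `n` elements. -/
def products (m x p n y i : ℕ) : List Code :=
  force (mul (2 * m) x (2 * p) (2 * n) y) fun z => force (mul (2 * m) x (2 * p + 1) (2 * n) y)
    fun z' => (List.range i).map fun q => codeAdd (code n z q) (codeRot (code n z' q))

section Value

variable {k : Type u} [Field k]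

lemma ev_plane (w y r : ℕ) : ev k 1 (plane w y r 60) 0 = ev k w y r := by
  rw [ev, ev]
  refine Finset.sum_congr rfl fun l hl => ?_
  rw [testBit_plane, add_zero, one_mul, decide_eq_true (Finset.mem_range.mp hl), Bool.true_and]

variable (ω : k)

/-- The element of the group algebra with the given code. -/
noncomputable def value (c : Code) : k[A5] := ev k 1 c.1 0 + ω • ev k 1 c.2 0

lemma value_code (n y q : ℕ) :
    value ω (code n y q) = ev k (2 * n) y (2 * q) + ω • ev k (2 * n) y (2 * q + 1) := by
  rw [value, code, ev_plane, ev_plane]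

@[simp] lemma value_zero : value ω (0, 0) = 0 := by simp [value, ev]

/-- The three nonzero bit pairs stand for `1`, `ω` and `1 + ω`, none of which is zero in `k`; thus a
single set bit makes a coefficient nonzero. -/
lemma value_ne_zero (hω : ω ^ 2 + ω + 1 = 0) {c : Code} {l : ℕ} (hl : l < 60)
    (h : c.1.testBit l = true ∨ c.2.testBit l = true) : value ω c ≠ 0 := by
  intro h0
  have h1 := congrArg (fun a : k[A5] => a.coeff (elt (⟨l, hl⟩ : Fin 60))) h0
  simp only [value, MonoidAlgebra.coeff_add, MonoidAlgebra.coeff_smul, Finsupp.add_apply,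
    Finsupp.smul_apply, coeff_ev k _ _ _ (⟨l, hl⟩ : Fin 60), MonoidAlgebra.coeff_zero,
    Finsupp.zero_apply] at h1
  have hω0 : ω ≠ 0 := by
    rintro rfl
    simp at hω
  have hω1 : 1 + ω ≠ 0 := by
    intro h
    have : ω ^ 2 = 0 := by linear_combination hω - h
    exact hω0 (by simpa using this)
  simp only [one_mul, add_zero] at h1
  cases h2 : c.1.testBit l <;> cases h3 : c.2.testBit l <;> simp_all

variable [CharP k 2]

lemma value_codeAdd (c d : Code) : value ω (codeAdd c d) = value ω c + value ω d := by
  rw [value, codeAdd, ev_xor, ev_xor, value, value, smul_add]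
  abel

variable (hω : ω ^ 2 + ω + 1 = 0)

include hω

lemma value_codeRot (c : Code) : value ω (codeRot c) = ω • value ω c := by
  have h : ω * ω = 1 + ω := by
    linear_combination hω - (1 + ω) * CharTwo.two_eq_zero (R := k)
  rw [value, codeRot, ev_xor, value, smul_add, smul_add, smul_smul, h, add_smul, one_smul]
  abel

lemma value_getElem_products {m x p n y i q : ℕ} (hq : q < i) (hn : q < n) :
    value ω ((products m x p n y i)[q]'(by simpa [products, force_eq] using hq)) =
      value ω (code m x p) * value ω (code n y q) := by
  simp only [products, force_eq, List.getElem_map, List.getElem_range]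
  rw [value_codeAdd, value_codeRot ω hω]
  simp only [value_code]
  rw [ev_mul k (by omega), ev_mul k (by omega), ev_mul k (by omega), ev_mul k (by omega)]
  simp only [add_mul, mul_add, smul_add, smul_mul_assoc, mul_smul_comm]
  abel

end Value

end A5

namespace A5

/-! ### Coded elements of the group algebra -/

/-- Codes of the left factors of the idempotents. -/
def codesU : ℕ :=
  4049837285394725189716764434460017308928725449458453146358817105946911600042759782080835901493586028705588939185173797355562422887499209137519879349068817255862568893238015117376210859843349875145788301482088644476573665604470826889113661487792847100379484248078099681314906079716724029934133104498108617852032627777464435713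

/-- Codes of the right factors of the idempotents. -/
def codesV : ℕ :=
  216043887969100515099966319097597994767103452724921451000817361290157103853547657185633205072965330711604115200876633144646096033226735340471836943288994714084350606975528016166562867047686771434634207840353035704012110025003327794941025761361738727898082929907901022970083064709584413303753461188671876340026240543519671297

/-- Codes of the arrows `α, β, γ, δ` and of their products `βα, γβα, δγβα, δγ, αδγ, γβ, δγβ, αδγβ,
αδ, βαδ, γβαδ`. -/
def codesW : ℕ :=
  67666841092818055737939042252167866900243178162207538176645670672156203403863808840407168386773821019146552480448331814268398284191082176283585316712434158217776011233797403455492284728628904139248204837868730717269592505501546888284695508584071177166118394927558712368952094968467341961301857221970766660086994369365419449401497498437896780772445608758599882138983392320580206059939992066710413443811150175979817573376684254072370978426400143214285786225719036072948215607406968113076438187086424789856469533575649888073438409729970735681536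

/-- Codes of bases of the socles of two projective modules. -/
def codesS : ℕ :=
  2291265506049259975565045094403860705286150726619194394449357282290343220742973904443097266637165994160725742208402143754705434657092650251036695

/-- Codes of left factors in two expressions of `1`. -/
def codesX : ℕ :=
  69064537256093192111694982012806026746957939167322663031172844722869609299875490711218125384788963912498502023798883547253882932416952465180373854101654457801585454018097940260957265631

/-- Codes of right factors in two expressions of `1`. -/
def codesY : ℕ :=
  86224476699973543267277854180966109832944232876301087833067254977202888743367664770723078228197819728247096650203742420392405134782914474118310838811853985429066538563627628540757383254110499019241309705222899107608

/-- The positions of the representatives of the idempotents. -/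
def baseIndex : Fin 4 → Fin 9 := ![0, 1, 3, 5]

/-- The five elements of the left ideal of the idempotent `3` that `A₅` permutes. -/
def codeF (y : ℕ) (i : Fin 5) : Code :=
  if i = 4 then codeAdd (code 9 y 5) (codeAdd (code 9 y 6) (codeAdd (code 9 y 7) (code 9 y 8)))
  else code 9 y (5 + i)

set_option maxRecDepth 100000

/-- The large integers enter the proof only through evaluations such as this one, which holds the
orthogonality relations of the frame. -/
lemma products_codesV : ∀ p q : Fin 9, (products 9 codesV p 9 codesU 9).getD q (0, 0) =
    if p = q then code 9 codesU (baseIndex (label p)) else (0, 0) := by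
  decide +kernel

lemma products_codesU : (List.finRange 9).foldr (fun (p : Fin 9) c => codeAdd
    ((products 9 codesU p 9 codesV 9).getD p (0, 0)) c) (0, 0) = (1, 0) := by
  decide +kernel

lemma code_baseIndex :
    ∀ i, code 9 codesV (baseIndex i) = code 9 codesU (baseIndex i) := by
  decide +kernel

lemma code_baseIndex_ne_zero : ∀ i, code 9 codesU (baseIndex i) ≠ (0, 0) := by
  decide +kernel

lemma code_codesW_ne_zero : ∀ i ∈ [6, 11, 14], code 15 codesW i ≠ (0, 0) := by
  decide +kernel

lemma products_codesU_codesW : ∀ c ∈ [((1 : ℕ), (0 : ℕ)), (0, 1), (3, 2), (0, 3)],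
    (products 9 codesU c.1 15 codesW 15).getD c.2 (0, 0) = code 15 codesW c.2 := by
  decide +kernel

lemma products_codesW_codesU : ∀ c ∈ [((0 : ℕ), (0 : ℕ)), (1, 1), (2, 0), (3, 3)],
    (products 15 codesW c.1 9 codesU 9).getD c.2 (0, 0) = code 15 codesW c.1 := by
  decide +kernel

lemma products_codesW_eq_zero : ∀ c ∈ [((0 : ℕ), (1 : ℕ)), (2, 3)],
    (products 15 codesW c.1 15 codesW 15).getD c.2 (0, 0) = (0, 0) := by
  decide +kernel

/-- A triple `(i, j, l)` records that the stored elements satisfy `w i * w j = w l`. Both `(3, 5,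
6)` and `(1, 8, 6)` end in `6`, and this is the relation `δγβα = βαδγ`. -/
lemma products_codesW : ∀ c ∈ [((1 : ℕ), (0 : ℕ), (4 : ℕ)), (2, 4, 5), (3, 5, 6), (3, 2, 7),
    (0, 7, 8), (1, 8, 6), (2, 1, 9), (3, 9, 10), (0, 10, 11), (0, 3, 12), (1, 12, 13), (2, 13, 14)],
    (products 15 codesW c.1 15 codesW 15).getD c.2.1 (0, 0) = code 15 codesW c.2.2 := by
  decide +kernel

lemma code_codesS_ne_zero : ∀ i : Fin 4, code 4 codesS i ≠ (0, 0) := by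
  decide +kernel

lemma products_codesU_codesS : ∀ c ∈ [((1 : ℕ), (0 : ℕ)), (3, 2)], ∃ l : Fin 60,
    ((products 9 codesU c.1 4 codesS 4).getD c.2 (0, 0)).1.testBit l = true ∨
    ((products 9 codesU c.1 4 codesS 4).getD c.2 (0, 0)).2.testBit l = true := by
  decide +kernel

/-- The two generators act on the first two stored elements through the columns of `genMatrix ω`.
The last two elements of `codesS` do the same for `ω ^ 2`. -/
lemma move_codesS_zero :
    code 4 (move 8 (shift false) codesS) 0 = codeRot (code 4 codesS 1) ∧
    code 4 (move 8 (shift false) codesS) 1 =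
      codeRot (codeRot (codeAdd (code 4 codesS 0) (code 4 codesS 1))) ∧
    code 4 (move 8 (shift true) codesS) 0 = codeRot (code 4 codesS 0) ∧
    code 4 (move 8 (shift true) codesS) 1 = codeRot (codeRot (code 4 codesS 1)) := by
  decide +kernel

lemma move_codesS_two :
    code 4 (move 8 (shift false) codesS) 2 = codeRot (codeRot (code 4 codesS 3)) ∧
    code 4 (move 8 (shift false) codesS) 3 =
      codeRot (codeAdd (code 4 codesS 2) (code 4 codesS 3)) ∧
    code 4 (move 8 (shift true) codesS) 2 = codeRot (codeRot (code 4 codesS 2)) ∧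
    code 4 (move 8 (shift true) codesS) 3 = codeRot (code 4 codesS 3) := by
  decide +kernel

lemma codeF_move : ∀ s i, codeF (move 18 (shift s) codesU) i =
    codeF codesU ((gen s : Equiv.Perm (Fin 5)) i) := by
  decide +kernel

lemma code_codesY :
    code 6 codesY 1 = codeAdd (2 ^ 48, 0) (codeRot (1, 0)) ∧
    code 6 codesY 2 = codeAdd (2 ^ 16, 0) (1, 0) ∧
    code 6 codesY 4 = codeAdd (2 ^ 48, 0) (codeRot (codeRot (1, 0))) ∧
    code 6 codesY 5 = codeAdd (2 ^ 16, 0) (1, 0) := by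
  decide +kernel

/-- Each identity reads `1 = x y + x' (c + η) + x'' (s + 1)`, with `c` the three-cycle, `s` the
involution `elt 16` and `η` equal to `ω` or `ω ^ 2`. On a vector with eigenvalue `η` under `c` and
fixed by `s`, only `x y` survives. -/
lemma products_codesX : ∀ i ∈ [0, 3], codeAdd ((products 6 codesX i 6 codesY 6).getD i (0, 0))
    (codeAdd ((products 6 codesX (i + 1) 6 codesY 6).getD (i + 1) (0, 0))
      ((products 6 codesX (i + 2) 6 codesY 6).getD (i + 2) (0, 0))) = (1, 0) := by
  decide +kernel

lemma products_codesU_codesY :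
    (products 9 codesU 3 6 codesY 6).getD 0 (0, 0) = code 6 codesY 0 ∧
    (products 9 codesU 1 6 codesY 6).getD 3 (0, 0) = code 6 codesY 3 := by
  decide +kernel

lemma elt_forty_eight : elt 48 = cycle123 := by
  decide +kernel

lemma elt_sixteen_mul_self : elt 16 * elt 16 = 1 := by
  decide +kernel

lemma elt_sixteen_mem : elt 16 ∈ A4 := by
  rw [MulAction.mem_stabilizer_iff]
  decide +kernel

section Value

variable {k : Type u} [Field k] (ω : k)

lemma ev_two_pow {l : ℕ} (hl : l < 60) : ev k 1 (2 ^ l) 0 = MonoidAlgebra.of k A5 (elt l) := by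
  rw [ev, Finset.sum_eq_single l]
  · simp
  · intro m _ hm
    rw [one_mul, add_zero, Nat.testBit_two_pow_of_ne (Ne.symm hm), cond_false]
  · intro h
    exact absurd (Finset.mem_range.mpr hl) h

lemma value_two_pow {l : ℕ} (hl : l < 60) :
    value ω (2 ^ l, 0) = MonoidAlgebra.of k A5 (elt l) := by
  rw [value, ev_two_pow hl]
  simp [ev]

lemma value_one : value ω (1, 0) = 1 := by
  have := value_two_pow ω (l := 0) (by omega)
  rwa [pow_zero, show elt 0 = 1 by rfl, map_one] at this

lemma value_code_ne_zero {n y q : ℕ} (hω : ω ^ 2 + ω + 1 = 0) (h : code n y q ≠ (0, 0)) :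
    value ω (code n y q) ≠ 0 := by
  have hex : ∃ l < 60, (code n y q).1.testBit l = true ∨ (code n y q).2.testBit l = true := by
    by_contra! hc
    refine h (Prod.ext (Nat.eq_of_testBit_eq fun l => ?_) (Nat.eq_of_testBit_eq fun l => ?_))
    · by_cases hl : l < 60
      · simpa using (hc l hl).1
      · simp [code, testBit_plane, hl]
    · by_cases hl : l < 60
      · simpa using (hc l hl).2
      · simp [code, testBit_plane, hl]
  obtain ⟨l, hl, h⟩ := hex
  exact value_ne_zero ω hω hl h

variable [CharP k 2]

lemma value_code_move {n q : ℕ} (hq : q < n) (s : Bool) (y : ℕ) :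
    value ω (code n (move (2 * n) (shift s) y) q) =
      MonoidAlgebra.of k A5 (gen s) * value ω (code n y q) := by
  rw [value_code, value_code, ev_move k (by omega), ev_move k (by omega), mul_add, mul_smul_comm]

variable {ω} (hω : ω ^ 2 + ω + 1 = 0)

include hω

lemma value_products {m x p n y q : ℕ} (hq : q < n) :
    value ω ((products m x p n y n).getD q (0, 0)) =
      value ω (code m x p) * value ω (code n y q) := by
  rw [List.getD_eq_getElem _ _ (by simpa [products, force_eq] using hq),
    value_getElem_products ω hω hq hq]

lemma value_mul {m x p n y q : ℕ} {c : Code} (hq : q < n)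
    (h : (products m x p n y n).getD q (0, 0) = c) :
    value ω (code m x p) * value ω (code n y q) = value ω c := by
  rw [← value_products hω hq, h]

lemma value_arrow (c : ℕ × ℕ × ℕ)
    (h : c ∈ [((1 : ℕ), (0 : ℕ), (4 : ℕ)), (2, 4, 5), (3, 5, 6), (3, 2, 7),
    (0, 7, 8), (1, 8, 6), (2, 1, 9), (3, 9, 10), (0, 10, 11), (0, 3, 12), (1, 12, 13),
    (2, 13, 14)]) :
    value ω (code 15 codesW c.1) * value ω (code 15 codesW c.2.1) =
      value ω (code 15 codesW c.2.2) := by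
  refine value_mul hω ?_ (products_codesW c h)
  revert c
  decide

/-- The idempotents and arrows of the group algebra of `A₅`. -/
noncomputable def frame : QuiverFrame k[A5] where
  e i := value ω (code 9 codesU (baseIndex i))
  u p := value ω (code 9 codesU p)
  v p := value ω (code 9 codesV p)
  base := baseIndex
  σ_base := by decide
  u_base _ := rfl
  v_base i := by rw [code_baseIndex]
  v_mul_u p q := by
    rw [← value_products hω q.2, products_codesV]
    split_ifs
    · rfl
    · exact value_zero ω
  sum_u_mul_v := by
    rw [← value_one ω, ← products_codesU, Fin.sum_univ_def]
    generalize List.finRange 9 = t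
    induction t with
    | nil => simp
    | cons p t ih =>
      rw [List.map_cons, List.sum_cons, ih, List.foldr_cons, value_codeAdd,
        value_products hω p.2]
  α := value ω (code 15 codesW 0)
  β := value ω (code 15 codesW 1)
  γ := value ω (code 15 codesW 2)
  δ := value ω (code 15 codesW 3)
  e_α := value_mul hω (by decide) (products_codesU_codesW (1, 0) (by decide))
  α_e := value_mul hω (by decide) (products_codesW_codesU (0, 0) (by decide))
  e_β := value_mul hω (by decide) (products_codesU_codesW (0, 1) (by decide))
  β_e := value_mul hω (by decide) (products_codesW_codesU (1, 1) (by decide))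
  e_γ := value_mul hω (by decide) (products_codesU_codesW (3, 2) (by decide))
  γ_e := value_mul hω (by decide) (products_codesW_codesU (2, 0) (by decide))
  e_δ := value_mul hω (by decide) (products_codesU_codesW (0, 3) (by decide))
  δ_e := value_mul hω (by decide) (products_codesW_codesU (3, 3) (by decide))
  α_β := (value_mul hω (by decide) (products_codesW_eq_zero (0, 1) (by decide))).trans
    (value_zero ω)
  γ_δ := (value_mul hω (by decide) (products_codesW_eq_zero (2, 3) (by decide))).trans
    (value_zero ω)
  β_α_δ_γ := by
    rw [value_arrow hω (3, 2, 7) (by decide), value_arrow hω (0, 7, 8) (by decide),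
      value_arrow hω (1, 8, 6) (by decide), value_arrow hω (1, 0, 4) (by decide),
      value_arrow hω (2, 4, 5) (by decide), value_arrow hω (3, 5, 6) (by decide)]
  δ_γ_β_α_ne_zero := by
    rw [value_arrow hω (1, 0, 4) (by decide), value_arrow hω (2, 4, 5) (by decide),
      value_arrow hω (3, 5, 6) (by decide)]
    exact value_code_ne_zero ω hω (code_codesW_ne_zero 6 (by decide))
  α_δ_γ_β_ne_zero := by
    rw [value_arrow hω (2, 1, 9) (by decide), value_arrow hω (3, 9, 10) (by decide),
      value_arrow hω (0, 10, 11) (by decide)]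
    exact value_code_ne_zero ω hω (code_codesW_ne_zero 11 (by decide))
  γ_β_α_δ_ne_zero := by
    rw [value_arrow hω (0, 3, 12) (by decide), value_arrow hω (1, 12, 13) (by decide),
      value_arrow hω (2, 13, 14) (by decide)]
    exact value_code_ne_zero ω hω (code_codesW_ne_zero 14 (by decide))
  e_ne_zero i := value_code_ne_zero ω hω (code_baseIndex_ne_zero i)

end Value

end A5

/-! ### Representations and modules over the group algebra -/

section Representation

variable {k G V M : Type*} [Field k] [Group G] [AddCommGroup V] [Module k V] [AddCommGroup M]
  [Module k M] [Module k[G] M] [IsScalarTower k k[G] M]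

/-- A linear map that commutes with the group elements commutes with the group algebra. -/
lemma Representation.map_smul_of_intertwines (ρ : Representation k G V) (f : V →ₗ[k] M)
    (hf : ∀ g x, f (ρ g x) = MonoidAlgebra.of k G g • f x) (a : k[G]) (x : ρ.asModule) :
    f (ρ.asModuleEquiv (a • x)) = a • f (ρ.asModuleEquiv x) := by
  induction a using MonoidAlgebra.induction_on with
  | of g => rw [asModuleEquiv_map_smul, asAlgebraHom_of, hf]
  | add a b ha hb => rw [add_smul, map_add, map_add, ha, hb, add_smul]
  | smul r a ha => rw [smul_assoc, map_smul, map_smul, ha, smul_assoc]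

end Representation

/-! ### Characters of `A₄` from the fixed line -/

section LineCharacter

variable {k : Type u} [Field k]

lemma linePoint_ne_zero (η : k) (i : Fin 5) : linePoint η i ≠ 0 := by
  intro h
  have h0 := congrFun h 0
  have h1 := congrFun h 1
  fin_cases i <;> simp [linePoint] at h0 h1

/-- The character of `A₄` on the line that it fixes. -/
lemma IsProjectiveLineRep.exists_character {η : k} {ρ : Representation k A5 (Fin 2 → k)}
    (hρ : IsProjectiveLineRep η ρ) : ∃ χ : A4 →* k,
      ∀ h : A4, ρ h (linePoint η 4) = χ h • linePoint η 4 := by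
  have hex (h : A4) : ∃ c : k, ρ h (linePoint η 4) = c • linePoint η 4 := by
    obtain ⟨c, hc⟩ := hρ.2 h 4
    have h4 : ((h : A5) : Equiv.Perm (Fin 5)) 4 = 4 := h.2
    exact ⟨c, by rw [hc, h4]⟩
  choose c hc using hex
  have hinj : Function.Injective fun a : k => a • linePoint η 4 :=
    smul_left_injective k (linePoint_ne_zero η 4)
  refine ⟨⟨⟨c, hinj ?_⟩, fun g h => hinj ?_⟩, hc⟩
  · simp only [← hc, one_smul]
    simp
  · simp only [← hc, Subgroup.coe_mul, map_mul, Module.End.mul_apply, mul_smul]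
    rw [hc h, map_smul, hc g, smul_smul, smul_smul, mul_comm]

/-- The one-dimensional representation with a given character. -/
def characterRep {H : Type*} [Group H] (χ : H →* k) : Representation k H k where
  toFun h := χ h • LinearMap.id
  map_one' := by rw [map_one, one_smul]; rfl
  map_mul' g h := by
    ext
    simp [mul_comm]

lemma characterRep_apply {H : Type*} [Group H] (χ : H →* k) (h : H) (a : k) :
    characterRep χ h a = χ h * a := rfl

end LineCharacter

/-! ### Modules induced from `A₄` -/

namespace A5

section Induced

variable {k : Type u} [Field k] (χ : A4 →* k)

/-- The generator of an induced module. -/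
noncomputable def indGen : IndA5 (characterRep χ) :=
  (Representation.ind A4.subtype (characterRep χ)).asModuleEquiv.symm
    (Representation.IndV.mk A4.subtype (characterRep χ) 1 1)

lemma indV_mk_mul (g : A4) (h : A5) (a : k) :
    Representation.IndV.mk A4.subtype (characterRep χ) (g * h) (χ g * a) =
      Representation.IndV.mk A4.subtype (characterRep χ) h a := by
  have := Representation.Coinvariants.mk_self_apply
    (Representation.tprod ((Representation.leftRegular k A5).comp A4.subtype) (characterRep χ)) g
    (TensorProduct.tmul k (MonoidAlgebra.single h 1) a)
  simp only [Representation.tprod_apply, TensorProduct.map_tmul, characterRep_apply,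
    MonoidHom.comp_apply, Representation.ofMulAction_single, smul_eq_mul] at this
  exact this

/-- Induced modules are modelled as coinvariants on which the group acts by inverse right
translation; hence the inverse on the right-hand side. -/
lemma of_smul_indGen (h : A5) (a : k) :
    (Representation.ind A4.subtype (characterRep χ)).asModuleEquiv
    (a • MonoidAlgebra.of k A5 h • indGen χ) =
      Representation.IndV.mk A4.subtype (characterRep χ) h⁻¹ a := by
  rw [map_smul, Representation.asModuleEquiv_map_smul, Representation.asAlgebraHom_of, indGen,
    LinearEquiv.apply_symm_apply, Representation.ind_mk, one_mul, ← map_smul, smul_eq_mul, mul_one]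

lemma of_smul_indGen_of_mem (h : A4) : MonoidAlgebra.of k A5 h • indGen χ = χ h • indGen χ := by
  apply (Representation.ind A4.subtype (characterRep χ)).asModuleEquiv.injective
  have h1 := of_smul_indGen χ (h : A5) 1
  have h2 := of_smul_indGen χ 1 (χ h)
  rw [one_smul] at h1
  rw [map_one, one_smul] at h2
  rw [h1, h2, ← indV_mk_mul χ h]
  simp

lemma span_indGen_smul : Submodule.span k (Set.range fun h : A5 =>
    MonoidAlgebra.of k A5 h • indGen χ) = ⊤ := by
  rw [eq_top_iff]
  rintro x -
  obtain ⟨y, rfl⟩ :=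
    (Representation.ind A4.subtype (characterRep χ)).asModuleEquiv.symm.surjective x
  induction y using Representation.Coinvariants.induction_on with
  | h y =>
    induction y using TensorProduct.induction_on with
    | zero => simp
    | add y z hy hz =>
      rw [map_add, map_add]
      exact add_mem hy hz
    | tmul f a =>
      induction f using MonoidAlgebra.induction_on with
      | of h =>
        have := of_smul_indGen χ h⁻¹ a
        rw [inv_inv] at this
        have := (LinearEquiv.eq_symm_apply _).mpr this
        exact this ▸ Submodule.smul_mem _ _ (Submodule.subset_span ⟨_, rfl⟩)
      | add f g hf hg =>
        rw [TensorProduct.add_tmul, map_add, map_add]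
        exact add_mem hf hg
      | smul r f hf =>
        rw [← TensorProduct.smul_tmul', map_smul, map_smul]
        exact Submodule.smul_mem _ _ hf

lemma span_indGen : Submodule.span k[A5] {indGen χ} = ⊤ := by
  rw [eq_top_iff]
  intro x _
  have hx : x ∈ Submodule.span k (Set.range fun h : A5 =>
    MonoidAlgebra.of k A5 h • indGen χ) := by rw [span_indGen_smul]; trivial
  refine Submodule.span_le (p := (Submodule.span k[A5] {indGen χ}).restrictScalars k) |>.mpr ?_ hx
  rintro _ ⟨h, rfl⟩
  exact Submodule.smul_mem _ _ (Submodule.mem_span_singleton_self _)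

/-- Representatives of the cosets of `A₄`. -/
def transversal (i : Fin 5) : A5 := fiveCycle ^ (i.val + 1)

/-- The five-cycle sends the fixed point `4` to `0`, so its power `i + 1` sends `4` to `i`. -/
lemma transversal_apply : ∀ i, (transversal i : Equiv.Perm (Fin 5)) 4 = i := by
  decide

lemma span_transversal_smul : Submodule.span k (Set.range fun i =>
    MonoidAlgebra.of k A5 (transversal i) • indGen χ) = ⊤ := by
  rw [← top_le_iff, ← span_indGen_smul, Submodule.span_le]
  rintro _ ⟨h, rfl⟩
  let i := (h : Equiv.Perm (Fin 5)) 4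
  have hmem : (transversal i)⁻¹ * h ∈ A4 := by
    rw [MulAction.mem_stabilizer_iff, mul_smul, inv_smul_eq_iff]
    exact (transversal_apply i).symm
  have := of_smul_indGen_of_mem χ ⟨_, hmem⟩
  have h2 : MonoidAlgebra.of k A5 h • indGen χ =
      χ ⟨_, hmem⟩ • MonoidAlgebra.of k A5 (transversal i) • indGen χ := by
    rw [smul_comm, ← this, smul_smul, ← map_mul, mul_inv_cancel_left]
  change _ ∈ Submodule.span k _
  dsimp only
  rw [h2]
  exact Submodule.smul_mem _ _ (Submodule.subset_span ⟨i, rfl⟩)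

/-- The induced module maps to five copies of `k²` by placing the translate of the line fixed by
`A₄` in the coordinate of the corresponding point; this is well defined exactly because `χ`
describes `A₄` on that line. The five generators land in different coordinates and are nonzero. -/
lemma linearIndependent_transversal_smul {η : k} {ρ : Representation k A5 (Fin 2 → k)}
    (hχ : ∀ h : A4, ρ h (linePoint η 4) = χ h • linePoint η 4) :
    LinearIndependent k fun i => MonoidAlgebra.of k A5 (transversal i) • indGen χ := by
  let φ (h : A5) : k →ₗ[k] Fin 5 → Fin 2 → k :=
    LinearMap.toSpanSingleton k _
      (Pi.single ((h⁻¹ : A5) • (4 : Fin 5)) (ρ h⁻¹ (linePoint η 4)))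
  have hb (h : A5) : (MonoidAlgebra.basis A5 k).constr k φ (MonoidAlgebra.single h 1) = φ h := by
    have := (MonoidAlgebra.basis A5 k).constr_basis k φ h
    simpa using this
  let Φ : Representation.IndV A4.subtype (characterRep χ) →ₗ[k] Fin 5 → Fin 2 → k :=
    Representation.Coinvariants.lift _
      (TensorProduct.lift ((MonoidAlgebra.basis A5 k).constr k φ)) fun g => by
        refine TensorProduct.ext (MonoidAlgebra.lhom_ext' fun h => LinearMap.ext_ring ?_)
        ext1
        have h4 : (((g : A5) * h)⁻¹ : A5) • (4 : Fin 5) = (h⁻¹ : A5) • (4 : Fin 5) := by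
          rw [mul_inv_rev, mul_smul]
          congr 1
          rw [inv_smul_eq_iff]
          exact g.2.symm
        have h5 : ρ ((g : A5) * h)⁻¹ (linePoint η 4) = χ g⁻¹ • ρ h⁻¹ (linePoint η 4) := by
          rw [mul_inv_rev, map_mul, Module.End.mul_apply, ← Subgroup.coe_inv, hχ, map_smul]
        have h6 : φ (g * h) (χ g) = φ h 1 := by
          simp only [φ, LinearMap.toSpanSingleton_apply]
          rw [h4, h5, Pi.single_smul, smul_smul, ← map_mul, mul_inv_cancel, map_one]
        simpa [hb, characterRep_apply] using h6
  refine LinearIndependent.of_comp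
    (Φ ∘ₗ (Representation.ind A4.subtype (characterRep χ)).asModuleEquiv.toLinearMap) ?_
  have hΦ (i : Fin 5) : Φ ((Representation.ind A4.subtype (characterRep χ)).asModuleEquiv
      (MonoidAlgebra.of k A5 (transversal i) • indGen χ)) =
      Pi.single i (ρ (transversal i) (linePoint η 4)) := by
    have h1 := of_smul_indGen χ (transversal i) 1
    rw [one_smul] at h1
    rw [h1]
    have h4 : (transversal i) • (4 : Fin 5) = i := transversal_apply i
    simp [Φ, hb, φ, h4]
  rw [Fintype.linearIndependent_iff]
  intro g hg j
  have hg :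
      ∑ i, g i • (Pi.single i (ρ (transversal i) (linePoint η 4)) : Fin 5 → Fin 2 → k) = 0 := by
    simp_rw [← hΦ]
    exact hg
  have hj := congrFun hg j
  simp_rw [← Pi.single_smul, Finset.univ_sum_single] at hj
  refine (smul_eq_zero.mp hj).resolve_right fun h0 => linePoint_ne_zero η 4 ?_
  rw [← Representation.inv_self_apply ρ (transversal j) (linePoint η 4), h0, map_zero]

lemma finrank_indA5 {η : k} {ρ : Representation k A5 (Fin 2 → k)}
    (hχ : ∀ h : A4, ρ h (linePoint η 4) = χ h • linePoint η 4) :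
    Module.Finite k (IndA5 (characterRep χ)) ∧ Module.finrank k (IndA5 (characterRep χ)) = 5 := by
  let b := Module.Basis.mk (linearIndependent_transversal_smul χ hχ) (span_transversal_smul χ).ge
  exact ⟨Module.Finite.of_basis b, (Module.finrank_eq_card_basis b).trans (Fintype.card_fin 5)⟩

end Induced

end A5

namespace A5

variable {k : Type u} [Field k]

/-! ### The two-dimensional representations -/

/-- The matrices of the generators. -/
def genMatrix (η : k) : Bool → Matrix (Fin 2) (Fin 2) k
  | false => !![0, η ^ 2; η, η ^ 2]
  | true => !![η, 0; 0, η ^ 2]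

lemma pow_three_eq_one {η : k} (hη : η ^ 2 + η + 1 = 0) : η ^ 3 = 1 := by
  linear_combination (η - 1) * hη

lemma square_root_eq {η : k} (hη : η ^ 2 + η + 1 = 0) : (η ^ 2) ^ 2 + η ^ 2 + 1 = 0 := by
  linear_combination hη + η * pow_three_eq_one hη

section Matrices

variable [CharP k 2] {η : k} (hη : η ^ 2 + η + 1 = 0)

include hη

lemma one_add_eq : 1 + η = η ^ 2 := by
  linear_combination -hη + (1 + η) * CharTwo.two_eq_zero (R := k)

lemma det_genMatrix (s : Bool) : (genMatrix η s).det = 1 := by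
  have h3 := pow_three_eq_one hη
  have h2 := CharTwo.two_eq_zero (R := k)
  cases s
  · simp only [genMatrix, Matrix.det_fin_two_of]
    linear_combination -h3 - h2
  · simp only [genMatrix, Matrix.det_fin_two_of]
    linear_combination h3

lemma genMatrix_mulVec (s : Bool) (i : Fin 5) : ∃ c : k,
    (genMatrix η s).mulVec (linePoint η i) =
      c • linePoint η ((gen s : Equiv.Perm (Fin 5)) i) := by
  have h3 := pow_three_eq_one hη
  have h1 := one_add_eq hη
  have h2 := CharTwo.two_eq_zero (R := k)
  have key (c : k) (j : Fin 5) (hj : (gen s : Equiv.Perm (Fin 5)) i = j)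
      (e0 : genMatrix η s 0 0 * linePoint η i 0 + genMatrix η s 0 1 * linePoint η i 1 =
        c * linePoint η j 0)
      (e1 : genMatrix η s 1 0 * linePoint η i 0 + genMatrix η s 1 1 * linePoint η i 1 =
        c * linePoint η j 1) : ∃ c : k,
      (genMatrix η s).mulVec (linePoint η i) =
        c • linePoint η ((gen s : Equiv.Perm (Fin 5)) i) := by
    refine ⟨c, ?_⟩
    rw [hj]
    ext r
    fin_cases r
    · simpa [Matrix.mulVec, dotProduct] using e0
    · simpa [Matrix.mulVec, dotProduct] using e1
  cases s <;> fin_cases i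
  · exact key (η ^ 2) 1 rfl (by simp [genMatrix, linePoint])
      (by simp [genMatrix, linePoint]; linear_combination -h1 - h3 + η * h2)
  · exact key 1 2 rfl (by simp [genMatrix, linePoint]; linear_combination h3)
      (by simp [genMatrix, linePoint]; linear_combination h1 + h3)
  · exact key η 3 rfl (by simp [genMatrix, linePoint]; linear_combination η * h3)
      (by simp [genMatrix, linePoint]; linear_combination η * h3 + η * h2)
  · exact key η 4 rfl (by simp [genMatrix, linePoint]) (by simp [genMatrix, linePoint])
  · exact key (η ^ 2) 0 rfl (by simp [genMatrix, linePoint]) (by simp [genMatrix, linePoint])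
  · exact key η 1 rfl (by simp [genMatrix, linePoint])
      (by simp [genMatrix, linePoint]; ring)
  · exact key η 2 rfl (by simp [genMatrix, linePoint])
      (by simp [genMatrix, linePoint]; ring)
  · exact key η 0 rfl (by simp [genMatrix, linePoint])
      (by simp [genMatrix, linePoint]; linear_combination η * h3)
  · exact key η 3 rfl (by simp [genMatrix, linePoint]) (by simp [genMatrix, linePoint])
  · exact key (η ^ 2) 4 rfl (by simp [genMatrix, linePoint]) (by simp [genMatrix, linePoint])

/-- Two elements of the group algebra that are permuted by the generators like the standard basis
define a two-dimensional representation. -/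
lemma exists_isProjectiveLineRep {w₀ w₁ : k[A5]} (h₀ : w₀ ≠ 0) (h₁ : w₁ ≠ 0)
    (ha₀ : MonoidAlgebra.of k A5 (gen false) * w₀ = η • w₁)
    (ha₁ : MonoidAlgebra.of k A5 (gen false) * w₁ = η ^ 2 • (w₀ + w₁))
    (hb₀ : MonoidAlgebra.of k A5 (gen true) * w₀ = η • w₀)
    (hb₁ : MonoidAlgebra.of k A5 (gen true) * w₁ = η ^ 2 • w₁) :
    ∃ ρ : Representation k A5 (Fin 2 → k), IsProjectiveLineRep η ρ ∧
      ρ cycle123 (linePoint η 4) = η ^ 2 • linePoint η 4 ∧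
      ∀ g x, ρ g x 0 • w₀ + ρ g x 1 • w₁ = MonoidAlgebra.of k A5 g * (x 0 • w₀ + x 1 • w₁) := by
  have hη0 : η ≠ 0 := by
    rintro rfl
    simp at hη
  have hη1 : η ^ 2 - η ≠ 0 := by
    intro h
    have h2 := CharTwo.two_eq_zero (R := k)
    exact one_ne_zero (α := k) (by linear_combination hη - h - η * h2)
  -- The vectors `w₀`, `w₁` are eigenvectors of the three-cycle for the distinct eigenvalues `η` and
  -- `η ^ 2`, hence independent.
  have hinj {x y : Fin 2 → k} (h : x 0 • w₀ + x 1 • w₁ = y 0 • w₀ + y 1 • w₁) : x = y := by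
    have hb := congrArg (MonoidAlgebra.of k A5 (gen true) * ·) h
    simp only [mul_add, mul_smul_comm, hb₀, hb₁] at hb
    have e1 : ((x 1 - y 1) * (η ^ 2 - η)) • w₁ = 0 := by
      calc ((x 1 - y 1) * (η ^ 2 - η)) • w₁
          = (x 0 • η • w₀ + x 1 • η ^ 2 • w₁ - η • (x 0 • w₀ + x 1 • w₁)) -
            (y 0 • η • w₀ + y 1 • η ^ 2 • w₁ - η • (y 0 • w₀ + y 1 • w₁)) := by module
        _ = 0 := by rw [hb, h, sub_self]
    have e1 : x 1 = y 1 := by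
      rcases smul_eq_zero.mp e1 with h' | h'
      · exact sub_eq_zero.mp ((mul_eq_zero.mp h').resolve_right hη1)
      · exact absurd h' h₁
    rw [e1, add_left_inj] at h
    have e0 : x 0 = y 0 := smul_left_injective k h₀ h
    ext r
    fin_cases r
    · exact e0
    · exact e1
  -- An operator is built for each `g` from some word in the generators. By `hinj` it is determined
  -- by its effect inside the group algebra, so the choices automatically form a representation and
  -- no presentation of `A₅` is needed.
  have hex (g : A5) : ∃ L : (Fin 2 → k) →ₗ[k] (Fin 2 → k),
      (∀ x, L x 0 • w₀ + L x 1 • w₁ = MonoidAlgebra.of k A5 g * (x 0 • w₀ + x 1 • w₁)) ∧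
      LinearMap.det L = 1 ∧ ∀ i, ∃ c : k, L (linePoint η i) =
        c • linePoint η ((g : Equiv.Perm (Fin 5)) i) := by
    induction g using A5.induction with
    | one =>
      exact ⟨LinearMap.id, fun x => by rw [map_one, one_mul, LinearMap.id_apply], LinearMap.det_id,
        fun i => ⟨1, by simp⟩⟩
    | mul s g ih =>
      obtain ⟨L, hL, hdet, hline⟩ := ih
      refine ⟨(Matrix.toLin' (genMatrix η s)) ∘ₗ L, fun x => ?_, ?_, fun i => ?_⟩
      · rw [LinearMap.comp_apply, map_mul, mul_assoc, ← hL]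
        generalize L x = y
        cases s
        · simp only [mul_add, mul_smul_comm, ha₀, ha₁]
          simp [genMatrix, Matrix.mulVec, dotProduct]
          module
        · simp only [mul_add, mul_smul_comm, hb₀, hb₁]
          simp [genMatrix, Matrix.mulVec, dotProduct]
          module
      · rw [LinearMap.det_comp, hdet, LinearMap.det_toLin', det_genMatrix hη, mul_one]
      · obtain ⟨c, hc⟩ := hline i
        obtain ⟨d, hd⟩ := genMatrix_mulVec hη s ((g : Equiv.Perm (Fin 5)) i)
        refine ⟨c * d, ?_⟩
        rw [LinearMap.comp_apply, hc, map_smul, Matrix.toLin'_apply, hd, smul_smul]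
        rfl
  choose L hL hdet hline using hex
  refine ⟨⟨⟨L, ?_⟩, fun g h => ?_⟩, ⟨hdet, hline⟩, hinj ?_, hL⟩
  · refine LinearMap.ext fun x => hinj ?_
    rw [hL, map_one, one_mul, Module.End.one_apply]
  · refine LinearMap.ext fun x => hinj ?_
    rw [hL, Module.End.mul_apply, hL, hL, map_mul, mul_assoc]
  · refine (hL cycle123 _).trans ?_
    have e0 : linePoint η 4 0 = 0 := rfl
    have e1 : linePoint η 4 1 = 1 := rfl
    rw [Pi.smul_apply, Pi.smul_apply, e0, e1, zero_smul, smul_zero, zero_smul, zero_add, zero_add,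
      one_smul, smul_eq_mul, mul_one]
    exact hb₁

end Matrices

/-! ### The simple modules inside the group algebra -/

section Modules

variable (k) in
lemma finrank_sumZero : Module.finrank k (sumZeroSubrep k).toSubmodule = 4 := by
  have h : (∑ i : Fin 5, LinearMap.proj (R := k) (φ := fun _ => k) i) ≠ 0 := by
    intro h
    have := LinearMap.congr_fun h (Pi.single 0 1)
    simp at this
  have h2 := Module.Dual.finrank_ker_add_one_of_ne_zero h
  rw [Module.finrank_fin_fun] at h2
  exact Nat.succ_injective h2

variable [CharP k 2]

lemma of_mul_value_codeF (ω : k) (g : A5) (i : Fin 5) :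
    MonoidAlgebra.of k A5 g * value ω (codeF codesU i) =
    value ω (codeF codesU ((g : Equiv.Perm (Fin 5)) i)) := by
  induction g using A5.induction with
  | one => rw [map_one, one_mul]; rfl
  | mul s g ih =>
    have key (i : Fin 5) : MonoidAlgebra.of k A5 (gen s) * value ω (codeF codesU i) =
        value ω (codeF (move 18 (shift s) codesU) i) := by
      have hmove {q : ℕ} (hq : q < 9) := value_code_move ω hq s codesU
      by_cases h : i = 4
      · simp only [codeF, if_pos h, value_codeAdd, mul_add]
        rw [hmove (by omega), hmove (by omega), hmove (by omega), hmove (by omega)]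
      · simp only [codeF, if_neg h]
        rw [hmove (by omega)]
    rw [map_mul, mul_assoc, ih, key, codeF_move]
    rfl

/-- The value squares to `1`, and `1` has no other square root in characteristic `2`. -/
lemma character_elt_sixteen (χ : A4 →* k) : χ ⟨elt 16, elt_sixteen_mem⟩ = 1 := by
  have h : χ ⟨elt 16, elt_sixteen_mem⟩ * χ ⟨elt 16, elt_sixteen_mem⟩ = 1 := by
    rw [← map_mul, ← map_one χ]
    exact congrArg χ (Subtype.ext elt_sixteen_mul_self)
  have h2 : (χ ⟨elt 16, elt_sixteen_mem⟩ + 1) ^ 2 = 0 := by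
    linear_combination h + (χ ⟨elt 16, elt_sixteen_mem⟩ + 1) * CharTwo.two_eq_zero (R := k)
  exact CharTwo.add_eq_zero.mp (pow_eq_zero_iff two_ne_zero |>.mp h2)

variable {ω : k} (hω : ω ^ 2 + ω + 1 = 0)

include hω

lemma exists_rep_one : ∃ ρ : Representation k A5 (Fin 2 → k), IsProjectiveLineRep ω ρ ∧
    ρ cycle123 (linePoint ω 4) = ω ^ 2 • linePoint ω 4 ∧
    ∀ g x, ρ g x 0 • value ω (code 4 codesS 0) + ρ g x 1 • value ω (code 4 codesS 1) =
      MonoidAlgebra.of k A5 g *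
        (x 0 • value ω (code 4 codesS 0) + x 1 • value ω (code 4 codesS 1)) := by
  obtain ⟨h1, h2, h3, h4⟩ := move_codesS_zero
  have hmove (s : Bool) {q : ℕ} (hq : q < 4) := value_code_move ω hq s codesS
  refine exists_isProjectiveLineRep hω (value_code_ne_zero ω hω (code_codesS_ne_zero 0))
    (value_code_ne_zero ω hω (code_codesS_ne_zero 1)) ?_ ?_ ?_ ?_
  · rw [← hmove false (by omega), h1, value_codeRot ω hω]
  · rw [← hmove false (by omega), h2, value_codeRot ω hω, value_codeRot ω hω, value_codeAdd,
      smul_smul, pow_two]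
  · rw [← hmove true (by omega), h3, value_codeRot ω hω]
  · rw [← hmove true (by omega), h4, value_codeRot ω hω, value_codeRot ω hω, smul_smul, pow_two]

lemma exists_rep_two : ∃ ρ : Representation k A5 (Fin 2 → k), IsProjectiveLineRep (ω ^ 2) ρ ∧
    ρ cycle123 (linePoint (ω ^ 2) 4) = (ω ^ 2) ^ 2 • linePoint (ω ^ 2) 4 ∧
    ∀ g x, ρ g x 0 • value ω (code 4 codesS 2) + ρ g x 1 • value ω (code 4 codesS 3) =
      MonoidAlgebra.of k A5 g *
        (x 0 • value ω (code 4 codesS 2) + x 1 • value ω (code 4 codesS 3)) := by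
  obtain ⟨h1, h2, h3, h4⟩ := move_codesS_two
  have hmove (s : Bool) {q : ℕ} (hq : q < 4) := value_code_move ω hq s codesS
  have h5 : (ω ^ 2) ^ 2 = ω := by linear_combination ω * pow_three_eq_one hω
  refine exists_isProjectiveLineRep (square_root_eq hω)
    (value_code_ne_zero ω hω (code_codesS_ne_zero 2))
    (value_code_ne_zero ω hω (code_codesS_ne_zero 3)) ?_ ?_ ?_ ?_
  · rw [← hmove false (by omega), h1, value_codeRot ω hω, value_codeRot ω hω, smul_smul, pow_two]
  · rw [← hmove false (by omega), h2, value_codeRot ω hω, value_codeAdd, h5]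
  · rw [← hmove true (by omega), h3, value_codeRot ω hω, value_codeRot ω hω, smul_smul, pow_two]
  · rw [← hmove true (by omega), h4, value_codeRot ω hω, h5]

/-- A representation on `k²` that is realised by two elements of the group algebra is simple if one
of the idempotents does not kill the first of them. -/
lemma isTop_of_realised {i : Fin 4} (hi : IdempotentFrame.dim label i = 2)
    {ρ : Representation k A5 (Fin 2 → k)} {w₀ w₁ : k[A5]}
    (h : ∀ g x, ρ g x 0 • w₀ + ρ g x 1 • w₁ =
      MonoidAlgebra.of k A5 g * (x 0 • w₀ + x 1 • w₁)) (hw : (frame hω).e i * w₀ ≠ 0) :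
    (frame hω).IsTop i ρ.asModule := by
  let f : (Fin 2 → k) →ₗ[k] k[A5] :=
    (LinearMap.proj 0).smulRight w₀ + (LinearMap.proj 1).smulRight w₁
  have hf := ρ.map_smul_of_intertwines f h
  let x : ρ.asModule := ρ.asModuleEquiv.symm ![1, 0]
  have hx : f (ρ.asModuleEquiv x) = w₀ := by simp [x, f]
  refine (frame hω).isTop_of_finrank_eq k (x := (frame hω).e i • x) (fun h0 => hw ?_) ?_ ?_
  · rw [← hx, ← smul_eq_mul, ← hf, h0, map_zero, map_zero]
  · rw [smul_smul, (frame hω).e_mul_e]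
  · rw [hi, ρ.asModuleEquiv.finrank_eq, Module.finrank_fin_fun]

lemma e_one_mul_ne_zero : (frame hω).e 1 * value ω (code 4 codesS 0) ≠ 0 := by
  change value ω (code 9 codesU 1) * _ ≠ 0
  rw [← value_products hω (by omega)]
  obtain ⟨l, hl⟩ := products_codesU_codesS (1, 0) (by decide)
  exact value_ne_zero ω hω l.2 hl

lemma e_two_mul_ne_zero : (frame hω).e 2 * value ω (code 4 codesS 2) ≠ 0 := by
  change value ω (code 9 codesU 3) * _ ≠ 0
  rw [← value_products hω (by omega)]
  obtain ⟨l, hl⟩ := products_codesU_codesS (3, 2) (by decide)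
  exact value_ne_zero ω hω l.2 hl

/-- A one-dimensional module has no room for a label of dimension greater than `1`. -/
lemma isTop_trivial : (frame hω).IsTop 0 (Representation.trivial k A5 k).asModule := by
  have hfin : Module.finrank k (Representation.trivial k A5 k).asModule = 1 :=
    (Representation.trivial k A5 k).asModuleEquiv.finrank_eq.trans (Module.finrank_self k)
  have : Nontrivial (Representation.trivial k A5 k).asModule :=
    Module.nontrivial_of_finrank_pos (R := k) (by omega)
  obtain ⟨i, x, hx, hi⟩ :=
    (frame hω).exists_homogeneous (M := (Representation.trivial k A5 k).asModule)
  have h1 := (frame hω).dim_le_finrank (k := k) hx hi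
  have h0 : i = 0 := by
    rw [hfin] at h1
    revert h1
    clear hi
    revert i
    decide
  subst h0
  exact (frame hω).isTop_of_finrank_eq k hx hi (by rw [hfin]; decide)

/-- The five elements `codeF` are permuted by `A₅`, so the permutation module maps to the group
algebra. The vector `(1, 1, 0, 0, 0)` goes to `u 5 + u 6`, which `e 3 = v 5` sends to the nonzero `e
3`; the dimension `4` then gives simplicity. -/
lemma isTop_sumZero : (frame hω).IsTop 3 (sumZeroSubrep k).toRepresentation.asModule := by
  let f : (sumZeroSubrep k).toSubmodule →ₗ[k] k[A5] :=
    (Fintype.linearCombination k fun i => value ω (codeF codesU i)) ∘ₗ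
      (sumZeroSubrep k).toSubmodule.subtype
  have hf := (sumZeroSubrep k).toRepresentation.map_smul_of_intertwines f (by
    intro g x
    have h1 : f x = ∑ i, (x : Fin 5 → k) i • value ω (codeF codesU i) := rfl
    have h2 : f ((sumZeroSubrep k).toRepresentation g x) =
      ∑ i, (x : Fin 5 → k) (((g⁻¹ : A5) : Equiv.Perm (Fin 5)) i) • value ω (codeF codesU i) := rfl
    rw [h1, h2, smul_eq_mul, Finset.mul_sum, ← Equiv.sum_comp (g : Equiv.Perm (Fin 5))]
    refine Finset.sum_congr rfl fun i _ => ?_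
    rw [mul_smul_comm, of_mul_value_codeF]
    simp)
  let x : (sumZeroSubrep k).toRepresentation.asModule :=
    (sumZeroSubrep k).toRepresentation.asModuleEquiv.symm ⟨![1, 1, 0, 0, 0], by
      change _ ∈ LinearMap.ker _
      simp [LinearMap.mem_ker, Fin.sum_univ_succ, CharTwo.add_self_eq_zero]⟩
  have hx : f ((sumZeroSubrep k).toRepresentation.asModuleEquiv x) =
      (frame hω).u 5 + (frame hω).u 6 := by
    change ∑ i, (![1, 1, 0, 0, 0] : Fin 5 → k) i • value ω (codeF codesU i) = _
    simp [Fin.sum_univ_succ]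
    rfl
  have he : (frame hω).e 3 * ((frame hω).u 5 + (frame hω).u 6) = (frame hω).e 3 := by
    have h5 := (frame hω).v_mul_u 5 5
    have h6 := (frame hω).v_mul_u 5 6
    rw [if_pos rfl] at h5
    rw [if_neg (by decide)] at h6
    have hv : (frame hω).v 5 = (frame hω).e 3 := (frame hω).v_base 3
    rw [hv] at h5 h6
    rw [mul_add, h5, h6, add_zero]
    rfl
  refine (frame hω).isTop_of_finrank_eq k (x := (frame hω).e 3 • x)
    (fun h0 => (frame hω).e_ne_zero 3 ?_) ?_ ?_
  · rw [← he, ← hx, ← smul_eq_mul, ← hf, h0, map_zero, map_zero]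
  · rw [smul_smul, (frame hω).e_mul_e]
  · rw [(sumZeroSubrep k).toRepresentation.asModuleEquiv.finrank_eq, finrank_sumZero]
    decide

/-! ### Generators of the induced modules -/

/-- An eigenvector of `A₄` that generates a module yields a generator in the part of an
idempotent. -/
lemma exists_generator {i : Fin 4} {j : ℕ} {η : k} (hj : j ∈ [0, 3])
    (he : (frame hω).e i * value ω (code 6 codesY j) = value ω (code 6 codesY j))
    (h1 : value ω (code 6 codesY (j + 1)) =
      MonoidAlgebra.of k A5 cycle123 + η • (1 : k[A5]))
    (h2 : value ω (code 6 codesY (j + 2)) = MonoidAlgebra.of k A5 (elt 16) + 1)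
    {M : Type*} [AddCommGroup M] [Module k M] [Module k[A5] M] [IsScalarTower k k[A5] M] {t : M}
    (ht : Submodule.span k[A5] {t} = ⊤) (hb : MonoidAlgebra.of k A5 cycle123 • t = η • t)
    (hx : MonoidAlgebra.of k A5 (elt 16) • t = t) :
    ∃ x : M, (frame hω).e i • x = x ∧ Submodule.span k[A5] {x} = ⊤ := by
  have hlt : j + 2 < 6 := by
    simp only [List.mem_cons, List.not_mem_nil, or_false] at hj
    omega
  have hone := congrArg (value ω) (products_codesX j hj)
  rw [value_one, value_codeAdd, value_codeAdd, value_products hω (by omega),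
    value_products hω (by omega), value_products hω hlt, h1, h2] at hone
  have h2' (y : M) : y + y = 0 := by
    rw [← two_smul k, CharTwo.two_eq_zero, zero_smul]
  -- In characteristic `2` the factors `c + η` and `s + 1` kill `t`, leaving `x • y • t = t`. So `y
  -- • t`, which is homogeneous, still generates.
  have ht' := congrArg (· • t) hone
  simp only [add_smul, mul_smul, hb, hx, one_smul, smul_assoc, h2', smul_zero, add_zero] at ht'
  refine ⟨value ω (code 6 codesY j) • t, by rw [smul_smul, he], ?_⟩
  rw [eq_top_iff, ← ht, Submodule.span_singleton_le_iff_mem]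
  exact Submodule.mem_span_singleton.mpr ⟨_, ht'⟩

lemma exists_generator_two {χ : A4 →* k} (hχ : χ cycle123' = ω) :
    ∃ x : IndA5 (characterRep χ), (frame hω).e 2 • x = x ∧ Submodule.span k[A5] {x} = ⊤ := by
  obtain ⟨h1, h2, -, -⟩ := code_codesY
  have he : (frame hω).e 2 * value ω (code 6 codesY 0) = value ω (code 6 codesY 0) := by
    change value ω (code 9 codesU 3) * _ = _
    exact value_mul hω (by omega) products_codesU_codesY.1
  refine exists_generator hω (i := 2) (j := 0) (η := ω) (by decide)
    he ?_ ?_ (span_indGen χ) ?_ ?_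
  · rw [h1, value_codeAdd, value_two_pow ω (l := 48) (by omega), value_codeRot ω hω, value_one,
      elt_forty_eight]
  · rw [h2, value_codeAdd, value_two_pow ω (l := 16) (by omega), value_one]
  · rw [← hχ]
    exact of_smul_indGen_of_mem χ cycle123'
  · have := of_smul_indGen_of_mem χ ⟨elt 16, elt_sixteen_mem⟩
    rwa [character_elt_sixteen, one_smul] at this

lemma exists_generator_one {χ : A4 →* k} (hχ : χ cycle123' = ω ^ 2) :
    ∃ x : IndA5 (characterRep χ), (frame hω).e 1 • x = x ∧ Submodule.span k[A5] {x} = ⊤ := by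
  obtain ⟨-, -, h1, h2⟩ := code_codesY
  have he : (frame hω).e 1 * value ω (code 6 codesY 3) = value ω (code 6 codesY 3) := by
    change value ω (code 9 codesU 1) * _ = _
    exact value_mul hω (by omega) products_codesU_codesY.2
  refine exists_generator hω (i := 1) (j := 3) (η := ω ^ 2) (by decide)
    he ?_ ?_ (span_indGen χ) ?_ ?_
  · rw [h1, value_codeAdd, value_two_pow ω (l := 48) (by omega), value_codeRot ω hω,
      value_codeRot ω hω, value_one, elt_forty_eight, smul_smul, pow_two]
  · rw [h2, value_codeAdd, value_two_pow ω (l := 16) (by omega), value_one]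
  · rw [← hχ]
    exact of_smul_indGen_of_mem χ cycle123'
  · have := of_smul_indGen_of_mem χ ⟨elt 16, elt_sixteen_mem⟩
    rwa [character_elt_sixteen, one_smul] at this

end Modules

variable (k) in
lemma finrank_groupAlgebra : Module.finrank k k[A5] = 60 := by
  rw [Module.finrank_eq_card_basis (MonoidAlgebra.basis A5 k), card_eq]

end A5

section Head

variable {k A : Type*} [Field k] [Ring A] [Algebra k A] {P I : Type*} [Fintype P] [DecidableEq P]
  {σ : P → I} {F : IdempotentFrame A σ}

/-- The head of an indecomposable projective module. -/
lemma IdempotentFrame.IsSplit.isTop_radLayer_zero (h : F.IsSplit k) {i : I} (hi : F.e i ≠ 0) :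
    F.IsTop i (RadLayer A (F.proj i) 0) := by
  have hJ : radSeries A (F.proj i) 1 = (Ring.jacobson A).submoduleOf (F.proj i) := by
    rw [radSeries_one]
    exact le_antisymm (sInf_le (h.isCoatom hi)) (le_sInf fun N hN => (h.eq_of_isCoatom hN).ge)
  refine (h.isTop_proj_quotient hi).congr ?_
  refine (Submodule.Quotient.equiv _ _ Submodule.topEquiv ?_).symm
  ext x
  simp only [zero_add, hJ]
  constructor
  · rintro ⟨y, hy, rfl⟩
    exact hy
  · exact fun hx => ⟨⟨x, Submodule.mem_top⟩, hx, rfl⟩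

end Head

/-! ### Uniserial modules for both labels and the heart -/

namespace QuiverFrame

variable {k A : Type*} [Field k] [Ring A] [Algebra k A] (Q : QuiverFrame A)
  (hA : Module.finrank k A = 60)

include hA

lemma uniserial_proj_one : IsUniserialModule A (Q.proj 1) ∧ radSeries A (Q.proj 1) 5 = ⊥ ∧
    ∀ n : Fin 5, Q.IsTop (![1, 0, 2, 0, 1] n) (RadLayer A (Q.proj 1) n) := by
  have : Module.Finite k A := Module.finite_of_finrank_pos (by omega)
  have : Module.Finite k (Q.proj 1) := (Q.proj 1).finite_of_tower (k := k)
  have h := Q.isRadChain_proj hA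
  refine ⟨h.isUniserialModule Q.span_word_zero_smul_gen,
    h.radSeries_eq_bot Q.span_word_zero_smul_gen, fun n => ?_⟩
  have hn := h.isTop_radLayer Q.span_word_zero_smul_gen n.2
  fin_cases n <;> exact hn

lemma uniserial_proj_two : IsUniserialModule A (Q.proj 2) ∧ radSeries A (Q.proj 2) 5 = ⊥ ∧
    ∀ n : Fin 5, Q.IsTop (![2, 0, 1, 0, 2] n) (RadLayer A (Q.proj 2) n) := by
  obtain ⟨h1, h2, h3⟩ := Q.swap.uniserial_proj_one hA
  refine ⟨h1, h2, fun n => ?_⟩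
  have hn := h3 n
  fin_cases n <;> exact hn

section Generated

variable {M : Type*} [AddCommGroup M] [Module A M] [Module k M] [IsScalarTower k A M]

lemma uniserial_of_e_one [Module.Finite k M] {x : M} (hx : Q.e 1 • x = x)
    (hspan : Submodule.span A {x} = ⊤)
    (hM : Module.finrank k M = 5) : IsUniserialModule A M ∧ radSeries A M 3 = ⊥ ∧
    ∀ n : Fin 3, Q.IsTop (![1, 0, 2] n) (RadLayer A M n) := by
  have h := Q.isRadChain_of_finrank_eq hA hx hspan hM
  have h0 : Submodule.span A {Q.word 0 • x} = ⊤ := by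
    rwa [show Q.word 0 • x = x from hx]
  refine ⟨h.isUniserialModule h0, h.radSeries_eq_bot h0, fun n => ?_⟩
  have hn := h.isTop_radLayer h0 n.2
  fin_cases n <;> exact hn

lemma uniserial_of_e_two [Module.Finite k M] {x : M} (hx : Q.e 2 • x = x)
    (hspan : Submodule.span A {x} = ⊤)
    (hM : Module.finrank k M = 5) : IsUniserialModule A M ∧ radSeries A M 3 = ⊥ ∧
    ∀ n : Fin 3, Q.IsTop (![2, 0, 1] n) (RadLayer A M n) := by
  obtain ⟨h1, h2, h3⟩ := Q.swap.uniserial_of_e_one hA hx hspan hM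
  refine ⟨h1, h2, fun n => ?_⟩
  have hn := h3 n
  fin_cases n <;> exact hn

lemma nonempty_moduleHeart_equiv_of_generated {M' : Type*} [AddCommGroup M'] [Module A M']
    [Module k M'] [IsScalarTower k A M'] {x : M} {x' : M'} (hx : Q.e 2 • x = x)
    (hspan : Submodule.span A {x} = ⊤) (hM : Module.finrank k M = 5) (hx' : Q.e 1 • x' = x')
    (hspan' : Submodule.span A {x'} = ⊤) (hM' : Module.finrank k M' = 5) :
    Nonempty (ModuleHeart A (Q.proj 0) ≃ₗ[A] M × M') := by
  obtain ⟨f⟩ := Q.nonempty_moduleHeart_equiv hA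
  obtain ⟨g⟩ := Q.swap.nonempty_equiv_arm_quotient hA hx hspan hM
  obtain ⟨g'⟩ := Q.nonempty_equiv_arm_quotient hA hx' hspan' hM'
  exact ⟨f.trans (g.prodCongr g')⟩

end Generated

end QuiverFrame

/-! ### The structure of `k A₅` -/

set_option maxHeartbeats 1000000 in
theorem mainTheorem3 (k : Type u) [Field k] [IsAlgClosed k] [CharP k 2]
    (ω : k) (hω : ω ^ 2 + ω + 1 = 0) :
    ∃ (ρ₂ ρ₃ : Representation k A5 (Fin 2 → k)) (τ₂ τ₃ : Representation k A4 k)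
      (S : Fin 4 → Rep k A5) (P : Fin 4 → Ideal k[A5]),
      -- the representations that define `S₁, S₂, S₃, S₄` and `T₂, T₃`
      (IsProjectiveLineRep ω ρ₂ ∧ IsProjectiveLineRep (ω ^ 2) ρ₃ ∧ S = fourReps ρ₂ ρ₃) ∧
      (τ₂ cycle123' = ω • LinearMap.id ∧ τ₃ cycle123' = ω ^ 2 • LinearMap.id) ∧
      -- `S₁, S₂, S₃, S₄` are the simple modules, each up to isomorphism exactly once
      ((∀ i, IsSimpleModule k[A5] (S i).ρ.asModule) ∧
        (∀ i, Module.finrank k (S i).ρ.asModule = ![1, 2, 2, 4] i) ∧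
        (∀ i j, Nonempty ((S i).ρ.asModule ≃ₗ[k[A5]] (S j).ρ.asModule) → i = j) ∧
        (∀ (M : Type v) [AddCommGroup M] [Module k[A5] M], IsSimpleModule k[A5] M →
          ∃ i, Nonempty (M ≃ₗ[k[A5]] (S i).ρ.asModule))) ∧
      -- `P₁, P₂, P₃, P₄` are the projective indecomposables, each exactly once; `Pᵢ` has head `Sᵢ`
      ((∀ i, Module.Projective k[A5] (P i) ∧ IsIndecomposableModule k[A5] (P i)) ∧
        (∀ i, Nonempty (RadLayer k[A5] (P i) 0 ≃ₗ[k[A5]] (S i).ρ.asModule)) ∧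
        (∀ i, Module.finrank k (P i) = ![12, 8, 8, 4] i) ∧
        (∀ i j, Nonempty (P i ≃ₗ[k[A5]] P j) → i = j) ∧
        (∀ (M : Type v) [AddCommGroup M] [Module k[A5] M], Module.Finite k[A5] M →
          Module.Projective k[A5] M → IsIndecomposableModule k[A5] M →
          ∃ i, Nonempty (M ≃ₗ[k[A5]] P i))) ∧
      -- the decomposition of the regular module
      Nonempty (k[A5] ≃ₗ[k[A5]]
        (P 0 × (Fin 2 → P 1) × (Fin 2 → P 2) × (Fin 4 → P 3))) ∧
      -- `P₄ = S₄`
      Nonempty (P 3 ≃ₗ[k[A5]] (S 3).ρ.asModule) ∧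
      -- `P₂` is uniserial with layers `S₂, S₁, S₃, S₁, S₂`
      (IsUniserialModule k[A5] (P 1) ∧ radSeries k[A5] (P 1) 5 = ⊥ ∧
        ∀ n : Fin 5, Nonempty (RadLayer k[A5] (P 1) n ≃ₗ[k[A5]]
          (S (![1, 0, 2, 0, 1] n)).ρ.asModule)) ∧
      -- `P₃` is uniserial with layers `S₃, S₁, S₂, S₁, S₃`
      (IsUniserialModule k[A5] (P 2) ∧ radSeries k[A5] (P 2) 5 = ⊥ ∧
        ∀ n : Fin 5, Nonempty (RadLayer k[A5] (P 2) n ≃ₗ[k[A5]]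
          (S (![2, 0, 1, 0, 2] n)).ρ.asModule)) ∧
      -- the modules induced from `T₂` and `T₃`
      (IsUniserialModule k[A5] (IndA5 τ₂) ∧ radSeries k[A5] (IndA5 τ₂) 3 = ⊥ ∧
        ∀ n : Fin 3, Nonempty (RadLayer k[A5] (IndA5 τ₂) n ≃ₗ[k[A5]]
          (S (![2, 0, 1] n)).ρ.asModule)) ∧
      (IsUniserialModule k[A5] (IndA5 τ₃) ∧ radSeries k[A5] (IndA5 τ₃) 3 = ⊥ ∧
        ∀ n : Fin 3, Nonempty (RadLayer k[A5] (IndA5 τ₃) n ≃ₗ[k[A5]]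
          (S (![1, 0, 2] n)).ρ.asModule)) ∧
      -- `P₁`: its socle, `rad P₁ / soc P₁`, and its radical layers
      (Nonempty (moduleSocle k[A5] (P 0) ≃ₗ[k[A5]] (S 0).ρ.asModule) ∧
        moduleSocle k[A5] (P 0) ≤ Module.jacobson k[A5] (P 0) ∧
        Nonempty (ModuleHeart k[A5] (P 0) ≃ₗ[k[A5]] IndA5 τ₂ × IndA5 τ₃) ∧
        radSeries k[A5] (P 0) 5 = ⊥ ∧
        Nonempty (RadLayer k[A5] (P 0) 1 ≃ₗ[k[A5]] (S 2).ρ.asModule × (S 1).ρ.asModule) ∧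
        Nonempty (RadLayer k[A5] (P 0) 2 ≃ₗ[k[A5]] (S 0).ρ.asModule × (S 0).ρ.asModule) ∧
        Nonempty (RadLayer k[A5] (P 0) 3 ≃ₗ[k[A5]] (S 1).ρ.asModule × (S 2).ρ.asModule) ∧
        Nonempty (RadLayer k[A5] (P 0) 4 ≃ₗ[k[A5]] (S 0).ρ.asModule)) ∧
      -- the Cartan matrix
      (∀ i j, HasMultiplicity k[A5] (P j) (S i).ρ.asModule (cartanA5 i j)) ∧
      -- the two blocks
      ((blocks k[A5]).ncard = 2 ∧
        ∃ e₁ e₂ : k[A5], IsBlockIdempotent e₁ ∧ IsBlockIdempotent e₂ ∧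
          e₁ * e₂ = 0 ∧ e₁ + e₂ = 1 ∧
          blocks k[A5] = {Ideal.span {e₁}, Ideal.span {e₂}} ∧
          IsCompl (Ideal.span {e₁}) (Ideal.span {e₂}) ∧
          (∀ i, i ≠ 3 → ∀ x ∈ P i, e₁ * x = x) ∧ (∀ x ∈ P 3, e₂ * x = x) ∧
          (∀ x : (S 0).ρ.asModule, e₁ • x = x) ∧
          ∀ (n : ℕ) (f : Fin n → k[A5]), CompleteOrthogonalIdempotents f →
            (∀ t, IsPrimitiveIdempotent (f t)) →
            e₁ = ∑ᶠ (t) (_ : ∃ i, i ≠ 3 ∧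
              Nonempty (Ideal.span {f t} ≃ₗ[k[A5]] P i)), f t ∧
            e₂ = ∑ᶠ (t) (_ : Nonempty (Ideal.span {f t} ≃ₗ[k[A5]] P 3)), f t) := by
  have hA := A5.finrank_groupAlgebra k
  obtain ⟨ρ₂, hρ₂, hcyc₂, hint₂⟩ := A5.exists_rep_one hω
  obtain ⟨ρ₃, hρ₃, hcyc₃, hint₃⟩ := A5.exists_rep_two hω
  -- The indices cross over: the three-cycle acts on the line fixed by `A₄` by the square of the
  -- parameter, and `(ω ^ 2) ^ 2 = ω`.
  obtain ⟨χ₂, hχ₂⟩ := hρ₃.exists_character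
  obtain ⟨χ₃, hχ₃⟩ := hρ₂.exists_character
  have hval₂ : χ₂ cycle123' = ω := by
    have h5 : (ω ^ 2) ^ 2 = ω := by linear_combination ω * A5.pow_three_eq_one hω
    rw [← h5]
    exact smul_left_injective k (linePoint_ne_zero _ 4) ((hχ₂ cycle123').symm.trans hcyc₃)
  have hval₃ : χ₃ cycle123' = ω ^ 2 :=
    smul_left_injective k (linePoint_ne_zero _ 4) ((hχ₃ cycle123').symm.trans hcyc₂)
  have hS : ∀ i, (A5.frame hω).IsTop i (fourReps ρ₂ ρ₃ i).ρ.asModule := by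
    intro i
    fin_cases i
    · exact A5.isTop_trivial hω
    · exact A5.isTop_of_realised hω (by decide) hint₂ (A5.e_one_mul_ne_zero hω)
    · exact A5.isTop_of_realised hω (by decide) hint₃ (A5.e_two_mul_ne_zero hω)
    · exact A5.isTop_sumZero hω
  obtain ⟨hfin₂, hdim₂⟩ := A5.finrank_indA5 χ₂ hχ₂
  obtain ⟨hfin₃, hdim₃⟩ := A5.finrank_indA5 χ₃ hχ₃
  obtain ⟨x₂, hx₂, hspan₂⟩ := A5.exists_generator_two hω hval₂
  obtain ⟨x₃, hx₃, hspan₃⟩ := A5.exists_generator_one hω hval₃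
  -- From here on only the relations of the frame matter, not its coded entries.
  generalize A5.frame hω = Q at hS hx₂ hx₃
  have hQ : Q.IsSplit k := Q.isSplit hA
  have : Module.Finite k k[A5] := Module.finite_of_finrank_pos (by omega)
  have hfin (i : Fin 4) : Module.Finite k (Q.proj i) := (Q.proj i).finite_of_tower (k := k)
  have toS {i : Fin 4} {M : Type u} [AddCommGroup M] [Module k[A5] M] (h : Q.IsTop i M) :
      Nonempty (M ≃ₗ[k[A5]] (fourReps ρ₂ ρ₃ i).ρ.asModule) := hQ.nonempty_equiv h (hS i)
  have toSS {i j : Fin 4} {L M N : Type u} [AddCommGroup L] [Module k[A5] L] [AddCommGroup M]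
      [Module k[A5] M] [AddCommGroup N] [Module k[A5] N] (h : Nonempty (L ≃ₗ[k[A5]] M × N))
      (hM : Q.IsTop i M) (hN : Q.IsTop j N) : Nonempty (L ≃ₗ[k[A5]]
        (fourReps ρ₂ ρ₃ i).ρ.asModule × (fourReps ρ₂ ρ₃ j).ρ.asModule) := by
    obtain ⟨f⟩ := h
    obtain ⟨g⟩ := toS hM
    obtain ⟨g'⟩ := toS hN
    exact ⟨f.trans (g.prodCongr g')⟩
  refine ⟨ρ₂, ρ₃, characterRep χ₂, characterRep χ₃, fourReps ρ₂ ρ₃, Q.proj, ⟨hρ₂, hρ₃, rfl⟩,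
    ⟨?_, ?_⟩, ⟨fun i => (hS i).1, ?_, ?_, ?_⟩, ⟨?_, ?_, ?_, ?_, ?_⟩, Q.nonempty_regular_equiv hA,
    ?_, ⟨?_, ?_, ?_⟩, ⟨?_, ?_, ?_⟩, ⟨?_, ?_, ?_⟩, ⟨?_, ?_, ?_⟩, ⟨?_, ?_, ?_, ?_, ?_, ?_, ?_, ?_⟩,
    ?_, ?_, Q.blockOne, Q.blockTwo, ?_, ?_, ?_, ?_, ?_, ?_, ?_, ?_, ?_, ?_⟩
  · exact congrArg (· • LinearMap.id) hval₂
  · exact congrArg (· • LinearMap.id) hval₃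
  · intro i
    rw [(fourReps ρ₂ ρ₃ i).ρ.asModuleEquiv.finrank_eq]
    fin_cases i
    · exact Module.finrank_self k
    · exact Module.finrank_fin_fun k
    · exact Module.finrank_fin_fun k
    · exact A5.finrank_sumZero k
  · rintro i j ⟨f⟩
    exact hQ.label_unique ((hS i).congr f) (hS j)
  · intro M _ _ hM
    obtain ⟨i, hi⟩ := Q.exists_isTop (M := M)
    exact ⟨i, hQ.nonempty_equiv hi (hS i)⟩
  · exact fun i => ⟨Q.projective_proj i, hQ.isIndecomposableModule_proj (Q.e_ne_zero i)⟩
  · exact fun i => toS (hQ.isTop_radLayer_zero (Q.e_ne_zero i))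
  · exact Q.finrank_proj hA
  · rintro i j ⟨f⟩
    -- Isomorphic projectives have equal columns in the Cartan matrix, and its columns are distinct.
    have h (l : Fin 4) : cartanA5 l i = cartanA5 l j := by
      rw [← Q.finrank_corner hA, ← Q.finrank_corner hA, ← Q.finrank_part_proj,
        ← Q.finrank_part_proj, Q.finrank_part_congr f]
    clear f
    revert i j
    decide
  · intro M _ _ _ _ hM
    exact hQ.exists_equiv_proj hM
  · refine toS (Q.isTop_of_finrank_eq k (x := Q.gen 3) ?_ (Q.e_smul_gen 3) ?_)
    · intro h
      exact Q.e_ne_zero 3 (congrArg Subtype.val h)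
    · rw [Q.finrank_proj hA]
      decide
  · exact (Q.uniserial_proj_one hA).1
  · exact (Q.uniserial_proj_one hA).2.1
  · exact fun n => toS ((Q.uniserial_proj_one hA).2.2 n)
  · exact (Q.uniserial_proj_two hA).1
  · exact (Q.uniserial_proj_two hA).2.1
  · exact fun n => toS ((Q.uniserial_proj_two hA).2.2 n)
  · exact (Q.uniserial_of_e_two hA hx₂ hspan₂ hdim₂).1
  · exact (Q.uniserial_of_e_two hA hx₂ hspan₂ hdim₂).2.1
  · exact fun n => toS ((Q.uniserial_of_e_two hA hx₂ hspan₂ hdim₂).2.2 n)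
  · exact (Q.uniserial_of_e_one hA hx₃ hspan₃ hdim₃).1
  · exact (Q.uniserial_of_e_one hA hx₃ hspan₃ hdim₃).2.1
  · exact fun n => toS ((Q.uniserial_of_e_one hA hx₃ hspan₃ hdim₃).2.2 n)
  · rw [Q.moduleSocle_proj_zero hA]
    exact toS (Q.isTop_arm_three hA)
  · exact Q.moduleSocle_le_jacobson hA
  · exact Q.nonempty_moduleHeart_equiv_of_generated hA hx₂ hspan₂ hdim₂ hx₃ hspan₃ hdim₃
  · exact Q.radSeries_proj_zero_five hA
  · exact toSS (i := 2) (j := 1) (Q.nonempty_radLayer_proj_zero_equiv hA (t := 0) (by omega))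
      (Q.isTop_coarm hA (t := 0) (by omega)) (Q.isTop_arm hA (t := 0) (by omega))
  · exact toSS (i := 0) (j := 0) (Q.nonempty_radLayer_proj_zero_equiv hA (t := 1) (by omega))
      (Q.isTop_coarm hA (t := 1) (by omega)) (Q.isTop_arm hA (t := 1) (by omega))
  · exact toSS (i := 1) (j := 2) (Q.nonempty_radLayer_proj_zero_equiv hA (t := 2) (by omega))
      (Q.isTop_coarm hA (t := 2) (by omega)) (Q.isTop_arm hA (t := 2) (by omega))
  · exact toS (Q.isTop_radLayer_proj_zero_four hA)
  · intro i j
    have := hQ.hasMultiplicity (M := Q.proj j) (hS i)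
    rwa [Q.finrank_part_proj, Q.finrank_corner hA] at this
  · rw [blocks_eq_pair (Q.isBlockIdempotent_blockOne hA) (Q.isBlockIdempotent_blockTwo hA)
      Q.blockOne_mul_blockTwo Q.blockOne_add_blockTwo]
    -- If the two ideals coincided, `blockOne = a * blockTwo` would give `blockOne = blockOne *
    -- blockOne = 0`, against `e 0 ≠ 0`.
    refine Set.ncard_pair fun h => Q.e_ne_zero 0 ?_
    obtain ⟨a, ha⟩ := Ideal.mem_span_singleton'.mp (h ▸ Ideal.subset_span rfl :
      Q.blockOne ∈ Ideal.span {Q.blockTwo})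
    have h0 := Q.blockOne_mul_self
    nth_rw 1 [← ha] at h0
    rw [mul_assoc, Q.blockTwo_mul_blockOne, mul_zero] at h0
    rw [← Q.e_mul_blockOne 0 (by decide), ← h0, mul_zero]
  · exact Q.isBlockIdempotent_blockOne hA
  · exact Q.isBlockIdempotent_blockTwo hA
  · exact Q.blockOne_mul_blockTwo
  · exact Q.blockOne_add_blockTwo
  · exact blocks_eq_pair (Q.isBlockIdempotent_blockOne hA) (Q.isBlockIdempotent_blockTwo hA)
      Q.blockOne_mul_blockTwo Q.blockOne_add_blockTwo
  · exact isCompl_span_of_add_eq_one Q.blockOne_mul_self Q.blockTwo_mul_blockOne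
      Q.blockOne_add_blockTwo
  · exact fun i hi x hx => Q.blockOne_mul_of_mem_proj hA hi hx
  · exact fun x hx => Q.blockTwo_mul_of_mem_proj hA hx
  · exact Q.blockOne_smul hA (hS 0)
  · exact fun n f hf hprim => ⟨Q.blockOne_eq_finsum hA hf hprim, Q.blockTwo_eq_finsum hA hf hprim⟩
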